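/- Let $\theta>0$, $t>0$ and let $N\ge 1$ be an integer. Let $\Lambda$ be the algebra of symmetric functions with real coefficients in countably many variables $x_1,x_2,\dots$, let $p_k=\sum_i x_i^k$, and let $\mathbb Y$ be the set of Young diagrams. For $\lambda\in\mathbb Y$ let $J_\lambda=J_\lambda(\,\cdot\,;\theta)\in\Lambda$ be the Jack symmetric function: the element whose restriction to $n$ variables is, for every $n\ge\ell(\lambda)$, the symmetric polynomial with leading term $x_1^{\lambda_1}\cdots x_n^{\lambda_n}$ (coefficient $1$) satisfying, for all $u$, $$\frac{1}{\prod_{i<j}(x_i-x_j)}\det\Big[x_i^{n-j}\Big(x_i\frac{\partial}{\partial x_i}+(n-j)\theta+u\Big)\Big]_{i,j=1}^n J_\lambda=\prod_{i=1}^n(\lambda_i+(n-i)\theta+u)\; J_\lambda .$$ Put $Q_\lambda=J_\lambda\prod_{\square\in\lambda}\frac{a(\square)+\theta l(\square)+\theta}{a(\square)+\theta l(\square)+1}$, where $a(\square)$, $l(\square)$ are the arm and leg lengths of the box $\square$. Let $1^N:\Lambda\to\mathbb R$ be the algebra homomorphism with $p_k\mapsto N$ for all $k\ge1$, and for $s>0$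 let $\mathfrak r_s:\Lambda\to\mathbb R$ be the algebra homomorphism with $p_1\mapsto s$ and $p_k\mapsto 0$ for $k\ge2$. The Jack measure $\mathcal J_{1^N;\mathfrak r_s}$ on $\mathbb Y$ is $$\mathcal J_{1^N;\mathfrak r_s}(\lambda)=\frac{J_\lambda(1^N)\,Q_\lambda(\mathfrak r_s)}{H_\theta(1^N;\mathfrak r_s)},\qquad H_\theta(\rho_1;\rho_2)=\exp\Big(\sum_{k\ge1}\frac{\theta}{k}\,p_k(\rho_1)p_k(\rho_2)\Big).$$ For $\varepsilon>0$ put $s=\varepsilon^{-1}t/\theta$ and define $y=(y_1,\dots,y_N)$ by $$\lambda_i=\varepsilon^{-1}t+\varepsilon^{-1/2}y_{N+1-i},\qquad i=1,\dots,N.$$ Then $\mathcal J_{1^N;\mathfrak r_s}$ is a probability measure for every $\varepsilon>0$, and, as $\varepsilon\to0$, the law of $y$ under $\lambda\sim\mathcal J_{1^N;\mathfrak r_s}$ converges weakly to the measure on the closed Weyl chamber $\{y\in\mathbb R^N:\ y_1\le y_2\le\dots\le y_N\}$ with density (with respect to Lebesgue measure) $$\frac1Z\prod_{i<j}(y_j-y_i)^{2\theta}\prod_{i=1}^N\exp\Big(-\frac{y_i^2}{2t}\Big),\qquad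 Z=t^{\theta\frac{N(N-1)}2+\frac N2}(2\pi)^{N/2}\prod_{j=1}^N\frac{\Gamma(j\theta)}{\Gamma(\theta)},$$ and this measure is a probability measure. -/

import Mathlib

open MeasureTheory Filter
open scoped Topology

namespace JackMeasures

open MvPolynomial

noncomputable section

/-! ### The algebra of symmetric functions -/

/-- The restriction `x_{n+1} = 0` from polynomials in `n + 1` variables to polynomials in `n`
variables. -/
def restrictLast (n : ℕ) : MvPolynomial (Fin (n + 1)) ℝ →ₐ[ℝ] MvPolynomial (Fin n) ℝ :=
  killCompl (Fin.castSucc_injective n)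

/-- The algebra `Λ` of symmetric functions in countably many variables: the inverse limit, in the
category of graded algebras, of the algebras `Λ^n` of symmetric polynomials in `n` variables along
`x_{n+1} = 0`. So a symmetric function is a compatible sequence of symmetric polynomials of bounded
degree, and `f.1 n` is `f(x_1, …, x_n)` (all the other variables are put equal to zero). -/
def SymFun : Subalgebra ℝ (∀ n : ℕ, MvPolynomial (Fin n) ℝ) where
  carrier := {f | (∀ n, (f n).IsSymmetric) ∧ (∀ n, restrictLast n (f (n + 1)) = f n) ∧
    ∃ d : ℕ, ∀ n, (f n).totalDegree ≤ d}
  mul_mem' := by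
    rintro f g ⟨hf, hf', d, hd⟩ ⟨hg, hg', e, he⟩
    exact ⟨fun n => (hf n).mul (hg n), fun n => by simp [hf', hg'], d + e,
      fun n => (totalDegree_mul _ _).trans (add_le_add (hd n) (he n))⟩
  add_mem' := by
    rintro f g ⟨hf, hf', d, hd⟩ ⟨hg, hg', e, he⟩
    exact ⟨fun n => (hf n).add (hg n), fun n => by simp [hf', hg'], max d e,
      fun n => (totalDegree_add _ _).trans (max_le_max (hd n) (he n))⟩
  algebraMap_mem' := by
    intro r
    exact ⟨fun n => IsSymmetric.C r, fun n => by simp [algebraMap_eq], 0,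
      fun n => by simp [algebraMap_eq]⟩

theorem restrictLast_psum (n k : ℕ) (hk : 1 ≤ k) :
    restrictLast n (psum (Fin (n + 1)) ℝ k) = psum (Fin n) ℝ k := by
  have h1 : ∀ i : Fin n, restrictLast n (X i.castSucc) = X i := fun i => by
    have := killCompl_rename_app (Fin.castSucc_injective n) (X i : MvPolynomial (Fin n) ℝ)
    rwa [rename_X] at this
  have h2 : restrictLast n (X (Fin.last n)) = 0 := by
    unfold restrictLast killCompl
    rw [aeval_X, dif_neg]
    rintro ⟨i, hi⟩
    exact (Fin.castSucc_lt_last i).ne hi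
  rw [psum, Fin.sum_univ_castSucc, map_add, map_sum, map_pow, h2, zero_pow (by omega), add_zero]
  exact Finset.sum_congr rfl fun i _ => by rw [map_pow, h1]

theorem psum_isHomogeneous (n k : ℕ) : (psum (Fin n) ℝ k).IsHomogeneous k :=
  IsHomogeneous.sum _ _ _ fun i _ => isHomogeneous_X_pow i k

/-- The Newton power sum `p_k = ∑ᵢ x_i ^ k` as an element of `Λ`, for `k = j + 1 ≥ 1`. -/
def powerSum (j : ℕ) : SymFun :=
  ⟨fun n => psum (Fin n) ℝ (j + 1), fun n => psum_isSymmetric _ _ _,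
    fun n => restrictLast_psum n (j + 1) (by omega), j + 1,
    fun n => (psum_isHomogeneous n (j + 1)).totalDegree_le⟩

/-- The homomorphism from polynomials in letters `p_1, p_2, …` to symmetric functions. -/
def ofPowerSums : MvPolynomial ℕ ℝ →ₐ[ℝ] SymFun := aeval powerSum

theorem ofPowerSums_val (G : MvPolynomial ℕ ℝ) (n : ℕ) :
    (ofPowerSums G).1 n = aeval (fun j => psum (Fin n) ℝ (j + 1)) G := by
  let ev : SymFun →ₐ[ℝ] MvPolynomial (Fin n) ℝ :=
    (Pi.evalAlgHom ℝ (fun n : ℕ => MvPolynomial (Fin n) ℝ) n).comp SymFun.val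
  have : ev.comp ofPowerSums = aeval (fun j => psum (Fin n) ℝ (j + 1)) := by
    ext1 j
    simp only [AlgHom.comp_apply, ofPowerSums, aeval_X]
    rfl
  exact DFunLike.congr_fun this G

/-- The power sums `p_1, …, p_n` in `n` variables. -/
def finPsum (n : ℕ) : MvPolynomial (Fin n) ℝ →ₐ[ℝ] symmetricSubalgebra (Fin n) ℝ :=
  aeval fun i => ⟨psum (Fin n) ℝ (i + 1), psum_isSymmetric _ _ _⟩

theorem finPsum_val (n : ℕ) (p : MvPolynomial (Fin n) ℝ) :
    (finPsum n p).1 = aeval (fun i : Fin n => psum (Fin n) ℝ (i + 1)) p :=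
  (Subalgebra.mvPolynomial_aeval_coe _ _ _).symm

theorem finPsum_surjective (n : ℕ) : Function.Surjective (finPsum n) := by
  have key : ∀ k, k ≤ n →
      ∃ p, (finPsum n p).1 = esymm (Fin n) ℝ k := by
    intro k
    induction k using Nat.strong_induction_on with
    | _ k ih =>
      intro hk
      rcases Nat.eq_zero_or_pos k with rfl | hpos
      · exact ⟨1, by simp⟩
      have hmem : ∑ a ∈ (Finset.HasAntidiagonal.antidiagonal k : Finset (ℕ × ℕ)).filter (fun a => a.1 < k),
          (-1) ^ a.1 * esymm (Fin n) ℝ a.1 * psum (Fin n) ℝ a.2 ∈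
          ((symmetricSubalgebra (Fin n) ℝ).val.comp (finPsum n)).range := by
        refine Subalgebra.sum_mem _ fun a ha => ?_
        rw [Finset.mem_filter, Finset.HasAntidiagonal.mem_antidiagonal] at ha
        refine Subalgebra.mul_mem _ (Subalgebra.mul_mem _ ?_ ?_) ?_
        · exact Subalgebra.pow_mem _ (Subalgebra.neg_mem _ (Subalgebra.one_mem _)) _
        · obtain ⟨p, hp⟩ := ih a.1 ha.2 (by omega)
          exact ⟨p, hp⟩
        · refine ⟨X ⟨a.2 - 1, by omega⟩, ?_⟩
          change (finPsum n _).1 = _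
          rw [finPsum_val, aeval_X]
          congr 1
          simp only
          omega
      obtain ⟨q, hq⟩ := hmem
      have hN := mul_esymm_eq_sum (Fin n) ℝ k
      change (finPsum n q).1 = _ at hq
      rw [← hq] at hN
      refine ⟨C ((k : ℝ)⁻¹) * ((-1) ^ (k + 1) * q), ?_⟩
      have hk0 : (k : ℝ) ≠ 0 := by positivity
      have hC : (finPsum n (C ((k : ℝ)⁻¹))).1 = C ((k : ℝ)⁻¹) := by
        rw [finPsum_val, aeval_C]; rfl
      have : (C ((k : ℝ)⁻¹) : MvPolynomial (Fin n) ℝ) * (k : MvPolynomial (Fin n) ℝ) = 1 := by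
        rw [← C_eq_coe_nat, ← C_mul, inv_mul_cancel₀ hk0, C_1]
      calc _ = C ((k : ℝ)⁻¹) * ((-1) ^ (k + 1) * (finPsum n q).1) := by
              rw [map_mul, map_mul, map_pow, map_neg, map_one]
              simp only [MulMemClass.coe_mul]
              rw [hC]
              simp
        _ = _ := by rw [← hN, ← mul_assoc, this, one_mul]
  intro f
  obtain ⟨g, rfl⟩ := (esymmAlgHom_fin_bijective ℝ n).2 f
  rw [← AlgHom.mem_range]
  induction g using MvPolynomial.induction_on with
  | C r => rw [← algebraMap_eq, AlgHom.commutes]; exact Subalgebra.algebraMap_mem _ _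
  | add p q hp hq => rw [map_add]; exact Subalgebra.add_mem _ hp hq
  | mul_X p i hp =>
    rw [map_mul]
    refine Subalgebra.mul_mem _ hp ?_
    obtain ⟨q, hq⟩ := key (i + 1) (by omega)
    refine ⟨q, Subtype.ext ?_⟩
    change (finPsum n q).1 = _
    rw [hq, esymmAlgHom_apply, aeval_X]

theorem injective_of_surjective_ringEnd {R : Type*} [CommRing R] [IsNoetherianRing R]
    (φ : R →+* R) (hφ : Function.Surjective φ) : Function.Injective φ := by
  let c : ℕ →o Ideal R :=
    ⟨fun n => RingHom.ker (φ ^ n), monotone_nat_of_le_succ fun n x hx => by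
      rw [RingHom.mem_ker] at hx ⊢
      rw [pow_succ', RingHom.mul_def, RingHom.comp_apply, hx, map_zero]⟩
  obtain ⟨n, hn⟩ := monotone_stabilizes_iff_noetherian.2 ‹IsNoetherianRing R› c
  rw [injective_iff_map_eq_zero]
  intro a ha
  have hs : Function.Surjective (φ ^ n) := by
    rw [RingHom.coe_pow]
    exact hφ.iterate n
  obtain ⟨b, rfl⟩ := hs a
  have hb : b ∈ c (n + 1) := by
    change b ∈ RingHom.ker (φ ^ (n + 1))
    rw [RingHom.mem_ker, pow_succ', RingHom.mul_def, RingHom.comp_apply, ha]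
  rw [← hn (n + 1) (Nat.le_succ n)] at hb
  exact hb

theorem finPsum_injective (n : ℕ) : Function.Injective (finPsum n) := by
  let e := AlgEquiv.ofBijective (esymmAlgHom (Fin n) ℝ n) (esymmAlgHom_fin_bijective ℝ n)
  let φ : MvPolynomial (Fin n) ℝ →+* MvPolynomial (Fin n) ℝ :=
    (e.symm : symmetricSubalgebra (Fin n) ℝ →+* MvPolynomial (Fin n) ℝ).comp
      (finPsum n : MvPolynomial (Fin n) ℝ →+* symmetricSubalgebra (Fin n) ℝ)
  have hφ : Function.Surjective φ := e.symm.surjective.comp (finPsum_surjective n)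
  have : Function.Injective φ := injective_of_surjective_ringEnd φ hφ
  intro a b hab
  apply this
  change e.symm (finPsum n a) = e.symm (finPsum n b)
  rw [hab]

theorem ofPowerSums_injective : Function.Injective ofPowerSums := by
  rw [injective_iff_map_eq_zero]
  intro G hG
  obtain ⟨n, hn⟩ : ∃ n, ∀ i ∈ G.vars, i < n :=
    ⟨G.vars.sup id + 1, fun i hi => Nat.lt_succ_of_le (Finset.le_sup (f := id) hi)⟩
  obtain ⟨H, rfl⟩ : ∃ H : MvPolynomial (Fin n) ℝ, rename Fin.val H = G := by
    apply exists_rename_eq_of_vars_subset_range G _ Fin.val_injective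
    intro i hi
    exact ⟨⟨i, hn i hi⟩, rfl⟩
  have h := ofPowerSums_val (rename Fin.val H) n
  rw [hG, aeval_rename] at h
  have : finPsum n H = 0 := by
    apply Subtype.ext
    rw [finPsum_val]
    exact h.symm
  rw [(injective_iff_map_eq_zero _).1 (finPsum_injective n) H this, map_zero]

theorem homogeneousComponent_aeval_psum (n j : ℕ) (G : MvPolynomial ℕ ℝ) :
    homogeneousComponent j (aeval (fun j => psum (Fin n) ℝ (j + 1)) G) =
      aeval (fun j => psum (Fin n) ℝ (j + 1))
        (weightedHomogeneousComponent (fun i : ℕ => i + 1) j G) := by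
  induction G using MvPolynomial.induction_on' with
  | add p q hp hq => simp only [map_add, hp, hq]
  | monomial u a =>
    have h1 : (aeval (fun j => psum (Fin n) ℝ (j + 1)) (monomial u a)).IsHomogeneous
        (Finsupp.weight (fun i : ℕ => i + 1) u) := by
      rw [aeval_monomial, algebraMap_eq, Finsupp.weight_apply, Finsupp.prod, Finsupp.sum]
      refine IsHomogeneous.C_mul (IsHomogeneous.prod _ _ _ fun i _ => ?_) a
      have := (psum_isHomogeneous n (i + 1)).pow (u i)
      rwa [mul_comm] at this
    have h2 := isWeightedHomogeneous_monomial (fun i : ℕ => i + 1) u a rfl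
    rw [weightedHomogeneousComponent_of_mem h2, homogeneousComponent_of_mem h1]
    split_ifs <;> simp

theorem sym_eq_of_degree_le {f : SymFun} {d : ℕ} (hd : ∀ n, (f.1 n).totalDegree ≤ d)
    (h0 : f.1 d = 0) : f = 0 := by
  obtain ⟨hs, hr, -⟩ := f.2
  have hdown : ∀ k n, n + k = d → f.1 n = 0 := by
    intro k
    induction k with
    | zero => rintro n rfl; exact h0
    | succ k ih =>
      intro n hn
      rw [← hr n, ih (n + 1) (by omega), map_zero]
  have hup : ∀ k, f.1 (d + k) = 0 := by
    intro k
    induction k with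
    | zero => exact h0
    | succ k ih =>
      have hr' := hr (d + k)
      rw [ih] at hr'
      change f.1 (d + k + 1) = 0
      generalize hg : f.1 (d + k + 1) = g at hr'
      have hsg : g.IsSymmetric := hg ▸ hs _
      have hdg : g.totalDegree ≤ d := hg ▸ hd _
      by_contra hne
      obtain ⟨m, hm⟩ := support_nonempty.2 hne
      have hsum : m.support.card ≤ d := by
        refine le_trans ?_ ((le_totalDegree hm).trans hdg)
        rw [Finsupp.sum, Finset.card_eq_sum_ones]
        exact Finset.sum_le_sum fun i hi =>
          Nat.one_le_iff_ne_zero.2 (Finsupp.mem_support_iff.1 hi)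
      obtain ⟨i, hi⟩ : ∃ i, i ∉ m.support := by
        by_contra! hall
        have : m.support = Finset.univ := Finset.eq_univ_iff_forall.2 hall
        rw [this, Finset.card_univ, Fintype.card_fin] at hsum
        omega
      set e := Equiv.swap i (Fin.last (d + k))
      have hc : coeff (m.mapDomain e) g ≠ 0 := by
        have := coeff_rename_mapDomain e e.injective g m
        rw [hsg e] at this
        rw [this]
        exact mem_support_iff.1 hm
      have hl : (m.mapDomain e) (Fin.last (d + k)) = 0 := by
        rw [Finsupp.mapDomain_equiv_apply]
        simpa [e] using hi
      apply hc
      have hco : coeff ((m.mapDomain e).comapDomain Fin.castSucc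
          (Fin.castSucc_injective _).injOn) (restrictLast (d + k) g) = 0 := by
        rw [hr']; simp
      rw [restrictLast, coeff_killCompl, Finsupp.mapDomain_comapDomain] at hco
      · exact hco
      · exact Fin.castSucc_injective _
      · intro x hx
        induction x using Fin.lastCases with
        | last => exact absurd hl (Finsupp.mem_support_iff.1 hx)
        | cast x => exact ⟨x, rfl⟩
  apply Subtype.ext
  funext n
  rcases le_total n d with h | h
  · exact hdown (d - n) n (by omega)
  · obtain ⟨k, rfl⟩ := Nat.exists_eq_add_of_le h
    exact hup k

theorem ofPowerSums_surjective : Function.Surjective ofPowerSums := by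
  intro f
  obtain ⟨hs, hr, d, hd⟩ := f.2
  obtain ⟨H, hH⟩ := finPsum_surjective d ⟨f.1 d, hs d⟩
  have hH' := congrArg Subtype.val hH
  rw [finPsum_val] at hH'
  set G := ∑ j ∈ Finset.range (d + 1),
    weightedHomogeneousComponent (fun i : ℕ => i + 1) j (rename Fin.val H) with hG
  have hval : ∀ n, (ofPowerSums G).1 n = ∑ j ∈ Finset.range (d + 1),
      homogeneousComponent j (aeval (fun j => psum (Fin n) ℝ (j + 1)) (rename Fin.val H)) := by
    intro n
    rw [ofPowerSums_val, hG, map_sum]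
    exact Finset.sum_congr rfl fun j _ => (homogeneousComponent_aeval_psum n j _).symm
  refine ⟨G, ?_⟩
  rw [← sub_eq_zero]
  apply sym_eq_of_degree_le (d := d)
  · intro n
    refine (totalDegree_sub _ _).trans (max_le ?_ (hd n))
    rw [hval n]
    refine totalDegree_finsetSum_le fun j hj => ?_
    exact (homogeneousComponent_isHomogeneous j _).totalDegree_le.trans
      (Nat.lt_succ_iff.1 (Finset.mem_range.1 hj))
  · change (ofPowerSums G).1 d - f.1 d = 0
    rw [hval d, aeval_rename, sub_eq_zero]
    change ∑ j ∈ Finset.range (d + 1), homogeneousComponent j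
      (aeval (fun i : Fin d => psum (Fin d) ℝ (i + 1)) H) = _
    rw [hH']
    change ∑ j ∈ Finset.range (d + 1), homogeneousComponent j (f.1 d) = f.1 d
    conv_rhs => rw [← sum_homogeneousComponent (f.1 d)]
    symm
    apply Finset.sum_subset
    · intro j hj
      have := hd d
      simp only [Finset.mem_range] at hj ⊢
      omega
    · intro j _ hj
      apply homogeneousComponent_eq_zero
      simp only [Finset.mem_range] at hj
      omega

/-- The power sums `p_1, p_2, …` freely generate `Λ`: there is exactly one algebra homomorphism
with prescribed values on them. -/
theorem existsUnique_specialization (v : ℕ → ℝ) :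
    ∃! ρ : SymFun →ₐ[ℝ] ℝ, ∀ j, ρ (powerSum j) = v j := by
  let e := AlgEquiv.ofBijective ofPowerSums ⟨ofPowerSums_injective, ofPowerSums_surjective⟩
  have he : ∀ j, e (X j) = powerSum j := fun j => by
    change ofPowerSums (X j) = _
    simp [ofPowerSums]
  refine ⟨(aeval v).comp (e.symm : SymFun →ₐ[ℝ] MvPolynomial ℕ ℝ), fun j => ?_, fun ρ hρ => ?_⟩
  · change aeval v (e.symm (powerSum j)) = v j
    rw [← he, e.symm_apply_apply, aeval_X]
  · have : ρ.comp (e : MvPolynomial ℕ ℝ →ₐ[ℝ] SymFun) = aeval v := by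
      ext1 j
      change ρ (e (X j)) = _
      rw [he, hρ, aeval_X]
    ext f
    obtain ⟨G, rfl⟩ := e.surjective f
    change ρ (e G) = aeval v (e.symm (e G))
    rw [e.symm_apply_apply, ← this]
    rfl

/-! ### Jack-positive specializations -/

/-- The values `p_k(α, β, γ)`, `k ≥ 1`, of the power sums at the triplet `(α, β, γ)`:
`p_1 = γ + ∑ (α_i + β_i)`, and `p_k = ∑ α_i ^ k + (-θ) ^ (k - 1) ∑ β_i ^ k` for `k ≥ 2`. -/
def tripletPowerSum (θ : ℝ) (α β : ℕ → ℝ) (γ : ℝ) (k : ℕ) : ℝ :=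
  (if k = 1 then γ else 0) + (∑' i, α i ^ k) + (-θ) ^ (k - 1) * (∑' i, β i ^ k)

/-- The specialization with parameters `(α, β, γ)`. -/
def specialization (θ : ℝ) (α β : ℕ → ℝ) (γ : ℝ) : SymFun →ₐ[ℝ] ℝ :=
  (existsUnique_specialization fun j => tripletPowerSum θ α β γ (j + 1)).choose

/-- The specialization `a^N`: `α_1 = ⋯ = α_N = a`, all the other parameters are zero. -/
def alphaSpecialization (θ a : ℝ) (N : ℕ) : SymFun →ₐ[ℝ] ℝ :=
  specialization θ (fun i => if i < N then a else 0) (fun _ => 0) 0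

/-- The specialization `𝔯_s`: `γ = s`, all the other parameters are zero. -/
def plancherelSpecialization (θ s : ℝ) : SymFun →ₐ[ℝ] ℝ :=
  specialization θ (fun _ => 0) (fun _ => 0) s

/-! ### Jack symmetric functions -/

/-- The entry `x_i ^ (N - j) (x_i ∂/∂x_i + (N - j) θ + u)` of the matrix in Sekiguchi's operator
(rows and columns are numbered from `0` here, so `N - j` becomes `N - 1 - j`). -/
def sekiguchiEntry (θ u : ℝ) (N : ℕ) (i j : Fin N) : Module.End ℝ (MvPolynomial (Fin N) ℝ) :=
  LinearMap.mulLeft ℝ (X i ^ (N - 1 - (j : ℕ))) ∘ₗ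
    (LinearMap.mulLeft ℝ (X i) ∘ₗ (pderiv i).toLinearMap +
      (((N : ℝ) - 1 - (j : ℕ)) * θ + u) • LinearMap.id)

/-- The determinant of the matrix of operators `sekiguchiEntry`. The entries in different rows
commute, so the order of the factors in the products is immaterial. -/
def sekiguchiDet (θ u : ℝ) (N : ℕ) : Module.End ℝ (MvPolynomial (Fin N) ℝ) :=
  ∑ σ : Equiv.Perm (Fin N),
    (Equiv.Perm.sign σ : ℤ) • (List.ofFn fun i => sekiguchiEntry θ u N i (σ i)).prod

/-- `∏_{i < j} (x_i - x_j)` -/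
def vandermonde (N : ℕ) : MvPolynomial (Fin N) ℝ :=
  ∏ i : Fin N, ∏ j ∈ Finset.Ioi i, (X i - X j)

/-- `f` is the Jack polynomial `J_λ(x_1, …, x_N; θ)`, where `N ≥ ℓ(λ)`: it is symmetric, has
`x_1 ^ λ_1 ⋯ x_N ^ λ_N` with coefficient `1`, and is an eigenfunction of Sekiguchi's operators
`∏_{i < j} (x_i - x_j)⁻¹ det [x_i ^ (N - j) (x_i ∂/∂x_i + (N - j) θ + u)]` for all `u`, with
eigenvalues `∏_i (λ_i + (N - i) θ + u)`. -/
structure IsJackPolynomial (θ : ℝ) (N : ℕ) (lam : YoungDiagram) (f : MvPolynomial (Fin N) ℝ) :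
    Prop where
  isSymmetric : f.IsSymmetric
  coeff_leading : coeff (Finsupp.equivFunOnFinite.symm fun i : Fin N => lam.rowLen i) f = 1
  sekiguchi : ∀ u : ℝ, sekiguchiDet θ u N f =
    vandermonde N * (C (∏ i : Fin N, ((lam.rowLen i : ℝ) + ((N : ℝ) - 1 - (i : ℕ)) * θ + u)) * f)

/-- The Jack symmetric function `J_λ(·; θ) ∈ Λ`: the one whose restriction to `N` variables is the
Jack polynomial `J_λ(x_1, …, x_N; θ)` for every `N ≥ ℓ(λ)`. -/
def jackJ (θ : ℝ) (lam : YoungDiagram) : SymFun :=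
  Classical.epsilon fun F : SymFun => ∀ N, lam.colLen 0 ≤ N → IsJackPolynomial θ N lam (F.1 N)

/-- The arm length `λ_i - j` of the box in row `i` and column `j`; here boxes are numbered from
`(0, 0)`. -/
def arm (lam : YoungDiagram) (b : ℕ × ℕ) : ℕ := lam.rowLen b.1 - (b.2 + 1)

/-- The leg length `λ'_j - i` of the box in row `i` and column `j`; here boxes are numbered from
`(0, 0)`. -/
def leg (lam : YoungDiagram) (b : ℕ × ℕ) : ℕ := lam.colLen b.2 - (b.1 + 1)

/-- The dual Jack symmetric function `Q_λ`. -/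
def jackQ (θ : ℝ) (lam : YoungDiagram) : SymFun :=
  (∏ b ∈ lam.cells,
    ((arm lam b : ℝ) + θ * leg lam b + θ) / ((arm lam b : ℝ) + θ * leg lam b + 1)) • jackJ θ lam

/-! ### Jack measures -/

/-- `H_θ(ρ₁; ρ₂) = exp (∑_{k ≥ 1} (θ / k) p_k(ρ₁) p_k(ρ₂))` -/
def jackH (θ : ℝ) (ρ₁ ρ₂ : SymFun →ₐ[ℝ] ℝ) : ℝ :=
  Real.exp (∑' j : ℕ, (θ / ((j : ℝ) + 1) * ρ₁ (powerSum j) * ρ₂ (powerSum j)))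

/-- The weight `J_λ(ρ₁) Q_λ(ρ₂) / H_θ(ρ₁; ρ₂)` of `λ`. -/
def jackWeight (θ : ℝ) (ρ₁ ρ₂ : SymFun →ₐ[ℝ] ℝ) (lam : YoungDiagram) : ℝ :=
  ρ₁ (jackJ θ lam) * ρ₂ (jackQ θ lam) / jackH θ ρ₁ ρ₂

/-- The countable set `𝕐` of Young diagrams carries the discrete σ-algebra. -/
instance : MeasurableSpace YoungDiagram := ⊤

/-- The Jack measure on `𝕐`, which has mass `J_λ(ρ₁) Q_λ(ρ₂) / H_θ(ρ₁; ρ₂)` at `λ` (a non-negative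
number if `ρ₁` and `ρ₂` are Jack-positive). -/
def jackMeasure (θ : ℝ) (ρ₁ ρ₂ : SymFun →ₐ[ℝ] ℝ) : Measure YoungDiagram :=
  Measure.sum fun lam => ENNReal.ofReal (jackWeight θ ρ₁ ρ₂ lam) • Measure.dirac lam

/-- The rescaled coordinates `y` of a diagram: `λ_i = ε⁻¹ t + ε^{-1/2} y_{N+1-i}`, that is,
`y_k = ε^{1/2} (λ_{N+1-k} - ε⁻¹ t)`. -/
def rescaledRows (N : ℕ) (t ε : ℝ) (lam : YoungDiagram) : Fin N → ℝ :=
  fun k => Real.sqrt ε * ((lam.rowLen (Fin.rev k) : ℝ) - t / ε)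

/-! ### The Hermite ensemble -/

/-- The open Weyl chamber `y_1 < y_2 < ⋯ < y_N`. -/
def weylChamber (N : ℕ) : Set (Fin N → ℝ) := {y | StrictMono y}

/-- `Z = t^{θ N (N - 1) / 2 + N / 2} (2π)^{N / 2} ∏_{j = 1}^N Γ(j θ) / Γ(θ)` -/
def hermiteZ (θ t : ℝ) (N : ℕ) : ℝ :=
  t ^ (θ * ((N : ℝ) * ((N : ℝ) - 1) / 2) + (N : ℝ) / 2) * (2 * Real.pi) ^ ((N : ℝ) / 2) *
    ∏ j ∈ Finset.Icc 1 N, Real.Gamma ((j : ℝ) * θ) / Real.Gamma θ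

/-- `Z⁻¹ ∏_{i < j} (y_j - y_i)^{2θ} ∏_i exp (- y_i² / (2t))` -/
def hermiteDensity (θ t : ℝ) (N : ℕ) (y : Fin N → ℝ) : ℝ :=
  1 / hermiteZ θ t N * (∏ i : Fin N, ∏ j ∈ Finset.Ioi i, (y j - y i) ^ (2 * θ)) *
    ∏ i : Fin N, Real.exp (-(y i ^ 2 / (2 * t)))

/-- The Hermite `β = 2θ` ensemble of variance `t`, as a measure on `ℝ^N` carried by the closed
Weyl chamber. -/
def hermiteMeasure (θ t : ℝ) (N : ℕ) : Measure (Fin N → ℝ) :=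
  ((volume : Measure (Fin N → ℝ)).restrict (closure (weylChamber N))).withDensity fun y =>
    ENNReal.ofReal (hermiteDensity θ t N y)

end

end JackMeasures

/-! ### Sekiguchi eigenfunctions: triangularity and uniqueness. -/

namespace JackMeasures
open MvPolynomial
noncomputable section

/-! ### The alternating sums behind Sekiguchi's operators -/

/-! The weight of λ is computed in closed form, as a product of Gamma functions of the shifted rows
l_i = λ_i + (N - i)θ and of their differences. Stirling's formula then yields a local limit theorem,
and dominated convergence turns it into weak convergence. Most of the work is algebraic, because the
Jack polynomials are known only through their eigenvalue equations.

Uniqueness is triangularity. The top coefficient of an eigenfunction, with respect to the statistic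
`lexWeight`, forces its eigenvalue, and the zeros in u of the eigenvalue determine the diagram
(`IsSekEigen.eq_of_max`, `sekEigenvalue_injective`). Existence is by induction on N
(`JackExists.succ`) and uses the kernel Π = ∏ (1 - x_i y_j)^(-θ). A Cauchy-type determinant identity
(`det_sekKernelMatrix_symm`) shows that, up to Vandermonde factors, Sekiguchi's operators in x and
in y act on Π in the same way (`vandermonde_mul_altSum_kernelCoeff`). With N + 1 variables x and N
variables y, the coefficients of Π in the Jack basis in y are then eigenfunctions in x for the
diagrams with at most N rows. Multiplication by x_1⋯x_{N+1} supplies the diagrams with N + 1 rows.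

The leading coefficient c_λ of such an eigenfunction must be nonzero. At y = 1^N the kernel is ∏ (1
- x_i)^(-Nθ), and the Jack expansion of ∏ (1 - x_i)^(-a) can be found independently
(`JackExists.repr_binSym`): at u = 0 Sekiguchi's operator sends it to a multiple of x_1⋯x_N ∏ (1 -
x_i)^(-a-1), a recursion which adds a full column. Hence c_λ J_λ(1^N) is an explicit positive
number. The same recursion identifies c_λ with the product over boxes that defines Q_λ, and
therefore gives J_λ(1^N). Since 𝔯_s is a limit of rescaled 1^n, it also gives Q_λ(𝔯_s), hence the
weight (`jackWeight_eq`). The diagrams with n boxes carry a Poisson weight in total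
(`tsum_jackWeight`, from `sum_latticeWeight`), so the Jack measure has mass 1.

Put τ = sθ = t/ε. The weight factors over rows and pairs of rows (`latticeDensity_eq`). A row
contributes a perturbed Poisson weight, which tends to a Gaussian (`tendsto_rowWeight`), and a pair
contributes the power 2θ of the difference (`tendsto_pairFactor`). Read as a step function on cells
of side √ε, the density has an integrable exponential bound uniform in ε
(`exists_smearedDensity_le`). The test function 1 shows that the limit has mass 1, so the constant Z
needs no separate integral. -/

/-- The exponent vector `(N - 1 - σ i)_i`. -/
def permExp {N : ℕ} (σ : Equiv.Perm (Fin N)) : Fin N →₀ ℕ :=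
  Finsupp.equivFunOnFinite.symm fun i => N - 1 - (σ i : ℕ)

@[simp] theorem permExp_apply {N : ℕ} (σ : Equiv.Perm (Fin N)) (i : Fin N) :
    permExp σ i = N - 1 - (σ i : ℕ) := rfl

theorem natCast_rev {N : ℕ} (j : Fin N) : ((N - 1 - (j : ℕ) : ℕ) : ℝ) = (N : ℝ) - 1 - (j : ℕ) := by
  have := j.2
  rw [Nat.cast_sub (by omega), Nat.cast_sub (by omega), Nat.cast_one]

/-- Reduces a product of operators from different rows to a product of commuting multipliers: the
operator of row i differentiates in the i-th variable only, and the multipliers produced by the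
other rows do not contain it. It serves both for monomials and for the Cauchy kernel. -/
theorem list_prod_apply {ι B : Type*} [CommRing B] [Algebra ℝ B] (op : ι → Module.End ℝ B)
    (c : ι → B) (P : B)
    (h : ∀ (i : ι) (s : List ι), i ∉ s → op i ((s.map c).prod * P) = c i * ((s.map c).prod * P))
    (l : List ι) (hl : l.Nodup) : (l.map op).prod P = (l.map c).prod * P := by
  induction l with
  | nil => simp
  | cons a l ih =>
    rw [List.nodup_cons] at hl
    rw [List.map_cons, List.prod_cons, Module.End.mul_apply, ih hl.2, h a l hl.1, List.map_cons,
      List.prod_cons, mul_assoc]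

theorem det_rev_vandermonde {R : Type*} [CommRing R] {N : ℕ} (x : Fin N → R) :
    (Matrix.of fun i j : Fin N => x i ^ (N - 1 - (j : ℕ))).det =
      ∏ i : Fin N, ∏ j ∈ Finset.Ioi i, (x i - x j) := by
  have h1 : (Matrix.of fun i j : Fin N => x i ^ (N - 1 - (j : ℕ))) =
      (Matrix.vandermonde (fun i => x (Fin.rev i))).submatrix Fin.revPerm Fin.revPerm := by
    ext i j
    simp only [Matrix.of_apply, Matrix.submatrix_apply, Matrix.vandermonde_apply,
      Fin.revPerm_apply, Fin.rev_rev, Fin.val_rev]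
    congr 1
    omega
  rw [h1, Matrix.det_submatrix_equiv_self, Matrix.det_vandermonde]
  rw [Finset.prod_sigma', Finset.prod_sigma']
  refine Finset.prod_nbij' (fun p => ⟨Fin.rev p.2, Fin.rev p.1⟩) (fun p => ⟨Fin.rev p.2, Fin.rev p.1⟩)
    ?_ ?_ ?_ ?_ ?_
  · rintro ⟨i, j⟩ h; simpa [Fin.rev_lt_rev] using h
  · rintro ⟨i, j⟩ h; simpa [Fin.rev_lt_rev] using h
  · rintro ⟨i, j⟩ h; simp
  · rintro ⟨i, j⟩ h; simp
  · rintro ⟨i, j⟩ h; simp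

theorem vandermonde_eq_det (N : ℕ) :
    vandermonde N = (Matrix.of fun i j : Fin N =>
      (X i : MvPolynomial (Fin N) ℝ) ^ (N - 1 - (j : ℕ))).det :=
  (det_rev_vandermonde _).symm

theorem prod_X_pow_permExp {N : ℕ} (σ : Equiv.Perm (Fin N)) :
    ∏ i, (X i : MvPolynomial (Fin N) ℝ) ^ (N - 1 - (σ i : ℕ)) = monomial (permExp σ) 1 := by
  rw [monomial_eq, C_1, one_mul, Finsupp.prod_fintype _ _ (by simp)]
  rfl

theorem vandermonde_eq_sum (N : ℕ) : vandermonde N =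
    ∑ σ : Equiv.Perm (Fin N), (Equiv.Perm.sign σ : ℤ) • monomial (permExp σ) (1 : ℝ) := by
  rw [vandermonde_eq_det, ← Matrix.det_transpose, Matrix.det_apply]
  refine Finset.sum_congr rfl fun σ _ => ?_
  rw [Units.smul_def, ← prod_X_pow_permExp]
  simp

theorem vandermonde_ne_zero (N : ℕ) : vandermonde N ≠ 0 := by
  refine Finset.prod_ne_zero_iff.2 fun i _ => Finset.prod_ne_zero_iff.2 fun j hj => ?_
  rw [sub_ne_zero]
  intro h
  exact (Finset.mem_Ioi.1 hj).ne (X_injective h)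

/-- The alternating sum `∑_σ sgn σ ∏_i φ_{σ i}(ρ_i - δ_{σ i}) c_{ρ - δ_σ}`. -/
def altSum {N : ℕ} {R : Type*} [AddCommGroup R] [Module ℝ R] (φ : Fin N → ℕ → ℝ)
    (c : (Fin N →₀ ℕ) → R) (ρ : Fin N →₀ ℕ) : R :=
  ∑ σ : Equiv.Perm (Fin N), (Equiv.Perm.sign σ : ℤ) •
    if permExp σ ≤ ρ then (∏ i, φ (σ i) ((ρ - permExp σ) i)) • c (ρ - permExp σ) else 0

/-- The factors `m + (N - 1 - j) θ + u`. -/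
def sekFactor (θ u : ℝ) (N : ℕ) (j : Fin N) (m : ℕ) : ℝ := (m : ℝ) + (((N : ℝ) - 1 - (j : ℕ)) * θ + u)

theorem pderiv_X_mul_self {N : ℕ} (i : Fin N) (μ : Fin N →₀ ℕ) (r : ℝ) :
    X i * pderiv i (monomial μ r) = monomial μ (r * μ i) := by
  rw [pderiv_monomial, X, monomial_mul, one_mul]
  by_cases h : μ i = 0
  · simp [h]
  · congr 1
    have h1 : Finsupp.single i 1 ≤ μ := by simpa using Nat.one_le_iff_ne_zero.2 h
    rw [add_comm, tsub_add_cancel_of_le h1]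

theorem sekiguchiEntry_apply (θ u : ℝ) (N : ℕ) (i j : Fin N) (f : MvPolynomial (Fin N) ℝ) :
    sekiguchiEntry θ u N i j f =
      X i ^ (N - 1 - (j : ℕ)) * (X i * pderiv i f + (((N : ℝ) - 1 - (j : ℕ)) * θ + u) • f) := rfl

theorem sekiguchiDet_apply (θ u : ℝ) (N : ℕ) (f : MvPolynomial (Fin N) ℝ) :
    sekiguchiDet θ u N f = ∑ σ : Equiv.Perm (Fin N), (Equiv.Perm.sign σ : ℤ) •
      ((List.finRange N).map fun i => sekiguchiEntry θ u N i (σ i)).prod f := by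
  simp only [sekiguchiDet, LinearMap.sum_apply, LinearMap.smul_apply, List.ofFn_eq_map]

theorem list_prod_finRange {N : ℕ} {B : Type*} [CommMonoid B] (c : Fin N → B) :
    ((List.finRange N).map c).prod = ∏ i, c i := by
  rw [← List.ofFn_eq_map, List.prod_ofFn]

theorem sekiguchiDet_monomial_aux (θ u : ℝ) {N : ℕ} (μ : Fin N →₀ ℕ) (σ : Equiv.Perm (Fin N)) :
    ((List.finRange N).map fun i => sekiguchiEntry θ u N i (σ i)).prod (monomial μ 1) =
      (∏ i, (X i ^ (N - 1 - (σ i : ℕ)) * C (sekFactor θ u N (σ i) (μ i)))) * monomial μ 1 := by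
  rw [← list_prod_finRange]
  refine list_prod_apply _ _ _ (fun i s hi => ?_) _ (List.nodup_finRange N)
  have hd : pderiv i (s.map fun i => (X i ^ (N - 1 - (σ i : ℕ)) * C (sekFactor θ u N (σ i) (μ i)) :
      MvPolynomial (Fin N) ℝ)).prod = 0 := by
    induction s with
    | nil => simp
    | cons a s ih =>
      rw [List.mem_cons, not_or] at hi
      rw [List.map_cons, List.prod_cons, Derivation.leibniz, ih hi.2, Derivation.leibniz, pderiv_C,
        Derivation.leibniz_pow, pderiv_X_of_ne (Ne.symm hi.1)]
      simp
  have hm := pderiv_X_mul_self i μ 1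
  rw [sekiguchiEntry_apply, Derivation.leibniz, hd, smul_zero, add_zero, smul_eq_mul, mul_left_comm,
    hm, one_mul]
  have : monomial μ (μ i : ℝ) = C (μ i : ℝ) * monomial μ 1 := by rw [C_mul_monomial, mul_one]
  rw [this, sekFactor, C_add, smul_eq_C_mul]
  ring

theorem sekiguchiDet_monomial (θ u : ℝ) {N : ℕ} (μ : Fin N →₀ ℕ) :
    sekiguchiDet θ u N (monomial μ 1) =
      (Matrix.of fun i j : Fin N => (X i ^ (N - 1 - (j : ℕ)) * C (sekFactor θ u N j (μ i)) :
        MvPolynomial (Fin N) ℝ)).det * monomial μ 1 := by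
  rw [sekiguchiDet_apply, ← Matrix.det_transpose, Matrix.det_apply, Finset.sum_mul]
  refine Finset.sum_congr rfl fun σ _ => ?_
  rw [sekiguchiDet_monomial_aux, Units.smul_def, smul_mul_assoc]
  simp

/-- On x^μ the entry in row i and column j acts as x_i^(N-1-j) times a scalar depending on μ_i and
j. With `coeff_vandermonde_mul`, the eigenvalue equation becomes an identity between two alternating
sums of the same coefficients, and no division by the Vandermonde is needed. -/
theorem coeff_sekiguchiDet (θ u : ℝ) {N : ℕ} (f : MvPolynomial (Fin N) ℝ) (ρ : Fin N →₀ ℕ) :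
    coeff ρ (sekiguchiDet θ u N f) = altSum (sekFactor θ u N) (fun μ => coeff μ f) ρ := by
  induction f using MvPolynomial.induction_on' with
  | add p q hp hq =>
    rw [map_add, coeff_add, hp, hq, altSum, altSum, altSum, ← Finset.sum_add_distrib]
    refine Finset.sum_congr rfl fun σ _ => ?_
    split_ifs <;> simp [mul_add]
  | monomial μ r =>
    have : monomial μ r = r • monomial μ (1 : ℝ) := by
      rw [smul_monomial, smul_eq_mul, mul_one]
    rw [this, map_smul, sekiguchiDet_apply, coeff_smul, coeff_sum, altSum, Finset.smul_sum]
    refine Finset.sum_congr rfl fun σ _ => ?_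
    rw [sekiguchiDet_monomial_aux, Finset.prod_mul_distrib, prod_X_pow_permExp, ← map_prod,
      mul_assoc, C_mul_monomial, coeff_smul, coeff_monomial_mul', one_mul, coeff_monomial, smul_comm]
    by_cases h : permExp σ ≤ ρ
    · simp only [if_pos h]
      rw [coeff_smul, coeff_monomial]
      by_cases h2 : μ = ρ - permExp σ
      · rw [if_pos h2, if_pos h2, ← h2]; simp only [mul_one, smul_eq_mul]; rw [mul_comm r]
      · simp [h2]
    · simp [h]

theorem coeff_vandermonde_mul {N : ℕ} (f : MvPolynomial (Fin N) ℝ) (ρ : Fin N →₀ ℕ) :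
    coeff ρ (vandermonde N * f) = altSum (fun _ _ => 1) (fun μ => coeff μ f) ρ := by
  rw [vandermonde_eq_sum, Finset.sum_mul, coeff_sum, altSum]
  refine Finset.sum_congr rfl fun σ _ => ?_
  rw [smul_mul_assoc, coeff_smul, coeff_monomial_mul']
  simp
end
end JackMeasures

namespace JackMeasures
open MvPolynomial
noncomputable section

/-! ### Triangularity -/

/-- The statistic `∑_i (N - 1 - i) μ_i`, which is maximal among the rearrangements of `μ` at the
antitone one. -/
def lexWeight {N : ℕ} (μ : Fin N →₀ ℕ) : ℕ := ∑ i : Fin N, (N - 1 - (i : ℕ)) * μ i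

theorem lexWeight_add {N : ℕ} (μ ν : Fin N →₀ ℕ) : lexWeight (μ + ν) = lexWeight μ + lexWeight ν := by
  simp [lexWeight, mul_add, Finset.sum_add_distrib]

theorem exists_perm_antitone {N : ℕ} (μ : Fin N →₀ ℕ) :
    ∃ τ : Equiv.Perm (Fin N), Antitone (μ.mapDomain τ) ∧ lexWeight μ ≤ lexWeight (μ.mapDomain τ) := by
  let σ := Tuple.sort (fun i => OrderDual.toDual (μ i))
  have hσ : Monotone ((fun i => OrderDual.toDual (μ i)) ∘ σ) := Tuple.monotone_sort _
  have hf : ⇑(μ.mapDomain σ.symm) = μ ∘ σ := by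
    ext i; rw [Finsupp.mapDomain_equiv_apply]; simp
  have hanti : Antitone (μ ∘ σ) := fun a b h => hσ h
  refine ⟨σ.symm, hf ▸ hanti, ?_⟩
  have hδ : Antitone fun i : Fin N => N - 1 - (i : ℕ) := fun a b h => by
    have : (a : ℕ) ≤ b := h
    show N - 1 - (b : ℕ) ≤ N - 1 - (a : ℕ)
    omega
  have hmv : Monovary (fun i : Fin N => N - 1 - (i : ℕ)) (μ ∘ σ) := hδ.monovary hanti
  have := hmv.sum_mul_comp_perm_le_sum_mul (σ := σ.symm)
  rw [lexWeight, lexWeight, hf]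
  simpa using this

/-- A strict rearrangement inequality: the squares of the exponents have the same sum for σ and for
the identity, so the sum of squared differences, positive for σ ≠ 1, is twice the gap. -/
theorem lexWeight_permExp_lt {N : ℕ} {σ : Equiv.Perm (Fin N)} (hσ : σ ≠ 1) :
    lexWeight (permExp σ) < lexWeight (permExp (1 : Equiv.Perm (Fin N))) := by
  have h1 : ∑ i : Fin N, (((N - 1 - (σ i : ℕ) : ℕ) : ℤ)) ^ 2 = ∑ i : Fin N, ((N - 1 - (i : ℕ) : ℕ) : ℤ) ^ 2 :=
    Equiv.sum_comp σ fun i => ((N - 1 - (i : ℕ) : ℕ) : ℤ) ^ 2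
  have h2 : 0 < ∑ i : Fin N, (((N - 1 - (i : ℕ) : ℕ) : ℤ) - ((N - 1 - (σ i : ℕ) : ℕ) : ℤ)) ^ 2 := by
    obtain ⟨i, hi⟩ : ∃ i, σ i ≠ i := by
      by_contra! h
      exact hσ (Equiv.ext h)
    refine Finset.sum_pos' (fun i _ => sq_nonneg _) ⟨i, Finset.mem_univ _, ?_⟩
    have := (σ i).2
    have := i.2
    have hne : (σ i : ℕ) ≠ i := fun h => hi (Fin.ext h)
    exact sq_pos_iff.2 (by omega)
  have h3 : ∑ i : Fin N, (((N - 1 - (i : ℕ) : ℕ) : ℤ) - ((N - 1 - (σ i : ℕ) : ℕ) : ℤ)) ^ 2 =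
      ∑ i : Fin N, ((N - 1 - (i : ℕ) : ℕ) : ℤ) ^ 2 + ∑ i : Fin N, (((N - 1 - (σ i : ℕ) : ℕ) : ℤ)) ^ 2
      - 2 * ∑ i : Fin N, ((N - 1 - (i : ℕ) : ℕ) : ℤ) * ((N - 1 - (σ i : ℕ) : ℕ) : ℤ) := by
    rw [Finset.mul_sum, ← Finset.sum_add_distrib, ← Finset.sum_sub_distrib]
    exact Finset.sum_congr rfl fun i _ => by ring
  rw [← Nat.cast_lt (α := ℤ), lexWeight, lexWeight]
  simp only [permExp_apply, Equiv.Perm.one_apply]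
  push_cast only [Nat.cast_sum, Nat.cast_mul]
  simp only [← sq]
  linarith

/-- Only the identity contributes. For any other σ the exponent μ + δ - δ_σ has a larger weight than
μ, sorting it can only increase the weight, and so its coefficient vanishes by maximality. -/
theorem altSum_leading {N : ℕ} (φ : Fin N → ℕ → ℝ) (c : (Fin N →₀ ℕ) → ℝ)
    (hc : ∀ (τ : Equiv.Perm (Fin N)) μ, c (μ.mapDomain τ) = c μ) (μ : Fin N →₀ ℕ)
    (hmax : ∀ ν : Fin N →₀ ℕ, Antitone ν → c ν ≠ 0 → lexWeight ν ≤ lexWeight μ) :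
    altSum φ c (μ + permExp 1) = (∏ i, φ i (μ i)) * c μ := by
  rw [altSum, Finset.sum_eq_single 1]
  · simp
  · intro σ _ hσ
    rw [ite_eq_right_iff.2, smul_zero]
    intro hle
    have hc0 : c (μ + permExp 1 - permExp σ) = 0 := by
      by_contra hne
      set ν := μ + permExp 1 - permExp σ with hν
      have h1 : ν + permExp σ = μ + permExp 1 := tsub_add_cancel_of_le hle
      obtain ⟨τ, hτ, hw⟩ := exists_perm_antitone ν
      have h2 := hmax _ hτ (by rwa [hc])
      have h3 := congrArg lexWeight h1
      rw [lexWeight_add, lexWeight_add] at h3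
      have := lexWeight_permExp_lt hσ
      omega
    rw [hc0, smul_zero]
  · simp

theorem coeff_mapDomain_of_isSymmetric {N : ℕ} {f : MvPolynomial (Fin N) ℝ} (hf : f.IsSymmetric)
    (τ : Equiv.Perm (Fin N)) (μ : Fin N →₀ ℕ) : coeff (μ.mapDomain τ) f = coeff μ f := by
  conv_lhs => rw [← hf τ]
  exact coeff_rename_mapDomain _ τ.injective f μ

/-! ### Diagrams with at most `N` rows -/

/-- The row lengths as an exponent vector. -/
def rowExp (N : ℕ) (lam : YoungDiagram) : Fin N →₀ ℕ :=
  Finsupp.equivFunOnFinite.symm fun i : Fin N => lam.rowLen i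

@[simp] theorem rowExp_apply (N : ℕ) (lam : YoungDiagram) (i : Fin N) :
    rowExp N lam i = lam.rowLen i := rfl

theorem rowExp_antitone (N : ℕ) (lam : YoungDiagram) : Antitone (rowExp N lam) :=
  fun i j h => lam.rowLen_anti i j h

theorem rowLen_eq_zero {lam : YoungDiagram} {i : ℕ} : lam.rowLen i = 0 ↔ lam.colLen 0 ≤ i := by
  rw [← not_lt, ← YoungDiagram.mem_iff_lt_colLen, YoungDiagram.mem_iff_lt_rowLen]
  omega

theorem YoungDiagram_ext_rowLen {lam mu : YoungDiagram} (h : ∀ i, lam.rowLen i = mu.rowLen i) :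
    lam = mu := by
  ext ⟨i, j⟩
  rw [YoungDiagram.mem_cells, YoungDiagram.mem_cells, YoungDiagram.mem_iff_lt_rowLen,
    YoungDiagram.mem_iff_lt_rowLen, h]

theorem rowExp_injective {N : ℕ} {lam mu : YoungDiagram} (hl : lam.colLen 0 ≤ N)
    (hm : mu.colLen 0 ≤ N) (h : rowExp N lam = rowExp N mu) : lam = mu := by
  refine YoungDiagram_ext_rowLen fun i => ?_
  by_cases hi : i < N
  · exact DFunLike.congr_fun h ⟨i, hi⟩
  · rw [rowLen_eq_zero.2 (by omega), rowLen_eq_zero.2 (by omega)]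

theorem exists_diagram {N : ℕ} (μ : Fin N →₀ ℕ) (hμ : Antitone μ) :
    ∃ lam : YoungDiagram, lam.colLen 0 ≤ N ∧ rowExp N lam = μ := by
  let lam : YoungDiagram := ⟨Finset.univ.biUnion fun i : Fin N => {(i : ℕ)} ×ˢ Finset.range (μ i), by
    rintro ⟨a, b⟩ ⟨c, d⟩ hle h
    obtain ⟨h1, h2⟩ := Prod.mk_le_mk.1 hle
    simp only [Finset.coe_biUnion, Set.mem_iUnion, Finset.coe_product, Set.mem_prod,
      Finset.mem_coe, Finset.mem_singleton, Finset.mem_range, Finset.mem_univ] at h ⊢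
    obtain ⟨i, -, rfl, hi⟩ := h
    refine ⟨⟨c, by omega⟩, trivial, rfl, ?_⟩
    have : μ i ≤ μ ⟨c, by omega⟩ := hμ h1
    omega⟩
  have hmem : ∀ i j, (i, j) ∈ lam ↔ ∃ h : i < N, j < μ ⟨i, h⟩ := by
    intro i j
    rw [← YoungDiagram.mem_cells]
    simp only [lam, Finset.mem_biUnion, Finset.mem_univ, true_and, Finset.mem_product,
      Finset.mem_singleton, Finset.mem_range]
    constructor
    · rintro ⟨k, rfl, hk⟩; exact ⟨k.2, hk⟩
    · rintro ⟨h, hk⟩; exact ⟨⟨i, h⟩, rfl, hk⟩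
  refine ⟨lam, ?_, ?_⟩
  · rw [← rowLen_eq_zero]
    by_contra hne
    obtain ⟨h, -⟩ := (hmem N 0).1 (YoungDiagram.mem_iff_lt_rowLen.2 (Nat.pos_of_ne_zero hne))
    omega
  · ext i
    rw [rowExp_apply]
    refine Nat.le_antisymm ?_ ?_ <;> by_contra! hlt
    · obtain ⟨h, h'⟩ := (hmem i (μ i)).1 (YoungDiagram.mem_iff_lt_rowLen.2 hlt)
      exact absurd h' (by simp)
    · have := YoungDiagram.mem_iff_lt_rowLen.1 ((hmem i (lam.rowLen i)).2 ⟨i.2, hlt⟩)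
      omega

/-- The eigenvalue `∏_i (λ_i + (N - 1 - i) θ + u)`. -/
def sekEigenvalue (θ : ℝ) (N : ℕ) (μ : Fin N → ℕ) (u : ℝ) : ℝ :=
  ∏ i : Fin N, ((μ i : ℝ) + ((N : ℝ) - 1 - (i : ℕ)) * θ + u)

theorem sekEigenvalue_eq (θ : ℝ) (N : ℕ) (μ : Fin N → ℕ) (u : ℝ) :
    sekEigenvalue θ N μ u = ∏ i, sekFactor θ u N i (μ i) :=
  Finset.prod_congr rfl fun i _ => by rw [sekFactor, add_assoc]

/-- As a polynomial in u the eigenvalue vanishes exactly at the negated shifted rows. For θ > 0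
these are strictly ordered, so the set of zeros determines every row. -/
theorem sekEigenvalue_injective {θ : ℝ} (hθ : 0 < θ) {N : ℕ} {μ ν : Fin N → ℕ} (hμ : Antitone μ)
    (hν : Antitone ν) (h : ∀ u, sekEigenvalue θ N μ u = sekEigenvalue θ N ν u) : μ = ν := by
  have key : ∀ μ : Fin N → ℕ, Antitone μ →
      StrictMono fun i : Fin N => -((μ i : ℝ) + ((N : ℝ) - 1 - (i : ℕ)) * θ) := by
    intro μ hμ i j hij
    have h1 : (μ j : ℝ) ≤ μ i := by exact_mod_cast hμ hij.le
    have h2 : ((i : ℕ) : ℝ) < (j : ℕ) := by exact_mod_cast hij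
    simp only [neg_lt_neg_iff]
    nlinarith
  have hr : Set.range (fun i : Fin N => -((μ i : ℝ) + ((N : ℝ) - 1 - (i : ℕ)) * θ)) =
      Set.range fun i : Fin N => -((ν i : ℝ) + ((N : ℝ) - 1 - (i : ℕ)) * θ) := by
    have hroot : ∀ (μ : Fin N → ℕ) (x : ℝ),
        x ∈ Set.range (fun i : Fin N => -((μ i : ℝ) + ((N : ℝ) - 1 - (i : ℕ)) * θ)) ↔
          sekEigenvalue θ N μ x = 0 := by
      intro μ x
      rw [sekEigenvalue, Finset.prod_eq_zero_iff, Set.mem_range]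
      refine exists_congr fun i => ?_
      simp only [Finset.mem_univ, true_and]
      constructor <;> intro h <;> linarith
    ext x
    rw [hroot, hroot, h]
  have := ((key μ hμ).range_inj (key ν hν)).1 hr
  funext i
  have hi := congrFun this i
  simp only [neg_inj, add_left_inj] at hi
  exact_mod_cast hi

/-! ### Eigenfunctions -/

/-- `f` is a symmetric eigenfunction of all of Sekiguchi's operators, with eigenvalue `e u`. -/
structure IsSekEigen (θ : ℝ) (N : ℕ) (e : ℝ → ℝ) (f : MvPolynomial (Fin N) ℝ) : Prop where
  symm : f.IsSymmetric
  eigen : ∀ u : ℝ, sekiguchiDet θ u N f = vandermonde N * (C (e u) * f)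

theorem isJackPolynomial_iff {θ : ℝ} {N : ℕ} {lam : YoungDiagram} {f : MvPolynomial (Fin N) ℝ} :
    IsJackPolynomial θ N lam f ↔
      IsSekEigen θ N (sekEigenvalue θ N (rowExp N lam)) f ∧ coeff (rowExp N lam) f = 1 :=
  ⟨fun h => ⟨⟨h.1, h.3⟩, h.2⟩, fun h => ⟨h.1.1, h.2, h.1.2⟩⟩

/-- By `altSum_leading`, at the exponent μ + (N-1, …, 0) each side of the eigenvalue equation has a
single term, a multiple of the coefficient at μ. -/
theorem IsSekEigen.eq_of_max {θ : ℝ} {N : ℕ} {e : ℝ → ℝ} {f : MvPolynomial (Fin N) ℝ}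
    (hf : IsSekEigen θ N e f) {μ : Fin N →₀ ℕ} (hμ : coeff μ f ≠ 0)
    (hmax : ∀ ν : Fin N →₀ ℕ, Antitone ν → coeff ν f ≠ 0 → lexWeight ν ≤ lexWeight μ) (u : ℝ) :
    e u = sekEigenvalue θ N μ u := by
  have h := congrArg (coeff (μ + permExp 1)) (hf.eigen u)
  have hs : ∀ (τ : Equiv.Perm (Fin N)) μ, coeff (μ.mapDomain τ) f = coeff μ f :=
    coeff_mapDomain_of_isSymmetric hf.symm
  rw [mul_left_comm, coeff_C_mul, coeff_sekiguchiDet, coeff_vandermonde_mul,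
    altSum_leading _ (fun μ => coeff μ f) hs μ hmax,
    altSum_leading _ (fun μ => coeff μ f) hs μ hmax, ← sekEigenvalue_eq] at h
  simp only [Finset.prod_const_one, one_mul] at h
  exact (mul_right_cancel₀ hμ h).symm

theorem exists_max_antitone {N : ℕ} {f : MvPolynomial (Fin N) ℝ} (hs : f.IsSymmetric) (hf : f ≠ 0) :
    ∃ μ : Fin N →₀ ℕ, Antitone μ ∧ coeff μ f ≠ 0 ∧
      ∀ ν : Fin N →₀ ℕ, Antitone ν → coeff ν f ≠ 0 → lexWeight ν ≤ lexWeight μ := by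
  classical
  let A := f.support.filter fun μ : Fin N →₀ ℕ => Antitone μ
  have hA : A.Nonempty := by
    obtain ⟨m, hm⟩ := support_nonempty.2 hf
    obtain ⟨τ, hτ, -⟩ := exists_perm_antitone m
    refine ⟨m.mapDomain τ, Finset.mem_filter.2 ⟨?_, hτ⟩⟩
    rw [mem_support_iff, coeff_mapDomain_of_isSymmetric hs]
    exact mem_support_iff.1 hm
  obtain ⟨μ, hμ, hmax⟩ := A.exists_max_image lexWeight hA
  rw [Finset.mem_filter, mem_support_iff] at hμ
  exact ⟨μ, hμ.2, hμ.1, fun ν h1 h2 => hmax ν (Finset.mem_filter.2 ⟨mem_support_iff.2 h2, h1⟩)⟩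

/-- A sorted exponent of maximal weight has the eigenvalue of `lam`, hence equals `lam`. This single
linear statistic replaces the dominance order. -/
theorem IsSekEigen.lexWeight_lt {θ : ℝ} (hθ : 0 < θ) {N : ℕ} {lam : Fin N →₀ ℕ} (hl : Antitone lam)
    {f : MvPolynomial (Fin N) ℝ} (hf : IsSekEigen θ N (sekEigenvalue θ N lam) f) {μ : Fin N →₀ ℕ}
    (hμ : Antitone μ) (hc : coeff μ f ≠ 0) : lexWeight μ < lexWeight lam ∨ μ = lam := by
  have hmx : ∀ ν : Fin N →₀ ℕ, Antitone ν → coeff ν f ≠ 0 →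
      (∀ κ : Fin N →₀ ℕ, Antitone κ → coeff κ f ≠ 0 → lexWeight κ ≤ lexWeight ν) → ν = lam :=
    fun ν h1 h2 h3 => DFunLike.coe_injective
      (sekEigenvalue_injective hθ h1 hl fun u => (hf.eq_of_max h2 h3 u).symm)
  obtain ⟨ν, h1, h2, h3⟩ := exists_max_antitone hf.symm (f := f) (by rintro rfl; simp at hc)
  obtain rfl := hmx ν h1 h2 h3
  rcases (h3 μ hμ hc).lt_or_eq with h | h
  · exact Or.inl h
  · exact Or.inr (hmx μ hμ hc fun κ h4 h5 => (h3 κ h4 h5).trans h.ge)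

theorem IsSekEigen.eq_zero {θ : ℝ} (hθ : 0 < θ) {N : ℕ} {lam : Fin N →₀ ℕ} (hl : Antitone lam)
    {f : MvPolynomial (Fin N) ℝ} (hf : IsSekEigen θ N (sekEigenvalue θ N lam) f)
    (h0 : coeff lam f = 0) : f = 0 := by
  by_contra hne
  obtain ⟨ν, h1, h2, h3⟩ := exists_max_antitone hf.symm hne
  have := DFunLike.coe_injective (sekEigenvalue_injective hθ h1 hl fun u => (hf.eq_of_max h2 h3 u).symm)
  exact h2 (this ▸ h0)

theorem IsSekEigen.sub {θ : ℝ} {N : ℕ} {e : ℝ → ℝ} {f g : MvPolynomial (Fin N) ℝ}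
    (hf : IsSekEigen θ N e f) (hg : IsSekEigen θ N e g) : IsSekEigen θ N e (f - g) :=
  ⟨hf.1.sub hg.1, fun u => by rw [map_sub, hf.2, hg.2]; ring⟩

theorem IsSekEigen.smul {θ : ℝ} {N : ℕ} {e : ℝ → ℝ} {f : MvPolynomial (Fin N) ℝ}
    (hf : IsSekEigen θ N e f) (r : ℝ) : IsSekEigen θ N e (r • f) :=
  ⟨hf.1.smul r, fun u => by rw [map_smul, hf.2, mul_smul_comm, mul_smul_comm]⟩

theorem IsSekEigen.eq_smul {θ : ℝ} (hθ : 0 < θ) {N : ℕ} {lam : Fin N →₀ ℕ} (hl : Antitone lam)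
    {f g : MvPolynomial (Fin N) ℝ} (hf : IsSekEigen θ N (sekEigenvalue θ N lam) f)
    (hg : IsSekEigen θ N (sekEigenvalue θ N lam) g) (h1 : coeff lam g = 1) :
    f = coeff lam f • g := by
  rw [← sub_eq_zero]
  exact (hf.sub (hg.smul _)).eq_zero hθ hl (by simp [h1])

theorem IsJackPolynomial.unique {θ : ℝ} (hθ : 0 < θ) {N : ℕ} {lam : YoungDiagram}
    {f g : MvPolynomial (Fin N) ℝ} (hf : IsJackPolynomial θ N lam f)
    (hg : IsJackPolynomial θ N lam g) : f = g := by
  rw [isJackPolynomial_iff] at hf hg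
  rw [hf.1.eq_smul hθ (rowExp_antitone N lam) hg.1 hg.2, hf.2, one_smul]
end
end JackMeasures

/-! ### Full columns, vanishing variables, and the Jack basis. -/

namespace JackMeasures
open MvPolynomial
noncomputable section

/-! ### Multiplication by `x_1 ⋯ x_N` -/

/-- The exponent vector `(1, …, 1)`. -/
def onesExp (N : ℕ) : Fin N →₀ ℕ := Finsupp.equivFunOnFinite.symm fun _ => 1

@[simp] theorem onesExp_apply (N : ℕ) (i : Fin N) : onesExp N i = 1 := rfl

theorem prod_X_eq (N : ℕ) : ∏ i : Fin N, (X i : MvPolynomial (Fin N) ℝ) = monomial (onesExp N) 1 := by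
  rw [monomial_eq, C_1, one_mul, Finsupp.prod_fintype _ _ (by simp)]
  simp

theorem isSymmetric_prod_X (N : ℕ) : (monomial (onesExp N) (1 : ℝ)).IsSymmetric := by
  intro σ
  rw [← prod_X_eq, map_prod]
  simp only [rename_X]
  exact Equiv.prod_comp σ fun i => (X i : MvPolynomial (Fin N) ℝ)

theorem sekiguchiEntry_prod_X_mul (θ u : ℝ) (N : ℕ) (i j : Fin N) (f : MvPolynomial (Fin N) ℝ) :
    sekiguchiEntry θ u N i j (monomial (onesExp N) 1 * f) =
      monomial (onesExp N) 1 * sekiguchiEntry θ (u + 1) N i j f := by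
  have h := pderiv_X_mul_self i (onesExp N) 1
  rw [onesExp_apply, Nat.cast_one, one_mul] at h
  rw [sekiguchiEntry_apply, sekiguchiEntry_apply, Derivation.leibniz, smul_eq_mul, smul_eq_mul,
    ← add_assoc, add_smul _ (1 : ℝ), one_smul]
  simp only [smul_eq_C_mul]
  linear_combination (X i ^ (N - 1 - (j : ℕ)) * f) * h

/-- Moving x_i ∂/∂x_i past x_1⋯x_N adds 1, which is absorbed into u. A full column added to the
diagram shifts the eigenvalue in the same way, so multiplication by x_1⋯x_N adds a column. -/
theorem sekiguchiDet_prod_X_mul (θ u : ℝ) (N : ℕ) (f : MvPolynomial (Fin N) ℝ) :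
    sekiguchiDet θ u N (monomial (onesExp N) 1 * f) =
      monomial (onesExp N) 1 * sekiguchiDet θ (u + 1) N f := by
  rw [sekiguchiDet_apply, sekiguchiDet_apply, Finset.mul_sum]
  refine Finset.sum_congr rfl fun σ _ => ?_
  rw [mul_smul_comm]
  congr 1
  induction (List.finRange N) with
  | nil => simp
  | cons a l ih =>
    rw [List.map_cons, List.prod_cons, List.map_cons, List.prod_cons, Module.End.mul_apply,
      Module.End.mul_apply, ih, sekiguchiEntry_prod_X_mul]

theorem IsSekEigen.prod_X_mul {θ : ℝ} {N : ℕ} {e : ℝ → ℝ} {f : MvPolynomial (Fin N) ℝ}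
    (hf : IsSekEigen θ N e f) : IsSekEigen θ N (fun u => e (u + 1)) (monomial (onesExp N) 1 * f) :=
  ⟨(isSymmetric_prod_X N).mul hf.1, fun u => by rw [sekiguchiDet_prod_X_mul, hf.2]; ring⟩

theorem sekEigenvalue_add_ones (θ : ℝ) {N : ℕ} (μ : Fin N →₀ ℕ) (u : ℝ) :
    sekEigenvalue θ N (μ + onesExp N : Fin N →₀ ℕ) u = sekEigenvalue θ N μ (u + 1) := by
  refine Finset.prod_congr rfl fun i _ => ?_
  rw [Finsupp.add_apply, onesExp_apply]
  push_cast
  ring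

/-- The diagram without its first column. -/
def removeColumn (lam : YoungDiagram) : YoungDiagram where
  cells := (lam.cells.filter fun c => 1 ≤ c.2).image fun c => (c.1, c.2 - 1)
  isLowerSet := by
    rintro ⟨a, b⟩ ⟨c, d⟩ hle h
    obtain ⟨h1, h2⟩ := Prod.mk_le_mk.1 hle
    simp only [Finset.coe_image, Finset.coe_filter, Set.mem_image, Set.mem_ofPred_eq, Prod.mk.injEq,
      Prod.exists, YoungDiagram.mem_cells] at h ⊢
    obtain ⟨p, q, ⟨h3, h4⟩, rfl, rfl⟩ := h
    exact ⟨c, d + 1, ⟨lam.up_left_mem h1 (by omega) h3, by omega⟩, rfl, rfl⟩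

theorem mem_removeColumn {lam : YoungDiagram} {i j : ℕ} :
    (i, j) ∈ removeColumn lam ↔ (i, j + 1) ∈ lam := by
  rw [← YoungDiagram.mem_cells]
  simp only [removeColumn, Finset.mem_image, Finset.mem_filter, YoungDiagram.mem_cells,
    Prod.mk.injEq, Prod.exists]
  constructor
  · rintro ⟨p, q, ⟨h3, h4⟩, rfl, rfl⟩
    rwa [Nat.sub_add_cancel h4]
  · intro h
    exact ⟨i, j + 1, ⟨h, by omega⟩, rfl, rfl⟩

theorem rowLen_removeColumn (lam : YoungDiagram) (i : ℕ) :
    (removeColumn lam).rowLen i = lam.rowLen i - 1 := by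
  have h : ∀ j, j < (removeColumn lam).rowLen i ↔ j + 1 < lam.rowLen i := fun j => by
    rw [← YoungDiagram.mem_iff_lt_rowLen, ← YoungDiagram.mem_iff_lt_rowLen, mem_removeColumn]
  have h1 := h ((removeColumn lam).rowLen i)
  have h2 := h (lam.rowLen i - 1)
  have h3 := h ((removeColumn lam).rowLen i - 1)
  omega

theorem colLen_removeColumn (lam : YoungDiagram) (j : ℕ) :
    (removeColumn lam).colLen j = lam.colLen (j + 1) := by
  have h : ∀ i, i < (removeColumn lam).colLen j ↔ i < lam.colLen (j + 1) := fun j => by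
    rw [← YoungDiagram.mem_iff_lt_colLen, ← YoungDiagram.mem_iff_lt_colLen, mem_removeColumn]
  have h1 := h ((removeColumn lam).colLen j)
  have h2 := h (lam.colLen (j + 1))
  omega

theorem colLen_removeColumn_le (lam : YoungDiagram) :
    (removeColumn lam).colLen 0 ≤ lam.colLen 0 := by
  rw [colLen_removeColumn]
  exact lam.colLen_anti 0 1 (by omega)

theorem rowExp_removeColumn {N : ℕ} {lam : YoungDiagram} (h : N ≤ lam.colLen 0) :
    rowExp N (removeColumn lam) + onesExp N = rowExp N lam := by
  ext i
  have : lam.rowLen i ≠ 0 := by rw [Ne, rowLen_eq_zero]; have := i.2; omega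
  simp only [Finsupp.add_apply, rowExp_apply, onesExp_apply, rowLen_removeColumn]
  omega

theorem card_eq_sum_rowLen {N : ℕ} {lam : YoungDiagram} (h : lam.colLen 0 ≤ N) :
    lam.card = ∑ i : Fin N, lam.rowLen i := by
  have h1 : lam.cells = Finset.univ.biUnion fun i : Fin N => lam.row i := by
    ext ⟨a, b⟩
    simp only [YoungDiagram.mem_cells, Finset.mem_biUnion, Finset.mem_univ, true_and,
      YoungDiagram.mem_row_iff]
    constructor
    · intro hm
      have : a < N := by
        have := lam.up_left_mem le_rfl (Nat.zero_le b) hm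
        rw [YoungDiagram.mem_iff_lt_colLen] at this
        omega
      exact ⟨⟨a, this⟩, hm, rfl⟩
    · rintro ⟨i, hm, -⟩; exact hm
  rw [YoungDiagram.card, h1, Finset.card_biUnion]
  · exact Finset.sum_congr rfl fun i _ => (lam.rowLen_eq_card).symm
  · intro i _ j _ hij
    rw [Function.onFun, Finset.disjoint_left]
    intro c hc hc'
    rw [YoungDiagram.mem_row_iff] at hc hc'
    exact hij (Fin.ext (hc.2.symm.trans hc'.2))

theorem degree_rowExp {N : ℕ} {lam : YoungDiagram} (h : lam.colLen 0 ≤ N) :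
    (rowExp N lam).degree = lam.card := by
  rw [card_eq_sum_rowLen h, Finsupp.degree_eq_sum]
  rfl

theorem IsJackPolynomial.of_removeColumn {θ : ℝ} {N : ℕ} {lam : YoungDiagram} (h : N ≤ lam.colLen 0)
    {f : MvPolynomial (Fin N) ℝ} (hf : IsJackPolynomial θ N (removeColumn lam) f) :
    IsJackPolynomial θ N lam (monomial (onesExp N) 1 * f) := by
  rw [isJackPolynomial_iff] at hf ⊢
  rw [← rowExp_removeColumn h]
  refine ⟨?_, ?_⟩
  · convert hf.1.prod_X_mul using 1
    funext u
    rw [sekEigenvalue_add_ones]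
  · rw [add_comm, coeff_monomial_mul, one_mul, hf.2]

/-! ### Stability -/

theorem restrictLast_X_castSucc (n : ℕ) (i : Fin n) : restrictLast n (X i.castSucc) = X i := by
  have := killCompl_rename_app (Fin.castSucc_injective n) (X i : MvPolynomial (Fin n) ℝ)
  rwa [rename_X] at this

theorem restrictLast_X_last (n : ℕ) : restrictLast n (X (Fin.last n)) = 0 := by
  unfold restrictLast killCompl
  rw [aeval_X, dif_neg]
  rintro ⟨i, hi⟩
  exact (Fin.castSucc_lt_last i).ne hi

theorem restrictLast_C (n : ℕ) (r : ℝ) : restrictLast n (C r) = C r := by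
  rw [← algebraMap_eq, AlgHom.commutes]; rfl

theorem restrictLast_monomial (n : ℕ) (μ : Fin (n + 1) →₀ ℕ) :
    restrictLast n (monomial μ 1) = (∏ i : Fin n, X i ^ μ i.castSucc) * 0 ^ μ (Fin.last n) := by
  rw [monomial_eq, C_1, one_mul, Finsupp.prod_fintype _ _ (by simp), map_prod, Fin.prod_univ_castSucc]
  simp only [map_pow, restrictLast_X_castSucc, restrictLast_X_last]

/-- The exponent vector with a zero appended. -/
def snocZero {n : ℕ} (μ : Fin n →₀ ℕ) : Fin (n + 1) →₀ ℕ := μ.mapDomain Fin.castSucc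

@[simp] theorem snocZero_castSucc {n : ℕ} (μ : Fin n →₀ ℕ) (i : Fin n) :
    snocZero μ i.castSucc = μ i := Finsupp.mapDomain_apply (Fin.castSucc_injective n) μ i

@[simp] theorem snocZero_last {n : ℕ} (μ : Fin n →₀ ℕ) : snocZero μ (Fin.last n) = 0 :=
  Finsupp.mapDomain_of_notMem_range _ _ (by rintro ⟨i, hi⟩; exact (Fin.castSucc_lt_last i).ne hi)

theorem coeff_restrictLast {n : ℕ} (f : MvPolynomial (Fin (n + 1)) ℝ) (μ : Fin n →₀ ℕ) :
    coeff μ (restrictLast n f) = coeff (snocZero μ) f := by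
  rw [restrictLast, coeff_killCompl]; rfl

theorem snocZero_rowExp {n : ℕ} {lam : YoungDiagram} (h : lam.colLen 0 ≤ n) :
    snocZero (rowExp n lam) = rowExp (n + 1) lam := by
  ext i
  induction i using Fin.lastCases with
  | last => rw [snocZero_last, rowExp_apply, eq_comm, rowLen_eq_zero]; simpa using h
  | cast i => simp

/-- At x_{n+1} = 0 the last row of the determinant survives only in the last column, where it is the
scalar u. In the remaining minor every entry keeps a spare factor x_i, and the renumbering of the
columns turns u into u + θ. -/
theorem restrictLast_sekiguchiDet (θ u : ℝ) (n : ℕ) (f : MvPolynomial (Fin (n + 1)) ℝ) :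
    restrictLast n (sekiguchiDet θ u (n + 1) f) =
      C u * monomial (onesExp n) 1 * sekiguchiDet θ (u + θ) n (restrictLast n f) := by
  induction f using MvPolynomial.induction_on' with
  | add p q hp hq => simp only [map_add, hp, hq, mul_add]
  | monomial μ r =>
    have hr : monomial μ r = r • monomial μ (1 : ℝ) := by rw [smul_monomial, smul_eq_mul, mul_one]
    rw [hr, map_smul, map_smul, map_smul, map_smul, mul_smul_comm]
    congr 1
    rw [sekiguchiDet_monomial, map_mul, restrictLast_monomial]
    by_cases h0 : μ (Fin.last n) = 0
    swap
    · simp [h0]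
    rw [h0, pow_zero, mul_one]
    let ν : Fin n →₀ ℕ := Finsupp.equivFunOnFinite.symm fun i => μ i.castSucc
    have hν : ∏ i : Fin n, (X i : MvPolynomial (Fin n) ℝ) ^ μ i.castSucc = monomial ν 1 := by
      rw [monomial_eq, C_1, one_mul, Finsupp.prod_fintype _ _ (by simp)]
      rfl
    rw [hν, sekiguchiDet_monomial, ← mul_assoc]
    congr 1
    rw [AlgHom.map_det, Matrix.det_succ_row _ (Fin.last n), Finset.sum_eq_single (Fin.last n)]
    · have h1 : ((restrictLast n).mapMatrix (Matrix.of fun i j : Fin (n + 1) =>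
          (X i ^ (n + 1 - 1 - (j : ℕ)) * C (sekFactor θ u (n + 1) j (μ i)) :
            MvPolynomial (Fin (n + 1)) ℝ))).submatrix (Fin.last n).succAbove (Fin.last n).succAbove =
          Matrix.of fun i j : Fin n => X i * Matrix.of (fun i j : Fin n =>
            (X i ^ (n - 1 - (j : ℕ)) * C (sekFactor θ (u + θ) n j (ν i)))) i j := by
        ext1 i j
        simp only [Matrix.submatrix_apply, Fin.succAbove_last, AlgHom.mapMatrix_apply,
          Matrix.map_apply, Matrix.of_apply, map_mul, map_pow, restrictLast_X_castSucc,
          restrictLast_C, Fin.val_castSucc]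
        rw [← mul_assoc, ← pow_succ']
        have := j.2
        congr 2
        · omega
        · simp only [sekFactor, Fin.val_castSucc, ν, Finsupp.coe_equivFunOnFinite_symm]
          push_cast
          ring
      rw [h1, Matrix.det_mul_column, prod_X_eq]
      simp only [AlgHom.mapMatrix_apply, Matrix.map_apply, Matrix.of_apply, restrictLast_C,
        Fin.val_last, Nat.add_sub_cancel, Nat.sub_self, pow_zero, one_mul, sekFactor, h0]
      rw [← two_mul, pow_mul, neg_one_sq, one_pow, one_mul, mul_assoc]
      push_cast
      congr 2
      ring
    · intro j _ hj
      simp only [AlgHom.mapMatrix_apply, Matrix.map_apply, Matrix.of_apply, map_mul, map_pow,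
        restrictLast_X_last]
      have : (j : ℕ) < n := Fin.val_lt_last hj
      rw [zero_pow (by omega)]
      simp
    · simp

theorem restrictLast_vandermonde (n : ℕ) :
    restrictLast n (vandermonde (n + 1)) = monomial (onesExp n) 1 * vandermonde n := by
  rw [vandermonde, map_prod, Fin.prod_univ_castSucc, ← prod_X_eq, vandermonde,
    ← Finset.prod_mul_distrib]
  have h1 : Finset.Ioi (Fin.last n) = ∅ := by ext i; simp [Fin.le_last]
  rw [h1, Finset.prod_empty, map_one, mul_one]
  refine Finset.prod_congr rfl fun i _ => ?_
  have h2 : Finset.Ioi i.castSucc = insert (Fin.last n) ((Finset.Ioi i).map Fin.castSuccEmb) := by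
    ext j
    induction j using Fin.lastCases with
    | last => simp [Fin.castSucc_lt_last]
    | cast j =>
      simp only [Finset.mem_Ioi, Fin.castSucc_lt_castSucc_iff, Finset.mem_insert, Fin.castSucc_ne_last,
        Finset.mem_map, Fin.castSuccEmb_apply, Fin.castSucc_inj, exists_eq_right, false_or]
  rw [h2, Finset.prod_insert, Finset.prod_map, map_mul, map_prod]
  · simp only [map_sub, Fin.castSuccEmb_apply, restrictLast_X_castSucc, restrictLast_X_last, sub_zero]
  · simp only [Finset.mem_map, not_exists, not_and]
    intro j _
    exact Fin.castSucc_ne_last j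

theorem restrictLast_isSymmetric {n : ℕ} {f : MvPolynomial (Fin (n + 1)) ℝ} (hf : f.IsSymmetric) :
    (restrictLast n f).IsSymmetric := by
  intro σ
  obtain ⟨τ, hτ⟩ : ∃ τ : Equiv.Perm (Fin (n + 1)), (∀ i : Fin n, τ i.castSucc = (σ i).castSucc) := by
    refine ⟨σ.viaFintypeEmbedding Fin.castSuccEmb, fun i => ?_⟩
    exact Equiv.Perm.viaFintypeEmbedding_apply_image σ Fin.castSuccEmb i
  ext μ
  have h1 : μ = (μ.mapDomain σ.symm).mapDomain σ := by
    rw [← Finsupp.mapDomain_comp]; simp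
  rw [h1, coeff_rename_mapDomain _ σ.injective, coeff_restrictLast, coeff_restrictLast,
    ← coeff_mapDomain_of_isSymmetric hf τ]
  congr 1
  rw [snocZero, snocZero, ← Finsupp.mapDomain_comp, ← Finsupp.mapDomain_comp]
  congr 1
  funext i
  simpa using hτ (σ.symm i)

theorem continuous_coeff_sekiguchiDet (θ : ℝ) {N : ℕ} (f : MvPolynomial (Fin N) ℝ)
    (ρ : Fin N →₀ ℕ) : Continuous fun u => coeff ρ (sekiguchiDet θ u N f) := by
  simp only [coeff_sekiguchiDet, altSum]
  refine continuous_finsetSum _ fun σ _ => ?_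
  split_ifs
  · simp only [sekFactor]
    fun_prop
  · fun_prop

theorem continuous_sekEigenvalue (θ : ℝ) (N : ℕ) (μ : Fin N → ℕ) :
    Continuous (sekEigenvalue θ N μ) := by
  unfold sekEigenvalue
  fun_prop

theorem sekEigenvalue_snocZero (θ : ℝ) {n : ℕ} (μ : Fin n →₀ ℕ) (u : ℝ) :
    sekEigenvalue θ (n + 1) (snocZero μ) u = u * sekEigenvalue θ n μ (u + θ) := by
  rw [sekEigenvalue, Fin.prod_univ_castSucc, mul_comm]
  simp only [snocZero_last, snocZero_castSucc, Fin.val_last, Fin.val_castSucc]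
  congr 1
  · push_cast; ring
  · refine Finset.prod_congr rfl fun i _ => ?_
    push_cast
    ring

/-- After restriction both sides carry the factor u - θ. It can be cancelled for u ≠ θ, and
continuity in u recovers the excluded value. -/
theorem IsSekEigen.restrictLast {θ : ℝ} {n : ℕ} {μ : Fin n →₀ ℕ} {f : MvPolynomial (Fin (n + 1)) ℝ}
    (hf : IsSekEigen θ (n + 1) (sekEigenvalue θ (n + 1) (snocZero μ)) f) :
    IsSekEigen θ n (sekEigenvalue θ n μ) (restrictLast n f) := by
  refine ⟨restrictLast_isSymmetric hf.1, fun u => ?_⟩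
  ext ρ
  revert u
  rw [← funext_iff]
  refine Continuous.ext_on (dense_compl_singleton θ) (continuous_coeff_sekiguchiDet _ _ _) ?_ ?_
  · have h : (fun u => coeff ρ (JackMeasures.vandermonde n * (C (sekEigenvalue θ n μ u) *
        JackMeasures.restrictLast n f))) = fun u => sekEigenvalue θ n μ u *
          coeff ρ (JackMeasures.vandermonde n * JackMeasures.restrictLast n f) :=
      funext fun u => by rw [mul_left_comm, coeff_C_mul]
    rw [h]
    exact (continuous_sekEigenvalue _ _ _).mul continuous_const
  · intro u hu
    have hu : u ≠ θ := hu
    have h := congrArg (JackMeasures.restrictLast n) (hf.2 (u - θ))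
    rw [restrictLast_sekiguchiDet, sub_add_cancel, map_mul, map_mul, restrictLast_vandermonde,
      restrictLast_C, sekEigenvalue_snocZero, sub_add_cancel, C_mul] at h
    have h0 : C (u - θ) * monomial (onesExp n) (1 : ℝ) ≠ 0 := by
      rw [Ne, mul_eq_zero, not_or]
      exact ⟨by rw [C_eq_zero]; exact sub_ne_zero.2 hu, by simp⟩
    refine congrArg (coeff ρ) (mul_left_cancel₀ h0 (h.trans ?_))
    ring

/-- At u = 0 the left side restricts to zero, because of the factor u in
`restrictLast_sekiguchiDet`, while the right side restricts to a nonzero factor times the restricted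
function. -/
theorem IsSekEigen.restrictLast_eq_zero {θ : ℝ} {n : ℕ} {e : ℝ → ℝ}
    {f : MvPolynomial (Fin (n + 1)) ℝ} (hf : IsSekEigen θ (n + 1) e f) (he : e 0 ≠ 0) :
    JackMeasures.restrictLast n f = 0 := by
  have h := congrArg (JackMeasures.restrictLast n) (hf.2 0)
  rw [restrictLast_sekiguchiDet, map_mul, map_mul, restrictLast_vandermonde,
    restrictLast_C, C_0, zero_mul, zero_mul, eq_comm, mul_eq_zero, mul_eq_zero, mul_eq_zero] at h
  rcases h with (h | h) | h | h
  · simp at h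
  · exact absurd h (vandermonde_ne_zero n)
  · exact absurd (C_eq_zero.1 h) he
  · exact h

theorem IsJackPolynomial.restrictLast {θ : ℝ} {n : ℕ} {lam : YoungDiagram} (h : lam.colLen 0 ≤ n)
    {f : MvPolynomial (Fin (n + 1)) ℝ} (hf : IsJackPolynomial θ (n + 1) lam f) :
    IsJackPolynomial θ n lam (restrictLast n f) := by
  rw [isJackPolynomial_iff] at hf ⊢
  rw [← snocZero_rowExp h] at hf
  exact ⟨hf.1.restrictLast, by rw [coeff_restrictLast, hf.2]⟩

theorem IsJackPolynomial.restrictLast_eq_zero {θ : ℝ} (hθ : 0 < θ) {n : ℕ} {lam : YoungDiagram}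
    (h : n < lam.colLen 0) {f : MvPolynomial (Fin (n + 1)) ℝ}
    (hf : IsJackPolynomial θ (n + 1) lam f) : JackMeasures.restrictLast n f = 0 := by
  rw [isJackPolynomial_iff] at hf
  -- All n + 1 rows are nonempty, so every factor of the eigenvalue at u = 0 is at least 1.
  refine hf.1.restrictLast_eq_zero (Finset.prod_ne_zero_iff.2 fun i _ => ?_)
  have h1 : lam.rowLen i ≠ 0 := by rw [Ne, rowLen_eq_zero]; have := i.2; omega
  have h2 : (1 : ℝ) ≤ lam.rowLen i := by exact_mod_cast Nat.one_le_iff_ne_zero.2 h1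
  have h3 : ((i : ℕ) : ℝ) ≤ n := by exact_mod_cast Nat.lt_succ_iff.1 i.2
  rw [rowExp_apply]
  push_cast
  have : 0 ≤ ((n : ℝ) + 1 - 1 - (i : ℕ)) * θ := mul_nonneg (by linarith) hθ.le
  linarith
end
end JackMeasures

namespace JackMeasures
open MvPolynomial
noncomputable section

/-! ### The basis of Jack polynomials -/

/-- The Jack polynomial in `N` variables (if there is one). -/
def jackPoly (θ : ℝ) (N : ℕ) (lam : YoungDiagram) : MvPolynomial (Fin N) ℝ :=
  Classical.epsilon (IsJackPolynomial θ N lam)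

/-- The Jack polynomials in `N` variables exist and are homogeneous. -/
def JackExists (θ : ℝ) (N : ℕ) : Prop :=
  ∀ lam : YoungDiagram, lam.colLen 0 ≤ N →
    ∃ f, IsJackPolynomial θ N lam f ∧ f.IsHomogeneous lam.card

/-- The diagrams with at most `N` rows. -/
abbrev Diagrams (N : ℕ) : Type := {lam : YoungDiagram // lam.colLen 0 ≤ N}

theorem IsJackPolynomial.eq_jackPoly {θ : ℝ} (hθ : 0 < θ) {N : ℕ} {lam : YoungDiagram}
    {f : MvPolynomial (Fin N) ℝ} (hf : IsJackPolynomial θ N lam f) : f = jackPoly θ N lam :=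
  hf.unique hθ (Classical.epsilon_spec ⟨f, hf⟩)

section Basis

variable {θ : ℝ} (hθ : 0 < θ) {N : ℕ} (h : JackExists θ N)
include hθ h

theorem JackExists.isJackPolynomial (lam : Diagrams N) :
    IsJackPolynomial θ N lam.1 (jackPoly θ N lam.1) := by
  obtain ⟨f, hf, -⟩ := h lam.1 lam.2
  rwa [← hf.eq_jackPoly hθ]

theorem JackExists.isHomogeneous (lam : Diagrams N) :
    (jackPoly θ N lam.1).IsHomogeneous lam.1.card := by
  obtain ⟨f, hf, hh⟩ := h lam.1 lam.2
  rwa [← hf.eq_jackPoly hθ]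

theorem JackExists.coeff_self (lam : Diagrams N) :
    coeff (rowExp N lam.1) (jackPoly θ N lam.1) = 1 := (h.isJackPolynomial hθ lam).2

theorem JackExists.coeff_eq_zero {lam mu : Diagrams N} (hne : mu ≠ lam)
    (hw : lexWeight (rowExp N lam.1) ≤ lexWeight (rowExp N mu.1)) :
    coeff (rowExp N mu.1) (jackPoly θ N lam.1) = 0 := by
  by_contra hc
  rcases (isJackPolynomial_iff.1 (h.isJackPolynomial hθ lam)).1.lexWeight_lt hθ
    (rowExp_antitone N lam.1) (rowExp_antitone N mu.1) hc with h1 | h1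
  · omega
  · exact hne (Subtype.ext (rowExp_injective mu.2 lam.2 h1))

theorem JackExists.linearIndependent :
    LinearIndependent ℝ fun lam : Diagrams N =>
      (⟨jackPoly θ N lam.1, (h.isJackPolynomial hθ lam).1⟩ : symmetricSubalgebra (Fin N) ℝ) := by
  rw [linearIndependent_iff]
  intro l hl
  by_contra hne
  obtain ⟨mu, hmu, hmax⟩ := l.support.exists_max_image (fun lam => lexWeight (rowExp N lam.1))
    (Finsupp.support_nonempty_iff.2 hne)
  have h1 := congrArg (fun f => coeff (rowExp N mu.1) (f : symmetricSubalgebra (Fin N) ℝ).1) hl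
  simp only [Finsupp.linearCombination_apply, Finsupp.sum] at h1
  rw [AddSubmonoidClass.coe_finsetSum, coeff_sum, Finset.sum_eq_single mu] at h1
  · simp only [SetLike.val_smul, coeff_smul, h.coeff_self hθ] at h1
    rw [Finsupp.mem_support_iff] at hmu
    apply hmu
    simpa using h1
  · intro lam hlam hne
    simp only [SetLike.val_smul, coeff_smul]
    rw [h.coeff_eq_zero hθ hne.symm (hmax lam hlam), smul_zero]
  · intro hn; exact absurd hmu hn

/-- Induction on a strict bound for the weights that occur. Subtracting the Jack polynomials of the
sorted exponents of top weight, with the matching coefficients, removes that level: a Jack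
polynomial has no other sorted exponent of weight at least its own. -/
theorem JackExists.mem_span (k : ℕ) (f : symmetricSubalgebra (Fin N) ℝ)
    (hf : ∀ μ : Fin N →₀ ℕ, Antitone μ → coeff μ f.1 ≠ 0 → lexWeight μ < k) :
    f ∈ Submodule.span ℝ (Set.range fun lam : Diagrams N =>
      (⟨jackPoly θ N lam.1, (h.isJackPolynomial hθ lam).1⟩ : symmetricSubalgebra (Fin N) ℝ)) := by
  classical
  induction k generalizing f with
  | zero =>
    have : f = 0 := by
      by_contra hne
      obtain ⟨μ, h1, h2, -⟩ := exists_max_antitone f.2 (f := f.1) (fun h => hne (Subtype.ext h))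
      exact absurd (hf μ h1 h2) (by omega)
    rw [this]
    exact Submodule.zero_mem _
  | succ k ih =>
    choose! D hD1 hD2 using fun (μ : Fin N →₀ ℕ) (hμ : Antitone μ) => exists_diagram μ hμ
    let A := f.1.support.filter fun μ : Fin N →₀ ℕ => Antitone μ ∧ lexWeight μ = k
    let J : (Fin N →₀ ℕ) → symmetricSubalgebra (Fin N) ℝ := fun μ =>
      if hμ : Antitone μ then
        ⟨jackPoly θ N (D μ), (h.isJackPolynomial hθ ⟨D μ, hD1 μ hμ⟩).1⟩ else 0
    have hJ : ∀ μ, J μ ∈ Submodule.span ℝ (Set.range fun lam : Diagrams N =>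
      (⟨jackPoly θ N lam.1, (h.isJackPolynomial hθ lam).1⟩ : symmetricSubalgebra (Fin N) ℝ)) := by
      intro μ
      by_cases hμ : Antitone μ
      · simp only [J, dif_pos hμ]
        exact Submodule.subset_span ⟨⟨D μ, hD1 μ hμ⟩, rfl⟩
      · simp [J, hμ]
    have key := ih (f - ∑ μ ∈ A, coeff μ f.1 • J μ) ?_
    · have := Submodule.add_mem _ key (Submodule.sum_mem _ fun μ (_ : μ ∈ A) =>
        Submodule.smul_mem _ (coeff μ f.1) (hJ μ))
      rwa [sub_add_cancel] at this
    intro ν hν hc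
    have hval : (∑ μ ∈ A, coeff μ f.1 • J μ).1 = ∑ μ ∈ A, coeff μ f.1 • (J μ).1 := by
      rw [AddSubmonoidClass.coe_finsetSum]; rfl
    rw [AddSubgroupClass.coe_sub, hval, coeff_sub, coeff_sum] at hc
    by_contra hk
    have hz : ∀ μ ∈ A, μ ≠ ν → coeff ν (coeff μ f.1 • (J μ).1) = 0 := by
      intro μ hμ hne
      obtain ⟨-, h1, h2⟩ := Finset.mem_filter.1 hμ
      rw [coeff_smul]
      simp only [J, dif_pos h1]
      have h3 := h.coeff_eq_zero hθ (lam := ⟨D μ, hD1 μ h1⟩) (mu := ⟨D ν, hD1 ν hν⟩)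
        (fun he => hne (by rw [← hD2 μ h1, ← hD2 ν hν, Subtype.mk.inj he]))
        (by simp only; rw [hD2 μ h1, hD2 ν hν]; omega)
      simp only [hD2 ν hν] at h3
      rw [h3, smul_zero]
    by_cases hνA : ν ∈ A
    · rw [Finset.sum_eq_single_of_mem ν hνA fun μ hμ hne => hz μ hμ hne] at hc
      apply hc
      simp only [J, dif_pos hν]
      have h3 := h.coeff_self hθ ⟨D ν, hD1 ν hν⟩
      simp only [hD2 ν hν] at h3
      rw [coeff_smul, h3, smul_eq_mul, mul_one, sub_self]
    · rw [Finset.sum_eq_zero fun μ hμ => hz μ hμ (fun he => hνA (he ▸ hμ)), sub_zero] at hc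
      have h1 := hf ν hν hc
      exact hνA (Finset.mem_filter.2 ⟨mem_support_iff.2 hc, hν, by omega⟩)

theorem JackExists.span_eq_top :
    ⊤ ≤ Submodule.span ℝ (Set.range fun lam : Diagrams N =>
      (⟨jackPoly θ N lam.1, (h.isJackPolynomial hθ lam).1⟩ : symmetricSubalgebra (Fin N) ℝ)) := by
  intro f _
  refine h.mem_span hθ (f.1.support.sup lexWeight + 1) f fun μ _ hc => ?_
  exact Nat.lt_succ_of_le (Finset.le_sup (f := lexWeight) (mem_support_iff.2 hc))

/-- The basis of Jack polynomials of the algebra of symmetric polynomials. -/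
def JackExists.basis : Module.Basis (Diagrams N) ℝ (symmetricSubalgebra (Fin N) ℝ) :=
  Module.Basis.mk (h.linearIndependent hθ) (h.span_eq_top hθ)

theorem JackExists.basis_val (lam : Diagrams N) : ((h.basis hθ) lam).1 = jackPoly θ N lam.1 := by
  rw [JackExists.basis, Module.Basis.mk_apply]

theorem JackExists.expansion (f : symmetricSubalgebra (Fin N) ℝ) :
    f.1 = ((h.basis hθ).repr f).sum fun lam c => c • jackPoly θ N lam.1 := by
  conv_lhs => rw [← (h.basis hθ).linearCombination_repr f]
  rw [Finsupp.linearCombination_apply, Finsupp.sum, AddSubmonoidClass.coe_finsetSum]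
  refine Finset.sum_congr rfl fun lam _ => ?_
  rw [SetLike.val_smul, h.basis_val hθ]

/-- The coefficients are determined by any expansion. -/
theorem JackExists.repr_eq (f : symmetricSubalgebra (Fin N) ℝ) (c : Diagrams N →₀ ℝ)
    (hc : f.1 = c.sum fun lam a => a • jackPoly θ N lam.1) : (h.basis hθ).repr f = c := by
  have : f = Finsupp.linearCombination ℝ (h.basis hθ) c := by
    apply Subtype.ext
    rw [hc, Finsupp.linearCombination_apply, Finsupp.sum, Finsupp.sum, AddSubmonoidClass.coe_finsetSum]
    refine Finset.sum_congr rfl fun lam _ => ?_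
    rw [SetLike.val_smul, h.basis_val hθ]
  rw [this, Module.Basis.repr_linearCombination]

/-- Taking the component of degree n in the expansion discards the diagrams of other sizes and does
not change the function, so uniqueness of coordinates kills their coefficients. -/
theorem JackExists.repr_eq_zero_of_homogeneous {f : symmetricSubalgebra (Fin N) ℝ} {n : ℕ}
    (hf : f.1.IsHomogeneous n) {lam : Diagrams N} (hl : lam.1.card ≠ n) :
    (h.basis hθ).repr f lam = 0 := by
  classical
  have h1 : (h.basis hθ).repr f = ((h.basis hθ).repr f).filter fun lam => lam.1.card = n := by
    apply h.repr_eq hθ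
    have h2 := congrArg (homogeneousComponent n) (h.expansion hθ f)
    rw [homogeneousComponent_of_mem hf, if_pos rfl] at h2
    rw [h2, Finsupp.sum, map_sum, Finsupp.sum, Finsupp.support_filter, Finset.sum_filter]
    refine Finset.sum_congr rfl fun mu _ => ?_
    rw [map_smul, homogeneousComponent_of_mem (h.isHomogeneous hθ mu)]
    by_cases hm : mu.1.card = n
    · rw [if_pos hm, if_pos hm.symm, Finsupp.filter_apply, if_pos hm]
    · rw [if_neg hm, if_neg (Ne.symm hm), smul_zero]
  rw [h1, Finsupp.filter_apply, if_neg hl]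

end Basis
end
end JackMeasures

/-! ### The Cauchy kernel and its symmetry under Sekiguchi's operators. -/

namespace JackMeasures
open MvPolynomial
noncomputable section

/-! ### A determinantal identity of Cauchy type -/

section CauchyDet

variable {B : Type*} [CommRing B] {N : ℕ}

/-- The polynomial `∏_{l ≠ j} (1 - y_l T)`. -/
def omitPoly (y : Fin N → B) (j : Fin N) : Polynomial B :=
  ∏ l ∈ Finset.univ.erase j, (1 - Polynomial.C (y l) * Polynomial.X)

/-- The matrix of coefficients of the polynomials `∏_{l ≠ j} (1 - y_l T)`. -/
def omitMatrix (y : Fin N → B) : Matrix (Fin N) (Fin N) B :=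
  Matrix.of fun k j => (omitPoly y j).coeff (N - 1 - (k : ℕ))

theorem natDegree_omitPoly_lt (y : Fin N → B) (j : Fin N) : (omitPoly y j).natDegree < N := by
  have h1 : (omitPoly y j).natDegree ≤ ∑ l ∈ Finset.univ.erase j, 1 := by
    refine (Polynomial.natDegree_prod_le _ _).trans (Finset.sum_le_sum fun l _ => ?_)
    have h := Polynomial.natDegree_C_mul_le (y l) Polynomial.X
    have h2 : (Polynomial.X : Polynomial B).natDegree ≤ 1 := Polynomial.natDegree_X_le
    exact (Polynomial.natDegree_sub_le _ _).trans (by simp only [Polynomial.natDegree_one]; omega)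
  rw [Finset.sum_const, smul_eq_mul, mul_one, Finset.card_erase_of_mem (Finset.mem_univ _),
    Finset.card_univ, Fintype.card_fin] at h1
  have := j.2
  omega

theorem sum_fin_rev (f : ℕ → B) : ∑ k : Fin N, f (N - 1 - (k : ℕ)) = ∑ i ∈ Finset.range N, f i := by
  rw [← Fin.sum_univ_eq_sum_range, ← Equiv.sum_comp Fin.revPerm fun i : Fin N => f i]
  refine Finset.sum_congr rfl fun k _ => ?_
  rw [Fin.revPerm_apply, Fin.val_rev]
  congr 1
  omega

theorem sum_pow_mul_omitMatrix (y : Fin N → B) (j : Fin N) (x : B) :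
    ∑ k : Fin N, x ^ (N - 1 - (k : ℕ)) * omitMatrix y k j = (omitPoly y j).eval x := by
  rw [Polynomial.eval_eq_sum_range' (natDegree_omitPoly_lt y j)]
  simp only [omitMatrix, Matrix.of_apply]
  rw [sum_fin_rev fun i => x ^ i * (omitPoly y j).coeff i]
  exact Finset.sum_congr rfl fun i _ => mul_comm _ _

theorem sum_natCast_mul_pow_mul_omitMatrix (y : Fin N → B) (j : Fin N) (x : B) :
    ∑ k : Fin N, ((N - 1 - (k : ℕ) : ℕ) : B) * x ^ (N - 1 - (k : ℕ)) * omitMatrix y k j =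
      x * (Polynomial.derivative (omitPoly y j)).eval x := by
  rw [Polynomial.derivative_eval, Polynomial.sum_over_range' _ (by simp) N (natDegree_omitPoly_lt y j)]
  simp only [omitMatrix, Matrix.of_apply]
  rw [sum_fin_rev fun i => (i : B) * x ^ i * (omitPoly y j).coeff i, Finset.mul_sum]
  refine Finset.sum_congr rfl fun i _ => ?_
  rcases i with _ | i
  · simp
  · rw [Nat.add_sub_cancel, pow_succ]
    ring

theorem eval_omitPoly (y : Fin N → B) (j : Fin N) (x : B) :
    (omitPoly y j).eval x = ∏ l ∈ Finset.univ.erase j, (1 - x * y l) := by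
  rw [omitPoly, Polynomial.eval_prod]
  exact Finset.prod_congr rfl fun l _ => by simp [mul_comm (y l)]

/-- The matrix `x_i ^ (N - 1 - k) ((N - 1 - k) t + v + t ∑_j x_i y_j I_ij)`, where `I_ij` is
meant to be `1 / (1 - x_i y_j)`. -/
def sekKernelMatrix (t v : B) (x y : Fin N → B) (I : Fin N → Fin N → B) :
    Matrix (Fin N) (Fin N) B :=
  Matrix.of fun i k => x i ^ (N - 1 - (k : ℕ)) *
    (((N - 1 - (k : ℕ) : ℕ) : B) * t + v + t * ∑ j, x i * y j * I i j)

variable {x y : Fin N → B} {I : Fin N → Fin N → B} (hI : ∀ i j, (1 - x i * y j) * I i j = 1)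
include hI

theorem eval_omitPoly_of_inv (i j : Fin N) :
    (omitPoly y j).eval (x i) = (∏ l, (1 - x i * y l)) * I i j := by
  rw [eval_omitPoly, ← Finset.mul_prod_erase _ _ (Finset.mem_univ j), mul_assoc, mul_comm,
    mul_assoc, mul_comm (I i j), hI, mul_one]

theorem mul_eval_derivative_omitPoly (i j : Fin N) :
    x i * (Polynomial.derivative (omitPoly y j)).eval (x i) =
      -(∑ l ∈ Finset.univ.erase j, x i * y l * I i l) * (omitPoly y j).eval (x i) := by
  rw [eval_omitPoly]
  rw [omitPoly, Polynomial.derivative_prod_finset, Polynomial.eval_finsetSum, Finset.mul_sum, neg_mul,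
    Finset.sum_mul, ← Finset.sum_neg_distrib]
  refine Finset.sum_congr rfl fun l hl => ?_
  rw [← Finset.mul_prod_erase _ _ hl]
  simp only [Polynomial.eval_mul, Polynomial.eval_prod, Polynomial.eval_sub, Polynomial.eval_one,
    Polynomial.eval_C, Polynomial.eval_X, Polynomial.derivative_sub, Polynomial.derivative_one,
    Polynomial.derivative_mul, Polynomial.derivative_C, Polynomial.derivative_X, zero_mul, zero_add,
    mul_one, zero_sub, Polynomial.eval_neg, mul_comm (y _) (x i)]
  linear_combination (x i * y l * ∏ m ∈ (Finset.univ.erase j).erase l, (1 - x i * y m)) * hI i l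

/-- The sum over columns evaluates P = ∏_{l ≠ j} (1 - y_l T) and T P' at x_i. The logarithmic
derivative of P cancels all the terms l ≠ j of the inner sum. Apart from a factor depending on the
row, the entry that remains is symmetric in x and y. -/
theorem sekKernelMatrix_mul_omitMatrix (t v : B) :
    sekKernelMatrix t v x y I * omitMatrix y =
      Matrix.of fun i j => (∏ l, (1 - x i * y l)) * (I i j * (v + t * (x i * y j * I i j))) := by
  ext i j
  have h1 := sum_pow_mul_omitMatrix y j (x i)
  have h2 := sum_natCast_mul_pow_mul_omitMatrix y j (x i)
  rw [mul_eval_derivative_omitPoly hI] at h2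
  rw [Matrix.mul_apply, Matrix.of_apply, ← mul_assoc, ← eval_omitPoly_of_inv hI]
  have h3 := Finset.add_sum_erase Finset.univ (fun l => x i * y l * I i l) (Finset.mem_univ j)
  calc ∑ k, sekKernelMatrix t v x y I i k * omitMatrix y k j
      = t * ∑ k : Fin N, ((N - 1 - (k : ℕ) : ℕ) : B) * x i ^ (N - 1 - (k : ℕ)) * omitMatrix y k j +
        (v + t * ∑ j, x i * y j * I i j) *
          ∑ k : Fin N, x i ^ (N - 1 - (k : ℕ)) * omitMatrix y k j := by
        rw [Finset.mul_sum, Finset.mul_sum, ← Finset.sum_add_distrib]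
        refine Finset.sum_congr rfl fun k _ => ?_
        simp only [sekKernelMatrix, Matrix.of_apply]
        ring
    _ = _ := by
        rw [h1, h2, ← h3]
        ring

theorem det_sekKernelMatrix_mul (t v : B) :
    (sekKernelMatrix t v x y I).det * (omitMatrix y).det = (∏ i, ∏ l, (1 - x i * y l)) *
      (Matrix.of fun i j => I i j * (v + t * (x i * y j * I i j))).det := by
  rw [← Matrix.det_mul, sekKernelMatrix_mul_omitMatrix hI, ← Matrix.det_mul_column]
  rfl

omit hI in
theorem sekKernelMatrix_zero_one :
    sekKernelMatrix 0 1 x y I = Matrix.of fun i j : Fin N => x i ^ (N - 1 - (j : ℕ)) := by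
  ext i k
  simp [sekKernelMatrix]

/-- The determinant multiplied by that of `omitMatrix y` is symmetric in x and y, by
`det_sekKernelMatrix_mul`. For t = 0, v = 1 this is a statement about the Vandermonde determinants,
and eliminating the `omitMatrix` determinants between the two statements leaves the claim. -/
theorem det_sekKernelMatrix_symm [IsDomain B] (hx : Function.Injective x) (t v : B) :
    (∏ i : Fin N, ∏ j ∈ Finset.Ioi i, (y i - y j)) * (sekKernelMatrix t v x y I).det =
      (∏ i : Fin N, ∏ j ∈ Finset.Ioi i, (x i - x j)) *
        (sekKernelMatrix t v y x fun j i => I i j).det := by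
  have hI' : ∀ j i, (1 - y j * x i) * (fun j i => I i j) j i = 1 := fun j i => by
    rw [mul_comm (y j)]; exact hI i j
  have hsymm : ∀ t v : B, (sekKernelMatrix t v x y I).det * (omitMatrix y).det =
      (sekKernelMatrix t v y x fun j i => I i j).det * (omitMatrix x).det := by
    intro t v
    rw [det_sekKernelMatrix_mul hI, det_sekKernelMatrix_mul hI', Finset.prod_comm,
      ← Matrix.det_transpose]
    simp only [mul_comm (y _) (x _)]
    rfl
  have h01 := hsymm 0 1
  rw [sekKernelMatrix_zero_one, sekKernelMatrix_zero_one, det_rev_vandermonde, det_rev_vandermonde] at h01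
  -- Multiplication by the matrix of powers of the x_i evaluates the reversed polynomials ∏_{l ≠ j}
  -- (T - x_l) at the x_i, which gives a diagonal matrix with nonzero entries.
  have hne : (omitMatrix x).det ≠ 0 := by
    have hmul : (Matrix.of fun i k : Fin N => x i ^ (k : ℕ)) * omitMatrix x =
        Matrix.diagonal fun j => ∏ l ∈ Finset.univ.erase j, (x j - x l) := by
      ext i j
      rw [Matrix.mul_apply]
      have h1 : ∑ k, Matrix.of (fun i k : Fin N => x i ^ (k : ℕ)) i k * omitMatrix x k j =
          (Polynomial.reflect (N - 1) (omitPoly x j)).eval (x i) := by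
        have hd := natDegree_omitPoly_lt x j
        rw [Polynomial.eval_eq_sum_range' (n := N)]
        · rw [← Fin.sum_univ_eq_sum_range]
          refine Finset.sum_congr rfl fun k _ => ?_
          rw [Polynomial.coeff_reflect, Polynomial.revAt_le (by have := k.2; omega)]
          simp [omitMatrix, mul_comm]
        · refine lt_of_le_of_lt (Polynomial.natDegree_reflect_le) ?_
          rw [max_lt_iff]
          exact ⟨by have := i.2; omega, hd⟩
      have h2 : ∀ s : Finset (Fin N), Polynomial.reflect s.card
          (∏ l ∈ s, (1 - Polynomial.C (x l) * Polynomial.X)) =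
            ∏ l ∈ s, (Polynomial.X - Polynomial.C (x l)) := by
        intro s
        induction s using Finset.induction_on with
        | empty => simp
        | insert a s ha ih =>
          rw [Finset.prod_insert ha, Finset.prod_insert ha, Finset.card_insert_of_notMem ha,
            ← ih, add_comm, Polynomial.reflect_mul]
          · congr 1
            rw [Polynomial.reflect_sub, Polynomial.reflect_C_mul, Polynomial.reflect_one,
              Polynomial.reflect_one_X]
            simp
          · refine (Polynomial.natDegree_sub_le _ _).trans ?_
            have h := Polynomial.natDegree_C_mul_le (x a) Polynomial.X
            have h2 : (Polynomial.X : Polynomial B).natDegree ≤ 1 := Polynomial.natDegree_X_le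
            simp only [Polynomial.natDegree_one]; omega
          · refine (Polynomial.natDegree_prod_le _ _).trans ?_
            rw [Finset.card_eq_sum_ones]
            refine Finset.sum_le_sum fun l _ => ?_
            refine (Polynomial.natDegree_sub_le _ _).trans ?_
            have h := Polynomial.natDegree_C_mul_le (x l) Polynomial.X
            have h2 : (Polynomial.X : Polynomial B).natDegree ≤ 1 := Polynomial.natDegree_X_le
            simp only [Polynomial.natDegree_one]; omega
      have h3 := h2 (Finset.univ.erase j)
      rw [Finset.card_erase_of_mem (Finset.mem_univ _), Finset.card_univ, Fintype.card_fin] at h3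
      rw [h1, omitPoly, h3, Polynomial.eval_prod]
      simp only [Polynomial.eval_sub, Polynomial.eval_X, Polynomial.eval_C]
      by_cases hij : i = j
      · subst hij; rw [Matrix.diagonal_apply_eq]
      · rw [Matrix.diagonal_apply_ne _ hij]
        exact Finset.prod_eq_zero (Finset.mem_erase.2 ⟨hij, Finset.mem_univ _⟩) (sub_self _)
    intro h0
    have := congrArg Matrix.det hmul
    rw [Matrix.det_mul, h0, mul_zero, Matrix.det_diagonal, eq_comm, Finset.prod_eq_zero_iff] at this
    obtain ⟨j, -, hj⟩ := this
    obtain ⟨l, hl, hl'⟩ := Finset.prod_eq_zero_iff.1 hj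
    exact (Finset.ne_of_mem_erase hl) (hx (sub_eq_zero.1 hl')).symm
  by_cases hvx : (∏ i : Fin N, ∏ j ∈ Finset.Ioi i, (x i - x j)) = 0
  · obtain ⟨i, -, hi⟩ := Finset.prod_eq_zero_iff.1 hvx
    obtain ⟨j, hj, hj'⟩ := Finset.prod_eq_zero_iff.1 hi
    exact absurd (hx (sub_eq_zero.1 hj')) (Finset.mem_Ioi.1 hj).ne
  · refine mul_right_cancel₀ hne ?_
    linear_combination (∏ i : Fin N, ∏ j ∈ Finset.Ioi i, (x i - x j)) * hsymm t v -
      (sekKernelMatrix t v x y I).det * h01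
end CauchyDet
end
end JackMeasures

namespace JackMeasures
open MvPolynomial
noncomputable section

/-! ### Power series in separated variables -/

section Axis

variable {N : ℕ} {R : Type*} [CommRing R]

/-- The power series `f(x_i)` in the variables `x_1, …, x_N`. -/
def axis (i : Fin N) : PowerSeries R →ₐ[R] MvPowerSeries (Fin N) R :=
  MvPowerSeries.rename (⟨fun _ => i, fun _ _ _ => rfl⟩ : Unit ↪ Fin N)

theorem coeff_axis_single (i : Fin N) (f : PowerSeries R) (m : ℕ) :
    MvPowerSeries.coeff (Finsupp.single i m) (axis i f) = PowerSeries.coeff m f := by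
  have := MvPowerSeries.coeff_embDomain_rename (⟨fun _ => i, fun _ _ _ => rfl⟩ : Unit ↪ Fin N) f
    (Finsupp.single () m)
  rwa [Finsupp.embDomain_single] at this

theorem coeff_axis_eq_zero (i : Fin N) (f : PowerSeries R) {μ : Fin N →₀ ℕ}
    (h : ∀ m, μ ≠ Finsupp.single i m) : MvPowerSeries.coeff μ (axis i f) = 0 := by
  refine MvPowerSeries.coeff_rename_eq_zero _ _ ?_
  rintro ⟨x, rfl⟩
  refine h (x ()) ?_
  rw [Finsupp.unique_single x, Finsupp.mapDomain_single]
  simp only [Finsupp.single_eq_same]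
  rfl

theorem axis_X (i : Fin N) : axis i (PowerSeries.X : PowerSeries R) = MvPowerSeries.X i :=
  MvPowerSeries.rename_X _ _

theorem axis_C (i : Fin N) (r : R) : axis i (PowerSeries.C r) = MvPowerSeries.C r :=
  MvPowerSeries.rename_C _ _

theorem coeff_axis_mul (i : Fin N) (f : PowerSeries R) (F : MvPowerSeries (Fin N) R)
    (μ : Fin N →₀ ℕ) : MvPowerSeries.coeff μ (axis i f * F) =
      ∑ a ∈ Finset.range (μ i + 1), PowerSeries.coeff a f *
        MvPowerSeries.coeff (μ - Finsupp.single i a) F := by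
  classical
  rw [MvPowerSeries.coeff_mul]
  symm
  refine Finset.sum_of_injOn (fun a => (Finsupp.single i a, μ - Finsupp.single i a)) ?_ ?_ ?_ ?_
  · intro a _ b _ hab
    exact Finsupp.single_injective i (Prod.mk.inj hab).1
  · intro a ha
    simp only [Finset.coe_range, Set.mem_Iio] at ha
    rw [Finset.mem_coe, Finset.HasAntidiagonal.mem_antidiagonal]
    exact add_tsub_cancel_of_le (by simpa using Nat.lt_succ_iff.1 ha)
  · rintro ⟨p, q⟩ hpq hn
    rw [Finset.HasAntidiagonal.mem_antidiagonal] at hpq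
    simp only at hpq
    rw [coeff_axis_eq_zero, zero_mul]
    rintro m rfl
    apply hn
    refine ⟨m, ?_, ?_⟩
    · simp only [Finset.coe_range, Set.mem_Iio, ← hpq, Finsupp.add_apply, Finsupp.single_eq_same]
      omega
    · simp only [Prod.mk.injEq, true_and, ← hpq]
      exact add_tsub_cancel_left _ _
  · intro a _
    rw [coeff_axis_single]

/-- The power series `G(x_1) ⋯ G(x_N)`. -/
def tensorPow (N : ℕ) (G : PowerSeries R) : MvPowerSeries (Fin N) R :=
  fun μ => ∏ i, PowerSeries.coeff (μ i) G

theorem coeff_tensorPow (G : PowerSeries R) (μ : Fin N →₀ ℕ) :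
    MvPowerSeries.coeff μ (tensorPow N G) = ∏ i, PowerSeries.coeff (μ i) G := rfl

theorem coeff_axis_mul_tensorPow (i : Fin N) (f G : PowerSeries R) (μ : Fin N →₀ ℕ) :
    MvPowerSeries.coeff μ (axis i f * tensorPow N G) =
      PowerSeries.coeff (μ i) (f * G) * ∏ k ∈ Finset.univ.erase i, PowerSeries.coeff (μ k) G := by
  rw [coeff_axis_mul, PowerSeries.coeff_mul, Finset.Nat.sum_antidiagonal_eq_sum_range_succ
    (fun a b => PowerSeries.coeff a f * PowerSeries.coeff b G), Finset.sum_mul]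
  refine Finset.sum_congr rfl fun a _ => ?_
  rw [coeff_tensorPow, ← Finset.mul_prod_erase _ _ (Finset.mem_univ i), mul_assoc]
  congr 2
  · simp
  · refine Finset.prod_congr rfl fun k hk => ?_
    simp [Finsupp.single_eq_of_ne (Finset.ne_of_mem_erase hk)]

theorem coeff_real_smul [Algebra ℝ R] {σ : Type*} (r : ℝ) (F : MvPowerSeries σ R) (μ : σ →₀ ℕ) :
    MvPowerSeries.coeff μ (r • F) = r • MvPowerSeries.coeff μ F := rfl

/-- The hypothesis says H G = T G', so multiplication by H(x_i) acts on G(x_1)⋯G(x_N) as x_i ∂/∂x_i.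
Factors belonging to distinct variables do not interfere and can be applied one at a time. -/
theorem coeff_prod_axis_mul_tensorPow [Algebra ℝ R] {G H : PowerSeries R}
    (hG : ∀ m, PowerSeries.coeff m (H * G) = (m : ℝ) • PowerSeries.coeff m G) (c : Fin N → ℝ)
    (s : Finset (Fin N)) (μ : Fin N →₀ ℕ) :
    MvPowerSeries.coeff μ ((∏ i ∈ s, (algebraMap ℝ _ (c i) + axis i H)) * tensorPow N G) =
      (∏ i ∈ s, ((μ i : ℝ) + c i)) • MvPowerSeries.coeff μ (tensorPow N G) := by
  classical
  induction s using Finset.induction_on generalizing μ with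
  | empty => simp
  | insert a s ha ih =>
    rw [Finset.prod_insert ha, Finset.prod_insert ha, mul_assoc, add_mul, map_add, coeff_axis_mul]
    have h1 : ∀ b ∈ Finset.range (μ a + 1), PowerSeries.coeff b H * MvPowerSeries.coeff
        (μ - Finsupp.single a b) ((∏ i ∈ s, (algebraMap ℝ _ (c i) + axis i H)) * tensorPow N G) =
        (∏ i ∈ s, ((μ i : ℝ) + c i)) • (PowerSeries.coeff b H *
          MvPowerSeries.coeff (μ - Finsupp.single a b) (tensorPow N G)) := by
      intro b _
      rw [ih, mul_smul_comm]
      congr 1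
      refine Finset.prod_congr rfl fun i hi => ?_
      have : i ≠ a := fun h => ha (h ▸ hi)
      simp [Finsupp.single_eq_of_ne this]
    rw [Finset.sum_congr rfl h1, ← Finset.smul_sum, ← coeff_axis_mul, coeff_axis_mul_tensorPow, hG,
      ← Algebra.smul_def, coeff_real_smul, ih, smul_mul_assoc,
      Finset.mul_prod_erase _ (fun k => PowerSeries.coeff (μ k) G) (Finset.mem_univ a),
      ← coeff_tensorPow, smul_smul, smul_smul, ← add_smul]
    congr 1
    ring

theorem prod_X_pow_permExp' (σ : Equiv.Perm (Fin N)) :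
    ∏ i, (MvPowerSeries.X i : MvPowerSeries (Fin N) R) ^ (N - 1 - (σ i : ℕ)) =
      MvPowerSeries.monomial (permExp σ) 1 := by
  have h : ∀ s : Finset (Fin N), ∏ i ∈ s, (MvPowerSeries.X i : MvPowerSeries (Fin N) R) ^
      (N - 1 - (σ i : ℕ)) = MvPowerSeries.monomial (∑ i ∈ s, Finsupp.single i (N - 1 - (σ i : ℕ))) 1 := by
    classical
    intro s
    induction s using Finset.induction_on with
    | empty => simp
    | insert a s ha ih =>
      rw [Finset.prod_insert ha, Finset.sum_insert ha, ih, MvPowerSeries.X_pow_eq,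
        MvPowerSeries.monomial_mul_monomial, one_mul]
  rw [h]
  congr 2
  ext j
  rw [Finsupp.finsetSum_apply, Finset.sum_eq_single j]
  · simp
  · intro b _ hb; simp [Finsupp.single_eq_of_ne hb.symm]
  · simp

theorem coeff_vandermonde_mul' [Algebra ℝ R] (F : MvPowerSeries (Fin N) R) (ρ : Fin N →₀ ℕ) :
    MvPowerSeries.coeff ρ ((∏ i : Fin N, ∏ j ∈ Finset.Ioi i,
      (MvPowerSeries.X i - MvPowerSeries.X j)) * F) =
      altSum (fun _ _ => 1) (fun μ => MvPowerSeries.coeff μ F) ρ := by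
  rw [← det_rev_vandermonde, ← Matrix.det_transpose, Matrix.det_apply, Finset.sum_mul, map_sum, altSum]
  refine Finset.sum_congr rfl fun σ _ => ?_
  simp only [Matrix.transpose_apply, Matrix.of_apply]
  rw [prod_X_pow_permExp', Units.smul_def, smul_mul_assoc, map_zsmul, MvPowerSeries.coeff_monomial_mul]
  simp

/-- On a series G(x_1)⋯G(x_N) Sekiguchi's operator becomes multiplication by a determinant over a
commutative ring. Both the kernel, with coefficients in y, and ∏ (1 - x_i)^(-a) have this form. -/
theorem coeff_det_mul_tensorPow [Algebra ℝ R] {G H : PowerSeries R}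
    (hG : ∀ m, PowerSeries.coeff m (H * G) = (m : ℝ) • PowerSeries.coeff m G) (θ u : ℝ)
    (ρ : Fin N →₀ ℕ) :
    MvPowerSeries.coeff ρ ((Matrix.of fun i j : Fin N => MvPowerSeries.X i ^ (N - 1 - (j : ℕ)) *
        (algebraMap ℝ (MvPowerSeries (Fin N) R) (((N : ℝ) - 1 - (j : ℕ)) * θ + u) + axis i H)).det *
          tensorPow N G) =
      altSum (sekFactor θ u N) (fun μ => MvPowerSeries.coeff μ (tensorPow N G)) ρ := by
  rw [← Matrix.det_transpose, Matrix.det_apply, Finset.sum_mul, map_sum, altSum]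
  refine Finset.sum_congr rfl fun σ _ => ?_
  simp only [Matrix.transpose_apply, Matrix.of_apply]
  rw [Finset.prod_mul_distrib, prod_X_pow_permExp', Units.smul_def, smul_mul_assoc, map_zsmul,
    mul_assoc, MvPowerSeries.coeff_monomial_mul]
  simp only [one_mul]
  congr 1
  refine if_congr Iff.rfl ?_ rfl
  exact coeff_prod_axis_mul_tensorPow hG (fun i => ((N : ℝ) - 1 - (σ i : ℕ)) * θ + u) Finset.univ _

end Axis

/-! ### The binomial series -/

/-- The coefficient `(a)_k / k!` of `T ^ k` in `(1 - T) ^ (-a)`. -/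
def binCoef (a : ℝ) (k : ℕ) : ℝ := (∏ i ∈ Finset.range k, (a + i)) / k.factorial

@[simp] theorem binCoef_zero (a : ℝ) : binCoef a 0 = 1 := by simp [binCoef]

theorem binCoef_succ (a : ℝ) (k : ℕ) : ((k : ℝ) + 1) * binCoef a (k + 1) = (a + k) * binCoef a k := by
  have h1 : (k.factorial : ℝ) ≠ 0 := by exact_mod_cast k.factorial_ne_zero
  have h2 : (k : ℝ) + 1 ≠ 0 := by positivity
  rw [binCoef, binCoef, Finset.prod_range_succ, Nat.factorial_succ]
  push_cast
  field_simp

section BinSeries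

variable {R : Type*} [CommRing R]

/-- The power series `(1 - s T) ^ (-a)`. -/
def binSeries [Algebra ℝ R] (a : ℝ) (s : R) : PowerSeries R := PowerSeries.mk fun k => binCoef a k • s ^ k

/-- The power series `(1 - s T)⁻¹`. -/
def geomSeries (s : R) : PowerSeries R := PowerSeries.mk fun k => s ^ k

theorem one_sub_mul_geomSeries (s : R) :
    (1 - PowerSeries.X * PowerSeries.C s) * geomSeries s = 1 := by
  ext m
  rw [sub_mul, one_mul, mul_assoc, map_sub]
  rcases m with _ | m
  · simp [geomSeries]
  · rw [PowerSeries.coeff_succ_X_mul, PowerSeries.coeff_C_mul]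
    simp [geomSeries, pow_succ', PowerSeries.coeff_one]

/-- The power series `a s T / (1 - s T)`. -/
def logDerivSeries [Algebra ℝ R] (a : ℝ) (s : R) : PowerSeries R :=
  algebraMap ℝ _ a * (PowerSeries.X * PowerSeries.C s * geomSeries s)

theorem coeff_logDerivSeries_mul_binSeries [Algebra ℝ R] (a : ℝ) (s : R) (m : ℕ) :
    PowerSeries.coeff m (logDerivSeries a s * binSeries a s) =
      (m : ℝ) • PowerSeries.coeff m (binSeries a s) := by
  -- Clearing the denominator 1 - sT leaves the two-term recursion `binCoef_succ`.
  have key : algebraMap ℝ (PowerSeries R) a * (PowerSeries.X * PowerSeries.C s) * binSeries a s =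
      (1 - PowerSeries.X * PowerSeries.C s) *
        PowerSeries.mk fun k => (k : ℝ) • (binCoef a k • s ^ k) := by
    ext m
    rw [sub_mul, one_mul, map_sub, mul_assoc, ← Algebra.smul_def, PowerSeries.coeff, coeff_real_smul, ← PowerSeries.coeff, mul_assoc,
      mul_assoc]
    rcases m with _ | m
    · rw [PowerSeries.coeff_zero_X_mul, PowerSeries.coeff_zero_X_mul]; simp
    · rw [PowerSeries.coeff_succ_X_mul, PowerSeries.coeff_C_mul, PowerSeries.coeff_succ_X_mul,
        PowerSeries.coeff_C_mul, binSeries, PowerSeries.coeff_mk, PowerSeries.coeff_mk,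
        PowerSeries.coeff_mk, mul_smul_comm, mul_smul_comm, mul_smul_comm, ← pow_succ', smul_smul,
        smul_smul, smul_smul, ← sub_smul]
      congr 1
      have := binCoef_succ a m
      push_cast
      linarith
  have h2 : logDerivSeries a s * binSeries a s =
      PowerSeries.mk fun k => (k : ℝ) • (binCoef a k • s ^ k) := by
    rw [logDerivSeries]
    linear_combination geomSeries s * key +
      (PowerSeries.mk fun k => (k : ℝ) • (binCoef a k • s ^ k)) * one_sub_mul_geomSeries s
  rw [h2]
  simp [binSeries]
end BinSeries
end
end JackMeasures

namespace JackMeasures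
open MvPolynomial
noncomputable section

/-! ### The reproducing kernel -/

section CoefDer

variable {σ S : Type*} [CommRing S] [Algebra ℝ S]

/-- A derivation applied to the coefficients of a power series. -/
def coefDer (σ : Type*) (d : Derivation ℝ S S) :
    Derivation ℝ (MvPowerSeries σ S) (MvPowerSeries σ S) :=
  Derivation.mk'
    { toFun := fun F μ => d (MvPowerSeries.coeff μ F)
      map_add' := fun F G => by ext μ; exact map_add d _ _
      map_smul' := fun r F => by ext μ; exact d.map_smul r _ }
    (fun F G => by
      classical
      ext μ
      change d (MvPowerSeries.coeff μ (F * G)) = MvPowerSeries.coeff μ (F * _ + G * _)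
      rw [map_add, mul_comm G, MvPowerSeries.coeff_mul, MvPowerSeries.coeff_mul,
        MvPowerSeries.coeff_mul, map_sum, ← Finset.sum_add_distrib]
      refine Finset.sum_congr rfl fun p _ => ?_
      rw [Derivation.leibniz, smul_eq_mul, smul_eq_mul, mul_comm (MvPowerSeries.coeff p.2 G)]
      rfl)

theorem coeff_coefDer (d : Derivation ℝ S S) (F : MvPowerSeries σ S) (μ : σ →₀ ℕ) :
    MvPowerSeries.coeff μ (coefDer σ d F) = d (MvPowerSeries.coeff μ F) := rfl

theorem coefDer_axis {N : ℕ} (d : Derivation ℝ S S) (i : Fin N) (f : PowerSeries S) :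
    coefDer (Fin N) d (axis i f) = axis i (coefDer Unit d f) := by
  ext μ
  rw [coeff_coefDer]
  by_cases h : ∃ m, μ = Finsupp.single i m
  · obtain ⟨m, rfl⟩ := h
    rw [coeff_axis_single, coeff_axis_single]
    rfl
  · push Not at h
    rw [coeff_axis_eq_zero i _ h, coeff_axis_eq_zero i _ h, map_zero]

theorem coefDer_logDerivSeries (d : Derivation ℝ S S) (a : ℝ) (s : S) (hs : d s = 0) :
    coefDer Unit d (logDerivSeries a s) = 0 := by
  have h1 : coefDer Unit d (PowerSeries.X : PowerSeries S) = 0 := by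
    ext m
    change d (PowerSeries.coeff m PowerSeries.X) = 0
    rw [PowerSeries.coeff_X]
    split_ifs <;> simp
  have h2 : coefDer Unit d (PowerSeries.C s : PowerSeries S) = 0 := by
    ext m
    change d (PowerSeries.coeff m (PowerSeries.C s)) = 0
    rw [PowerSeries.coeff_C]
    split_ifs <;> simp [hs]
  have h3 : coefDer Unit d (geomSeries s) = 0 := by
    ext m
    change d (PowerSeries.coeff m (geomSeries s)) = 0
    rw [geomSeries, PowerSeries.coeff_mk, Derivation.leibniz_pow, hs, smul_zero, smul_zero]
  rw [logDerivSeries, Derivation.leibniz, Derivation.map_algebraMap, smul_zero, add_zero,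
    Derivation.leibniz, h3, Derivation.leibniz, h1, h2]
  simp

theorem derivation_prod {ι : Type*} [DecidableEq ι] (d : Derivation ℝ S S) (s : Finset ι) (f : ι → S) :
    d (∏ i ∈ s, f i) = ∑ i ∈ s, d (f i) * ∏ k ∈ s.erase i, f k := by
  induction s using Finset.induction_on with
  | empty => simp
  | insert a s ha ih =>
    rw [Finset.prod_insert ha, Derivation.leibniz, ih, Finset.sum_insert ha, Finset.erase_insert ha,
      smul_eq_mul, smul_eq_mul, add_comm, mul_comm (∏ i ∈ s, f i), Finset.mul_sum]
    congr 1
    refine Finset.sum_congr rfl fun i hi => ?_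
    have : a ≠ i := fun h => ha (h ▸ hi)
    rw [Finset.erase_insert_of_ne this, Finset.prod_insert (fun h => ha (Finset.mem_of_mem_erase h))]
    ring

theorem coefDer_tensorPow {N : ℕ} (d : Derivation ℝ S S) {G Z : PowerSeries S}
    (h : coefDer Unit d G = Z * G) :
    coefDer (Fin N) d (tensorPow N G) = (∑ i, axis i Z) * tensorPow N G := by
  ext μ
  have h' : ∀ m, d (PowerSeries.coeff m G) = PowerSeries.coeff m (Z * G) := fun m => by rw [← h]; rfl
  rw [coeff_coefDer, coeff_tensorPow, derivation_prod, Finset.sum_mul, map_sum]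
  refine Finset.sum_congr rfl fun i _ => ?_
  rw [coeff_axis_mul_tensorPow, h']

theorem coeff_logDeriv_mul {G₁ H₁ G₂ H₂ : PowerSeries S}
    (h₁ : ∀ m, PowerSeries.coeff m (H₁ * G₁) = (m : ℝ) • PowerSeries.coeff m G₁)
    (h₂ : ∀ m, PowerSeries.coeff m (H₂ * G₂) = (m : ℝ) • PowerSeries.coeff m G₂) (m : ℕ) :
    PowerSeries.coeff m ((H₁ + H₂) * (G₁ * G₂)) = (m : ℝ) • PowerSeries.coeff m (G₁ * G₂) := by
  have : (H₁ + H₂) * (G₁ * G₂) = (H₁ * G₁) * G₂ + G₁ * (H₂ * G₂) := by ring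
  rw [this, map_add, PowerSeries.coeff_mul, PowerSeries.coeff_mul, PowerSeries.coeff_mul,
    ← Finset.sum_add_distrib, Finset.smul_sum]
  refine Finset.sum_congr rfl fun p hp => ?_
  rw [h₁, h₂, ← Finset.HasAntidiagonal.mem_antidiagonal.1 hp, smul_mul_assoc, mul_smul_comm,
    ← add_smul, Nat.cast_add]

end CoefDer

/-- The power series `∏_j (1 - y_j T) ^ (-θ)`. -/
def kernelSeries (θ : ℝ) (N : ℕ) : PowerSeries (MvPolynomial (Fin N) ℝ) :=
  ∏ j : Fin N, binSeries θ (X j)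

theorem coeff_logDeriv_kernelSeries (θ : ℝ) (N : ℕ) (m : ℕ) :
    PowerSeries.coeff m ((∑ j : Fin N, logDerivSeries θ (X j)) * kernelSeries θ N) =
      (m : ℝ) • PowerSeries.coeff m (kernelSeries θ N) := by
  have key : ∀ (s : Finset (Fin N)) (m : ℕ), PowerSeries.coeff m
      ((∑ j ∈ s, logDerivSeries θ (X j : MvPolynomial (Fin N) ℝ)) * ∏ j ∈ s, binSeries θ (X j)) =
      (m : ℝ) • PowerSeries.coeff m (∏ j ∈ s, binSeries θ (X j : MvPolynomial (Fin N) ℝ)) := by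
    classical
    intro s
    induction s using Finset.induction_on with
    | empty =>
      intro m
      rw [Finset.sum_empty, zero_mul, Finset.prod_empty, PowerSeries.coeff_one, map_zero]
      split_ifs with h <;> simp [h]
    | insert a s ha ih =>
      intro m
      rw [Finset.sum_insert ha, Finset.prod_insert ha]
      exact coeff_logDeriv_mul (coeff_logDerivSeries_mul_binSeries θ _) ih m
  exact key Finset.univ m

/-- The derivation `y_j ∂/∂y_j`. -/
def eulerDer {N : ℕ} (j : Fin N) :
    Derivation ℝ (MvPolynomial (Fin N) ℝ) (MvPolynomial (Fin N) ℝ) :=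
  (X j : MvPolynomial (Fin N) ℝ) • pderiv j

theorem eulerDer_apply {N : ℕ} (j : Fin N) (f : MvPolynomial (Fin N) ℝ) :
    eulerDer j f = X j * pderiv j f := rfl

theorem eulerDer_X_of_ne {N : ℕ} {j k : Fin N} (h : k ≠ j) : eulerDer j (X k) = 0 := by
  rw [eulerDer_apply, pderiv_X_of_ne h, mul_zero]

/-- The factor (1 - y_j T)^(-θ) depends only on the product y_j T, so y_j ∂/∂y_j acts on it as T
∂/∂T. The other factors do not contain y_j. -/
theorem coefDer_eulerDer_kernelSeries (θ : ℝ) (N : ℕ) (j : Fin N) :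
    coefDer Unit (eulerDer j) (kernelSeries θ N) = logDerivSeries θ (X j) * kernelSeries θ N := by
  classical
  have h1 : ∀ s : Finset (Fin N), j ∉ s → coefDer Unit (eulerDer j)
      (∏ k ∈ s, binSeries θ (X k) : PowerSeries (MvPolynomial (Fin N) ℝ)) = 0 := by
    intro s hs
    refine (derivation_prod _ _ _).trans (Finset.sum_eq_zero fun k hk => ?_)
    have h2 : coefDer Unit (eulerDer j) (binSeries θ (X k)) = 0 := by
      ext1 m
      change eulerDer j (PowerSeries.coeff m (binSeries θ (X k))) = 0
      have hne : k ≠ j := fun h => hs (h ▸ hk)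
      rw [binSeries, PowerSeries.coeff_mk, Derivation.map_smul, Derivation.leibniz_pow,
        eulerDer_X_of_ne hne, smul_zero, smul_zero, smul_zero]
    rw [h2, zero_mul]
  have h2 : coefDer Unit (eulerDer j) (binSeries θ (X j)) =
      logDerivSeries θ (X j) * binSeries θ (X j) := by
    ext1 m
    refine Eq.trans ?_ (coeff_logDerivSeries_mul_binSeries θ _ m).symm
    change eulerDer j (PowerSeries.coeff m (binSeries θ (X j))) = _
    rw [binSeries, PowerSeries.coeff_mk, Derivation.map_smul, Derivation.leibniz_pow, eulerDer_apply,
      pderiv_X_self, mul_one, smul_comm, Nat.cast_smul_eq_nsmul]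
    rcases m with _ | m
    · simp
    · rw [Nat.add_sub_cancel, smul_eq_mul, ← pow_succ]
  rw [kernelSeries, ← Finset.mul_prod_erase _ _ (Finset.mem_univ j), Derivation.leibniz,
    h1 _ (Finset.notMem_erase _ _), h2, smul_zero, zero_add, smul_eq_mul]
  ring

/-- The coefficient of `x ^ μ` in `∏_{i, j} (1 - x_i y_j) ^ (-θ)`. -/
def kernelCoeff (θ : ℝ) (n : ℕ) {N : ℕ} (μ : Fin N →₀ ℕ) : MvPolynomial (Fin n) ℝ :=
  ∏ i, PowerSeries.coeff (μ i) (kernelSeries θ n)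

/-- A linear map applied to the coefficients of a power series. -/
def coefMap {σ S : Type*} [CommRing S] [Algebra ℝ S] (L : Module.End ℝ S) :
    Module.End ℝ (MvPowerSeries σ S) where
  toFun := fun F μ => L (MvPowerSeries.coeff μ F)
  map_add' := fun F G => by ext μ; exact map_add L _ _
  map_smul' := fun r F => by ext μ; exact map_smul L r _

theorem coeff_list_prod_coefMap {ι σ S : Type*} [CommRing S] [Algebra ℝ S] (L : ι → Module.End ℝ S)
    (l : List ι) (F : MvPowerSeries σ S) (μ : σ →₀ ℕ) :
    MvPowerSeries.coeff μ ((l.map fun i => coefMap (L i)).prod F) =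
      (l.map L).prod (MvPowerSeries.coeff μ F) := by
  induction l with
  | nil => rfl
  | cons a l ih =>
    rw [List.map_cons, List.prod_cons, List.map_cons, List.prod_cons, Module.End.mul_apply,
      Module.End.mul_apply, ← ih]
    rfl

/-- The operators in y act on the coefficients of a power series in x. By `list_prod_apply` each y_j
∂/∂y_j may be replaced by its logarithmic derivative on the kernel, the sum over i of θ x_i y_j / (1
- x_i y_j). -/
theorem sekiguchiDet_kernelCoeff (θ u : ℝ) (N : ℕ) (μ : Fin N →₀ ℕ) :
    sekiguchiDet θ u N (kernelCoeff θ N μ) = MvPowerSeries.coeff μ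
      ((Matrix.of fun j k : Fin N => (MvPowerSeries.C (X j : MvPolynomial (Fin N) ℝ) :
          MvPowerSeries (Fin N) (MvPolynomial (Fin N) ℝ)) ^ (N - 1 - (k : ℕ)) *
        (algebraMap ℝ _ (((N : ℝ) - 1 - (k : ℕ)) * θ + u) +
          ∑ i : Fin N, axis i (logDerivSeries θ (X j)))).det * tensorPow N (kernelSeries θ N)) := by
  rw [sekiguchiDet_apply, ← Matrix.det_transpose, Matrix.det_apply, Finset.sum_mul, map_sum]
  refine Finset.sum_congr rfl fun σ _ => ?_
  simp only [Matrix.transpose_apply, Matrix.of_apply]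
  rw [Units.smul_def, smul_mul_assoc, map_zsmul, ← list_prod_finRange,
    ← list_prod_apply (fun j => coefMap (sekiguchiEntry θ u N j (σ j))) _ _ ?_ _
      (List.nodup_finRange N), coeff_list_prod_coefMap]
  · rfl
  intro j s hj
  have hop : ∀ F : MvPowerSeries (Fin N) (MvPolynomial (Fin N) ℝ),
      coefMap (sekiguchiEntry θ u N j (σ j)) F = MvPowerSeries.C (X j) ^ (N - 1 - (σ j : ℕ)) *
        (coefDer (Fin N) (eulerDer j) F + (((N : ℝ) - 1 - (σ j : ℕ)) * θ + u) • F) := by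
    intro F
    ext1 ν
    rw [← map_pow, MvPowerSeries.coeff_C_mul]
    rfl
  have hz : coefDer (Fin N) (eulerDer j) (s.map fun i => (MvPowerSeries.C (X i : MvPolynomial (Fin N) ℝ) :
          MvPowerSeries (Fin N) (MvPolynomial (Fin N) ℝ)) ^ (N - 1 - (σ i : ℕ)) *
        (algebraMap ℝ _ (((N : ℝ) - 1 - (σ i : ℕ)) * θ + u) +
          ∑ k : Fin N, axis k (logDerivSeries θ (X i)))).prod = 0 := by
    induction s with
    | nil => simp
    | cons a s ih =>
      rw [List.mem_cons, not_or] at hj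
      have h1 : coefDer (Fin N) (eulerDer j) (MvPowerSeries.C (X a : MvPolynomial (Fin N) ℝ)) = 0 := by
        rw [← axis_C a, coefDer_axis]
        have : coefDer Unit (eulerDer j) (PowerSeries.C (X a : MvPolynomial (Fin N) ℝ)) = 0 := by
          ext1 m
          change eulerDer j (PowerSeries.coeff m (PowerSeries.C (X a))) = 0
          rw [PowerSeries.coeff_C]
          split_ifs <;> simp [eulerDer_X_of_ne (Ne.symm hj.1)]
        rw [this, map_zero]
      rw [List.map_cons, List.prod_cons, Derivation.leibniz, ih hj.2, smul_zero, zero_add,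
        Derivation.leibniz, Derivation.leibniz_pow, h1, map_add, Derivation.map_algebraMap, map_sum,
        Finset.sum_eq_zero fun i _ => by
          rw [coefDer_axis, coefDer_logDerivSeries _ _ _ (eulerDer_X_of_ne (Ne.symm hj.1)), map_zero]]
      simp
  rw [hop, Derivation.leibniz, hz, smul_zero, add_zero, smul_eq_mul,
    coefDer_tensorPow _ (coefDer_eulerDer_kernelSeries θ N j), Algebra.smul_def]
  ring

theorem axis_algebraMap {N : ℕ} {S : Type*} [CommRing S] [Algebra ℝ S] (i : Fin N) (r : ℝ) :
    axis i (algebraMap ℝ (PowerSeries S) r) = algebraMap ℝ (MvPowerSeries (Fin N) S) r := by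
  rw [MvPowerSeries.algebraMap_apply, MvPowerSeries.algebraMap_apply]
  exact axis_C i (algebraMap ℝ S r)

theorem axis_logDerivSeries {N : ℕ} {S : Type*} [CommRing S] [Algebra ℝ S] (i : Fin N) (θ : ℝ) (s : S) :
    axis i (logDerivSeries θ s) = algebraMap ℝ (MvPowerSeries (Fin N) S) θ *
      (MvPowerSeries.X i * MvPowerSeries.C s * axis i (geomSeries s)) := by
  rw [logDerivSeries, map_mul, map_mul, map_mul, axis_X, axis_C, axis_algebraMap]

/-- This is `det_sekKernelMatrix_symm` with t = θ, v = u and with the geometric series as the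
inverses of 1 - x_i s_j. -/
theorem det_logDeriv_symm {N : ℕ} {S : Type*} [CommRing S] [IsDomain S] [Algebra ℝ S] (s : Fin N → S)
    (θ u : ℝ) :
    MvPowerSeries.C (∏ i : Fin N, ∏ j ∈ Finset.Ioi i, (s i - s j)) *
      (Matrix.of fun i j : Fin N => MvPowerSeries.X i ^ (N - 1 - (j : ℕ)) *
        (algebraMap ℝ (MvPowerSeries (Fin N) S) (((N : ℝ) - 1 - (j : ℕ)) * θ + u) +
          axis i (∑ j : Fin N, logDerivSeries θ (s j)))).det =
    (∏ i : Fin N, ∏ j ∈ Finset.Ioi i, (MvPowerSeries.X i - MvPowerSeries.X j)) *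
      (Matrix.of fun j k : Fin N => (MvPowerSeries.C (s j) : MvPowerSeries (Fin N) S) ^
        (N - 1 - (k : ℕ)) * (algebraMap ℝ _ (((N : ℝ) - 1 - (k : ℕ)) * θ + u) +
          ∑ i : Fin N, axis i (logDerivSeries θ (s j)))).det := by
  have : IsDomain (MvPowerSeries (Fin N) S) := NoZeroDivisors.to_isDomain _
  have hI : ∀ i j : Fin N, (1 - (MvPowerSeries.X i : MvPowerSeries (Fin N) S) * MvPowerSeries.C (s j)) * axis i (geomSeries (s j)) = 1 := by
    intro i j
    have := congrArg (axis i) (one_sub_mul_geomSeries (s j))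
    rwa [map_mul, map_sub, map_mul, map_one, axis_X, axis_C] at this
  have hx : Function.Injective fun i : Fin N => (MvPowerSeries.X i : MvPowerSeries (Fin N) S) :=
    fun i j hij => by
    classical
    have := congrArg (MvPowerSeries.coeff (Finsupp.single i 1)) hij
    simp only [MvPowerSeries.coeff_X, if_true] at this
    by_contra hne
    rw [if_neg] at this
    · exact one_ne_zero this
    · intro h
      exact hne (Finsupp.single_left_injective one_ne_zero h)
  have key := det_sekKernelMatrix_symm hI hx (algebraMap ℝ _ θ) (algebraMap ℝ _ u)
  have hc : ∀ k : Fin N, algebraMap ℝ (MvPowerSeries (Fin N) S) (((N : ℝ) - 1 - (k : ℕ)) * θ + u) =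
      ((N - 1 - (k : ℕ) : ℕ) : MvPowerSeries (Fin N) S) * algebraMap ℝ _ θ + algebraMap ℝ _ u := by
    intro k
    rw [← natCast_rev, map_add, map_mul, map_natCast]
  simp only [map_prod, map_sub]
  simp only [sekKernelMatrix] at key
  have h1 : (Matrix.of fun i j : Fin N => (MvPowerSeries.X i : MvPowerSeries (Fin N) S) ^ (N - 1 - (j : ℕ)) *
        (algebraMap ℝ (MvPowerSeries (Fin N) S) (((N : ℝ) - 1 - (j : ℕ)) * θ + u) +
          axis i (∑ j : Fin N, logDerivSeries θ (s j)))) = _ :=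
    congrArg Matrix.of (funext fun i => funext fun k => by
      rw [map_sum, Finset.sum_congr rfl fun j _ => axis_logDerivSeries i θ (s j), ← Finset.mul_sum, hc])
  have h2 : (Matrix.of fun j k : Fin N => (MvPowerSeries.C (s j) : MvPowerSeries (Fin N) S) ^
        (N - 1 - (k : ℕ)) * (algebraMap ℝ _ (((N : ℝ) - 1 - (k : ℕ)) * θ + u) +
          ∑ i : Fin N, axis i (logDerivSeries θ (s j)))) = _ :=
    congrArg Matrix.of (funext fun j => funext fun k => by
      rw [Finset.sum_congr rfl fun i _ => axis_logDerivSeries i θ (s j), ← Finset.mul_sum, hc,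
        Finset.sum_congr rfl fun i _ => by rw [mul_comm (MvPowerSeries.X i)]])
  rw [h1, h2]
  exact key

/-- The determinant symmetry, multiplied by Π and read off at x^ρ: after division by the
Vandermondes, Sekiguchi's operators in x and in y agree on Π. This is what makes the Jack
coefficients of Π in y eigenfunctions in x. -/
theorem vandermonde_mul_altSum_kernelCoeff (θ u : ℝ) (N : ℕ) (ρ : Fin N →₀ ℕ) :
    vandermonde N * altSum (sekFactor θ u N) (kernelCoeff θ N) ρ =
      altSum (fun _ _ => 1) (fun μ => sekiguchiDet θ u N (kernelCoeff θ N μ)) ρ := by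
  have key := det_logDeriv_symm (fun j : Fin N => (X j : MvPolynomial (Fin N) ℝ)) θ u
  have h := congrArg (fun F => MvPowerSeries.coeff ρ (F * tensorPow N (kernelSeries θ N))) key
  simp only [mul_assoc] at h
  rw [MvPowerSeries.coeff_C_mul, coeff_det_mul_tensorPow (coeff_logDeriv_kernelSeries θ N),
    coeff_vandermonde_mul'] at h
  simp only [← sekiguchiDet_kernelCoeff] at h
  exact h
end
end JackMeasures

namespace JackMeasures
open MvPolynomial
noncomputable section

/-! ### Expansion of `∏ (1 - x_i T) ^ (-a)` -/

section

variable {R S : Type*} [CommRing R] [CommRing S] [Algebra ℝ R] [Algebra ℝ S]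

theorem map_binSeries (f : R →ₐ[ℝ] S) (a : ℝ) (s : R) :
    PowerSeries.map (f : R →+* S) (binSeries a s) = binSeries a (f s) := by
  ext m
  rw [PowerSeries.coeff_map, binSeries, binSeries, PowerSeries.coeff_mk, PowerSeries.coeff_mk]
  exact (map_smul f _ _).trans (by rw [map_pow])

theorem map_kernelSeries (a : ℝ) {n : ℕ} (f : MvPolynomial (Fin n) ℝ →ₐ[ℝ] S) :
    PowerSeries.map (f : MvPolynomial (Fin n) ℝ →+* S) (kernelSeries a n) =
      ∏ j, binSeries a (f (X j)) := by
  rw [kernelSeries, map_prod]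
  exact Finset.prod_congr rfl fun j _ => map_binSeries f a _

theorem binSeries_zero (a : ℝ) : binSeries a (0 : R) = 1 := by
  ext m
  rw [binSeries, PowerSeries.coeff_mk, PowerSeries.coeff_one]
  rcases m with _ | m <;> simp

/-- With F(0) = 1, the equation T F' = (a T / (1 - T)) F is a first-order recursion for the
coefficients. It replaces any manipulation of binomial sums in the product formula below. -/
theorem eq_binSeries {a : ℝ} {F : PowerSeries ℝ} (h0 : PowerSeries.coeff 0 F = 1)
    (h : ∀ m, PowerSeries.coeff m (logDerivSeries a 1 * F) = (m : ℝ) • PowerSeries.coeff m F) :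
    F = binSeries a 1 := by
  have h1 : logDerivSeries a 1 * F = PowerSeries.mk fun m => (m : ℝ) * PowerSeries.coeff m F := by
    ext m; rw [h, PowerSeries.coeff_mk, smul_eq_mul]
  have h2 : algebraMap ℝ (PowerSeries ℝ) a * (PowerSeries.X * F) = (1 - PowerSeries.X) *
      PowerSeries.mk fun m => (m : ℝ) * PowerSeries.coeff m F := by
    have h3 := one_sub_mul_geomSeries (1 : ℝ)
    rw [map_one, mul_one] at h3
    rw [← h1, logDerivSeries, map_one]
    linear_combination (-algebraMap ℝ (PowerSeries ℝ) a * PowerSeries.X * F) * h3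
  ext m
  rw [binSeries, PowerSeries.coeff_mk, one_pow, smul_eq_mul, mul_one]
  induction m with
  | zero => rw [h0, binCoef_zero]
  | succ m ih =>
    have h4 := congrArg (PowerSeries.coeff (m + 1)) h2
    rw [sub_mul, one_mul, map_sub, PowerSeries.coeff_succ_X_mul, PowerSeries.coeff_mk,
      PowerSeries.coeff_mk, ← Algebra.smul_def, PowerSeries.coeff_smul, PowerSeries.coeff_succ_X_mul,
      ih, smul_eq_mul] at h4
    have h5 := binCoef_succ a m
    have h6 : (m : ℝ) + 1 ≠ 0 := by positivity
    push_cast at h4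
    apply mul_left_cancel₀ h6
    linarith

theorem binSeries_one_mul (a b : ℝ) :
    binSeries a (1 : ℝ) * binSeries b 1 = binSeries (a + b) 1 := by
  apply eq_binSeries
  · simp [binSeries]
  · have : logDerivSeries (a + b) (1 : ℝ) = logDerivSeries a 1 + logDerivSeries b 1 := by
      rw [logDerivSeries, logDerivSeries, logDerivSeries, map_add, add_mul]
    rw [this]
    exact coeff_logDeriv_mul (coeff_logDerivSeries_mul_binSeries a _)
      (coeff_logDerivSeries_mul_binSeries b _)

theorem binSeries_one_pow (a : ℝ) (n : ℕ) : binSeries a (1 : ℝ) ^ n = binSeries (n * a) 1 := by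
  induction n with
  | zero =>
    rw [pow_zero]
    ext m
    rw [binSeries, PowerSeries.coeff_mk, PowerSeries.coeff_one]
    rcases m with _ | m
    · simp
    · simp [binCoef, Finset.prod_range_succ']
  | succ n ih => rw [pow_succ, ih, binSeries_one_mul]; push_cast; ring_nf

theorem geomSeries_mul_binSeries (a : ℝ) (s : R) :
    geomSeries s * binSeries a s = binSeries (a + 1) s := by
  have h : binSeries a s = (1 - PowerSeries.X * PowerSeries.C s) * binSeries (a + 1) s := by
    ext m
    rw [sub_mul, one_mul, mul_assoc, map_sub]
    rcases m with _ | m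
    · rw [PowerSeries.coeff_zero_X_mul]; simp [binSeries]
    · rw [PowerSeries.coeff_succ_X_mul, PowerSeries.coeff_C_mul]
      simp only [binSeries, PowerSeries.coeff_mk]
      rw [mul_smul_comm, ← pow_succ', ← sub_smul]
      congr 1
      have key : ∀ m, (a + m) * binCoef a m = a * binCoef (a + 1) m := by
        intro m
        have hp : (∏ i ∈ Finset.range m, (a + (i : ℕ))) * (a + m) =
            a * ∏ i ∈ Finset.range m, (a + 1 + (i : ℕ)) := by
          rw [← Finset.prod_range_succ, Finset.prod_range_succ', mul_comm]
          push_cast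
          rw [add_zero]
          congr 1
          exact Finset.prod_congr rfl fun i _ => by ring
        rw [binCoef, binCoef, mul_div_assoc', mul_comm, hp, mul_div_assoc]
      have h1 := binCoef_succ a m
      have h2 := binCoef_succ (a + 1) m
      have h3 := key m
      have h6 : (m : ℝ) + 1 ≠ 0 := by positivity
      apply mul_left_cancel₀ h6
      linarith
  rw [h, ← mul_assoc, mul_comm (geomSeries s), one_sub_mul_geomSeries, one_mul]

end

/-- The component of degree `m` of `∏_i (1 - x_i) ^ (-a)`. -/
def binPoly (a : ℝ) (n m : ℕ) : MvPolynomial (Fin n) ℝ := PowerSeries.coeff m (kernelSeries a n)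

theorem kernelCoeff_eq (θ : ℝ) (n : ℕ) {N : ℕ} (μ : Fin N →₀ ℕ) :
    kernelCoeff θ n μ = ∏ i, binPoly θ n (μ i) := rfl

theorem map_binPoly {S : Type*} [CommRing S] [Algebra ℝ S] (a : ℝ) {n : ℕ} (m : ℕ)
    (f : MvPolynomial (Fin n) ℝ →ₐ[ℝ] S) :
    f (binPoly a n m) = PowerSeries.coeff m (∏ j, binSeries a (f (X j))) := by
  rw [← map_kernelSeries, PowerSeries.coeff_map]
  rfl

theorem coeff_binPoly (a : ℝ) (n m : ℕ) (μ : Fin n →₀ ℕ) :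
    coeff μ (binPoly a n m) = if μ.degree = m then ∏ i, binCoef a (μ i) else 0 := by
  classical
  have h : ∀ l : Fin n →₀ ℕ, ∏ i, PowerSeries.coeff (l i) (binSeries a (X i : MvPolynomial (Fin n) ℝ)) =
      monomial l (∏ i, binCoef a (l i)) := by
    intro l
    rw [monomial_eq, Finsupp.prod_fintype _ _ (fun _ => pow_zero _), map_prod, ← Finset.prod_mul_distrib]
    refine Finset.prod_congr rfl fun i _ => ?_
    rw [binSeries, PowerSeries.coeff_mk, smul_eq_C_mul]
  rw [binPoly, kernelSeries, PowerSeries.coeff_prod, coeff_sum, Finset.sum_congr rfl fun l _ => by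
    rw [h, coeff_monomial], Finset.sum_ite_eq']
  refine if_congr ?_ rfl rfl
  rw [Finset.mem_finsuppAntidiag, Finsupp.degree_eq_sum]
  simp

theorem binPoly_isHomogeneous (a : ℝ) (n m : ℕ) : (binPoly a n m).IsHomogeneous m := by
  intro μ hμ
  rw [coeff_binPoly] at hμ
  refine (DFunLike.congr_fun Finsupp.degree_eq_weight_one μ).symm.trans ?_
  exact (ite_ne_right_iff.1 hμ).1

theorem binPoly_isSymmetric (a : ℝ) (n m : ℕ) : (binPoly a n m).IsSymmetric := by
  intro σ
  rw [map_binPoly, binPoly, kernelSeries]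
  simp only [rename_X]
  rw [Equiv.prod_comp σ fun j => binSeries a (X j : MvPolynomial (Fin n) ℝ)]

theorem restrictLast_binPoly (a : ℝ) (n m : ℕ) :
    restrictLast n (binPoly a (n + 1) m) = binPoly a n m := by
  rw [map_binPoly, binPoly, kernelSeries, Fin.prod_univ_castSucc, restrictLast_X_last, binSeries_zero,
    mul_one]
  simp only [restrictLast_X_castSucc]

theorem aeval_one_binPoly (a : ℝ) (n m : ℕ) :
    aeval (fun _ => (1 : ℝ)) (binPoly a n m) = binCoef (n * a) m := by
  rw [map_binPoly]
  simp only [aeval_X]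
  rw [Finset.prod_const, Finset.card_univ, Fintype.card_fin, binSeries_one_pow, binSeries,
    PowerSeries.coeff_mk, one_pow, smul_eq_mul, mul_one]

theorem kernelCoeff_isSymmetric (θ : ℝ) (n : ℕ) {N : ℕ} (μ : Fin N →₀ ℕ) :
    (kernelCoeff θ n μ).IsSymmetric := by
  intro σ
  rw [kernelCoeff_eq, map_prod]
  exact Finset.prod_congr rfl fun i _ => binPoly_isSymmetric θ n _ σ

theorem kernelCoeff_isHomogeneous (θ : ℝ) (n : ℕ) {N : ℕ} (μ : Fin N →₀ ℕ) :
    (kernelCoeff θ n μ).IsHomogeneous μ.degree := by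
  rw [Finsupp.degree_eq_sum]
  exact IsHomogeneous.prod _ _ _ fun i _ => binPoly_isHomogeneous θ n _

theorem restrictLast_kernelCoeff (θ : ℝ) (n : ℕ) {N : ℕ} (μ : Fin N →₀ ℕ) :
    restrictLast n (kernelCoeff θ (n + 1) μ) = kernelCoeff θ n μ := by
  rw [kernelCoeff_eq, map_prod]
  exact Finset.prod_congr rfl fun i _ => restrictLast_binPoly θ n _

/-- Since the kernel at y = 1^n is ∏ (1 - x_i)^(-nθ), this links the Cauchy expansion with the
binomial one. -/
theorem aeval_one_kernelCoeff (θ : ℝ) (n : ℕ) {N : ℕ} (μ : Fin N →₀ ℕ) :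
    aeval (fun _ => (1 : ℝ)) (kernelCoeff θ n μ) = ∏ i, binCoef (n * θ) (μ i) := by
  rw [kernelCoeff_eq, map_prod]
  exact Finset.prod_congr rfl fun i _ => aeval_one_binPoly θ n _

theorem kernelCoeff_mapDomain (θ : ℝ) (n : ℕ) {N : ℕ} (τ : Equiv.Perm (Fin N)) (μ : Fin N →₀ ℕ) :
    kernelCoeff θ n (μ.mapDomain τ) = kernelCoeff θ n μ := by
  rw [kernelCoeff_eq, kernelCoeff_eq, ← Equiv.prod_comp τ]
  exact Finset.prod_congr rfl fun i _ => by rw [Finsupp.mapDomain_apply τ.injective]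

theorem kernelCoeff_snocZero (θ : ℝ) (n : ℕ) {N : ℕ} (μ : Fin N →₀ ℕ) :
    kernelCoeff θ n (snocZero μ) = kernelCoeff θ n μ := by
  have h0 : binPoly θ n 0 = 1 := by
    ext μ
    rw [coeff_binPoly, coeff_one]
    by_cases h : μ = 0
    · subst h; simp
    · rw [if_neg (mt (Finsupp.degree_eq_zero_iff μ).1 h), if_neg (Ne.symm h)]
  rw [kernelCoeff_eq, kernelCoeff_eq, Fin.prod_univ_castSucc, snocZero_last, h0, mul_one]
  exact Finset.prod_congr rfl fun i _ => by rw [snocZero_castSucc]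

/-! ### Sekiguchi's operator on `∏ (1 - x_i) ^ (-a)` -/

section

variable {N : ℕ} {R : Type*} [CommRing R]

theorem prod_axis_mul_tensorPow (f G : PowerSeries R) :
    (∏ i : Fin N, axis i f) * tensorPow N G = tensorPow N (f * G) := by
  classical
  have key : ∀ (s : Finset (Fin N)) (μ : Fin N →₀ ℕ),
      MvPowerSeries.coeff μ ((∏ i ∈ s, axis i f) * tensorPow N G) =
      (∏ i ∈ s, PowerSeries.coeff (μ i) (f * G)) * ∏ i ∈ sᶜ, PowerSeries.coeff (μ i) G := by
    intro s
    induction s using Finset.induction_on with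
    | empty => intro μ; simp [coeff_tensorPow]
    | insert a s ha ih =>
      intro μ
      have ha' : a ∈ sᶜ := Finset.mem_compl.2 ha
      rw [Finset.prod_insert ha, Finset.prod_insert ha, mul_assoc, coeff_axis_mul,
        PowerSeries.coeff_mul, Finset.Nat.sum_antidiagonal_eq_sum_range_succ
        (fun a b => PowerSeries.coeff a f * PowerSeries.coeff b G), Finset.sum_mul, Finset.sum_mul,
        Finset.compl_insert]
      refine Finset.sum_congr rfl fun b _ => ?_
      rw [ih, ← Finset.mul_prod_erase _ _ ha']
      have h1 : ∏ i ∈ s, PowerSeries.coeff ((μ - Finsupp.single a b) i) (f * G) =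
          ∏ i ∈ s, PowerSeries.coeff (μ i) (f * G) := Finset.prod_congr rfl fun i hi => by
        have : i ≠ a := fun h => ha (h ▸ hi)
        simp [Finsupp.single_eq_of_ne this]
      have h2 : ∏ i ∈ sᶜ.erase a, PowerSeries.coeff ((μ - Finsupp.single a b) i) G =
          ∏ i ∈ sᶜ.erase a, PowerSeries.coeff (μ i) G := Finset.prod_congr rfl fun i hi => by
        simp [Finsupp.single_eq_of_ne (Finset.ne_of_mem_erase hi)]
      rw [h1, h2]
      simp only [Finsupp.tsub_apply, Finsupp.single_eq_same]
      ring
  ext μ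
  rw [key, coeff_tensorPow, Finset.compl_univ, Finset.prod_empty, mul_one]

/-- The determinant of `x_i ^ k (k t + a x_i / (1 - x_i))`. -/
theorem det_binomial_column {N : ℕ} (x I : Fin N → R) (hI : ∀ i, (1 - x i) * I i = 1) (t a : R) :
    (Matrix.of fun i j : Fin N => x i ^ (N - 1 - (j : ℕ)) *
      ((N - 1 - (j : ℕ) : ℕ) * t + a * (x i * I i))).det =
    (∏ j : Fin N, (a - (j : ℕ) * t)) * ((∏ i : Fin N, ∏ j ∈ Finset.Ioi i, (x i - x j)) *
      ((∏ i, x i) * ∏ i, I i)) := by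
  let U : Matrix (Fin N) (Fin N) R := Matrix.of fun l j =>
    if l = j then a - (N - 1 - (j : ℕ) : ℕ) * t else
      if (l : ℕ) = j + 1 then (N - 1 - (j : ℕ) : ℕ) * t else 0
  let V : Matrix (Fin N) (Fin N) R := Matrix.of fun i j => x i ^ (N - 1 - (j : ℕ))
  have hU : U.det = ∏ j : Fin N, (a - (j : ℕ) * t) := by
    rw [Matrix.det_of_isLowerTriangular]
    · rw [← Equiv.prod_comp Fin.revPerm]
      refine Finset.prod_congr rfl fun j _ => ?_
      simp only [U, Matrix.of_apply, if_true, Fin.revPerm_apply, Fin.val_rev]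
      have := j.2
      congr 3
      omega
    · intro i j hij
      have hij' : (i : ℕ) < j := hij
      simp only [U, Matrix.of_apply]
      rw [if_neg (fun h => by rw [h] at hij'; exact lt_irrefl _ hij'), if_neg (by omega)]
  -- For k = N - 1 - j: x^k (k t + a x/(1-x)) = x/(1-x) · ((a - k t) x^k + k t x^(k-1)). Each column
  -- combines two neighbouring powers, so U is bidiagonal and its determinant is the product of its
  -- diagonal.
  have hM : (Matrix.of fun i j : Fin N => x i ^ (N - 1 - (j : ℕ)) *
      ((N - 1 - (j : ℕ) : ℕ) * t + a * (x i * I i))) =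
      Matrix.of fun i j => (x i * I i) * (V * U) i j := by
    ext i j
    rw [Matrix.of_apply, Matrix.of_apply, Matrix.mul_apply]
    have h2 : ∑ l, V i l * U l j = x i ^ (N - 1 - (j : ℕ)) * (a - (N - 1 - (j : ℕ) : ℕ) * t) +
        if h : (j : ℕ) + 1 < N then x i ^ (N - 1 - ((j : ℕ) + 1)) * ((N - 1 - (j : ℕ) : ℕ) * t) else 0 := by
      by_cases h : (j : ℕ) + 1 < N
      · rw [dif_pos h]
        have hne : j ≠ ⟨j + 1, h⟩ := fun hh => by have := congrArg Fin.val hh; simp at this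
        rw [Finset.sum_eq_add j ⟨j + 1, h⟩ hne]
        · simp [V, U, hne.symm]
        · rintro l - ⟨h3, h4⟩
          simp only [U, Matrix.of_apply]
          rw [if_neg h3, if_neg (fun h5 => h4 (Fin.ext h5)), mul_zero]
        · simp
        · simp
      · rw [dif_neg h, Finset.sum_eq_single j]
        · simp [V, U]
        · intro l _ h3
          simp only [U, Matrix.of_apply]
          have := l.2
          rw [if_neg h3, if_neg (by omega), mul_zero]
        · simp
    rw [h2]
    by_cases h : (j : ℕ) + 1 < N
    · rw [dif_pos h]
      obtain ⟨k, hk⟩ : ∃ k, N - 1 - (j : ℕ) = k + 1 := ⟨N - 1 - j - 1, by omega⟩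
      have hk' : N - 1 - ((j : ℕ) + 1) = k := by omega
      rw [hk, hk']
      linear_combination (-((k + 1 : ℕ) : R) * t * x i ^ (k + 1)) * hI i
    · rw [dif_neg h]
      have hk : N - 1 - (j : ℕ) = 0 := by omega
      rw [hk]
      push_cast
      ring
  rw [hM, Matrix.det_mul_column, Matrix.det_mul, hU, det_rev_vandermonde, Finset.prod_mul_distrib]
  ring

end

theorem altSum_binCoef (θ a : ℝ) (N : ℕ) (ρ : Fin N →₀ ℕ) :
    altSum (sekFactor θ 0 N) (fun μ => ∏ i, binCoef a (μ i)) ρ =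
      (∏ j : Fin N, (a - (j : ℕ) * θ)) * altSum (fun _ _ => 1)
        (fun μ => if onesExp N ≤ μ then ∏ i, binCoef (a + 1) (μ i - 1) else 0) ρ := by
  have hb : ∀ (a : ℝ) (μ : Fin N →₀ ℕ), ∏ i, binCoef a (μ i) =
      MvPowerSeries.coeff μ (tensorPow N (binSeries a (1 : ℝ))) := by
    intro a μ
    rw [coeff_tensorPow]
    exact Finset.prod_congr rfl fun i _ => by simp [binSeries]
  have hI : ∀ i : Fin N, (1 - (MvPowerSeries.X i : MvPowerSeries (Fin N) ℝ)) *
      axis i (geomSeries (1 : ℝ)) = 1 := by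
    intro i
    have := congrArg (axis i) (one_sub_mul_geomSeries (1 : ℝ))
    rwa [map_mul, map_sub, map_mul, map_one, axis_X, axis_C, map_one, mul_one] at this
  have key := det_binomial_column _ _ hI (algebraMap ℝ (MvPowerSeries (Fin N) ℝ) θ)
    (algebraMap ℝ (MvPowerSeries (Fin N) ℝ) a)
  have h1 := coeff_det_mul_tensorPow (coeff_logDerivSeries_mul_binSeries a (1 : ℝ)) θ 0 ρ
  have h2 : (Matrix.of fun i j : Fin N => (MvPowerSeries.X i : MvPowerSeries (Fin N) ℝ) ^ (N - 1 - (j : ℕ)) *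
        (algebraMap ℝ (MvPowerSeries (Fin N) ℝ) (((N : ℝ) - 1 - (j : ℕ)) * θ + 0) +
          axis i (logDerivSeries a (1 : ℝ)))) = _ :=
    congrArg Matrix.of (funext fun i => funext fun j => by
      rw [axis_logDerivSeries, map_one, mul_one, add_zero, map_mul, ← natCast_rev, map_natCast])
  rw [h2, key] at h1
  simp only [hb]
  rw [← h1, mul_assoc, mul_assoc, mul_assoc (∏ i : Fin N, MvPowerSeries.X i), prod_axis_mul_tensorPow,
    geomSeries_mul_binSeries]
  have h3 : ∏ j : Fin N, (algebraMap ℝ (MvPowerSeries (Fin N) ℝ) a - (j : ℕ) * algebraMap ℝ _ θ) =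
      algebraMap ℝ _ (∏ j : Fin N, (a - (j : ℕ) * θ)) := by
    rw [map_prod]
    exact Finset.prod_congr rfl fun j _ => by rw [map_sub, map_mul, map_natCast]
  rw [h3, ← Algebra.smul_def, coeff_real_smul, smul_eq_mul, coeff_vandermonde_mul']
  congr 2
  funext μ
  have h4 : ∏ i : Fin N, (MvPowerSeries.X i : MvPowerSeries (Fin N) ℝ) =
      MvPowerSeries.monomial (onesExp N) 1 := by
    have := congrArg (fun p : MvPolynomial (Fin N) ℝ => (p : MvPowerSeries (Fin N) ℝ)) (prod_X_eq N)
    simp only [MvPolynomial.coe_monomial] at this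
    rw [← this]
    have h5 := map_prod (MvPolynomial.coeToMvPowerSeries.ringHom (σ := Fin N) (R := ℝ)) X Finset.univ
    exact (Finset.prod_congr rfl fun i _ => (MvPolynomial.coe_X i).symm).trans h5.symm
  rw [h4, MvPowerSeries.coeff_monomial_mul, one_mul]
  refine if_congr Iff.rfl ?_ rfl
  rw [← hb]
  rfl

theorem degree_permExp {N : ℕ} (σ : Equiv.Perm (Fin N)) :
    (permExp σ).degree = (permExp (1 : Equiv.Perm (Fin N))).degree := by
  rw [Finsupp.degree_eq_sum, Finsupp.degree_eq_sum]
  exact Equiv.sum_comp σ fun i : Fin N => N - 1 - (i : ℕ)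

/-- All the vectors `permExp σ` have the same degree, so the alternating sum respects homogeneous
components. -/
theorem altSum_degree {N : ℕ} (φ : Fin N → ℕ → ℝ) (c : (Fin N →₀ ℕ) → ℝ) (n : ℕ) (ρ : Fin N →₀ ℕ) :
    altSum φ (fun μ => if μ.degree = n then c μ else 0) ρ =
      if ρ.degree = n + (permExp (1 : Equiv.Perm (Fin N))).degree then altSum φ c ρ else 0 := by
  rw [altSum, altSum]
  have : ∀ σ : Equiv.Perm (Fin N), permExp σ ≤ ρ → ((ρ - permExp σ).degree = n ↔
      ρ.degree = n + (permExp (1 : Equiv.Perm (Fin N))).degree) := by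
    intro σ h
    have h1 := congrArg Finsupp.degree (tsub_add_cancel_of_le h)
    rw [map_add, degree_permExp] at h1
    omega
  by_cases h : ρ.degree = n + (permExp (1 : Equiv.Perm (Fin N))).degree
  · rw [if_pos h]
    refine Finset.sum_congr rfl fun σ _ => ?_
    congr 1
    split_ifs with h1 h2
    · rfl
    · exact absurd ((this σ h1).2 h) h2
    · rfl
  · rw [if_neg h]
    refine Finset.sum_eq_zero fun σ _ => ?_
    split_ifs with h1 h2
    · exact absurd ((this σ h1).1 h2) h
    · simp
    · simp

/-- By `det_binomial_column`, the operator at u = 0 produces the factors x_i / (1 - x_i): the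
exponent a becomes a + 1 and x_1⋯x_N splits off. In Jack coordinates this is a recursion that adds a
full column. -/
theorem sekiguchiDet_binPoly (θ a : ℝ) (N n : ℕ) :
    sekiguchiDet θ 0 N (binPoly a N (n + N)) = vandermonde N *
      ((∏ j : Fin N, (a - (j : ℕ) * θ)) • (monomial (onesExp N) 1 * binPoly (a + 1) N n)) := by
  ext ρ
  rw [mul_smul_comm, coeff_smul, coeff_sekiguchiDet, coeff_vandermonde_mul]
  simp only [coeff_binPoly]
  rw [altSum_degree, altSum_binCoef]
  have h : (fun μ : Fin N →₀ ℕ => coeff μ (monomial (onesExp N) 1 * binPoly (a + 1) N n)) =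
      fun μ : Fin N →₀ ℕ => if μ.degree = n + N then
        (if onesExp N ≤ μ then ∏ i, binCoef (a + 1) (μ i - 1) else 0) else 0 := by
    funext μ
    rw [coeff_monomial_mul', coeff_binPoly, one_mul]
    have h0 : (onesExp N).degree = N := by
      rw [Finsupp.degree_eq_sum]; simp
    by_cases h1 : onesExp N ≤ μ
    · have h2 := congrArg Finsupp.degree (tsub_add_cancel_of_le h1)
      rw [map_add, h0] at h2
      rw [if_pos h1, if_pos h1]
      refine if_congr (by omega) ?_ rfl
      rfl
    · rw [if_neg h1, if_neg h1, ite_self]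
  rw [h, altSum_degree]
  split_ifs <;> simp

end
end JackMeasures

/-! ### Explicit Gamma products and their row and column recursions. -/

namespace JackMeasures
open MvPolynomial
noncomputable section

/-! ### Closed formulas and their recursions -/

theorem prod_pairs_castSucc {α : Type*} [CommMonoid α] {n : ℕ} (F : Fin (n + 1) → Fin (n + 1) → α) :
    ∏ i, ∏ j ∈ Finset.Ioi i, F i j =
      (∏ i : Fin n, ∏ j ∈ Finset.Ioi i, F i.castSucc j.castSucc) *
        ∏ i : Fin n, F i.castSucc (Fin.last n) := by
  have h1 : Finset.Ioi (Fin.last n) = ∅ := by ext i; simp [Fin.le_last]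
  rw [Fin.prod_univ_castSucc, h1, Finset.prod_empty, mul_one, ← Finset.prod_mul_distrib]
  refine Finset.prod_congr rfl fun i _ => ?_
  have h2 : Finset.Ioi i.castSucc = insert (Fin.last n) ((Finset.Ioi i).map Fin.castSuccEmb) := by
    ext j
    induction j using Fin.lastCases with
    | last => simp [Fin.castSucc_lt_last]
    | cast j => simpa [Fin.castSucc_lt_castSucc_iff] using fun _ => (Fin.castSucc_lt_last j).le
  rw [h2, Finset.prod_insert, Finset.prod_map, mul_comm]
  · rfl
  · simp

/-- The shifted rows `μ_i + (N - i) θ`. -/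
def shiftedRow (θ : ℝ) (N : ℕ) (μ : Fin N → ℕ) (i : Fin N) : ℝ := (μ i : ℝ) + ((N : ℝ) - 1 - (i : ℕ)) * θ

theorem shiftedRow_snocZero (θ : ℝ) {n : ℕ} (μ : Fin n →₀ ℕ) (i : Fin n) :
    shiftedRow θ (n + 1) (snocZero μ) i.castSucc = shiftedRow θ n μ i + θ := by
  simp only [shiftedRow, snocZero_castSucc, Fin.val_castSucc]
  push_cast
  ring

theorem shiftedRow_snocZero_last (θ : ℝ) {n : ℕ} (μ : Fin n →₀ ℕ) :
    shiftedRow θ (n + 1) (snocZero μ) (Fin.last n) = 0 := by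
  simp [shiftedRow]

theorem shiftedRow_add_ones (θ : ℝ) {N : ℕ} (μ : Fin N →₀ ℕ) (i : Fin N) :
    shiftedRow θ N (μ + onesExp N : Fin N →₀ ℕ) i = shiftedRow θ N μ i + 1 := by
  simp only [shiftedRow, Finsupp.add_apply, onesExp_apply]
  push_cast
  ring

theorem shiftedRow_nonneg {θ : ℝ} (hθ : 0 < θ) {N : ℕ} (μ : Fin N → ℕ) (i : Fin N) :
    0 ≤ shiftedRow θ N μ i := by
  have : (((i : ℕ) + 1 : ℕ) : ℝ) ≤ (N : ℝ) := by exact_mod_cast i.2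
  push_cast at this
  have : 0 ≤ ((N : ℝ) - 1 - (i : ℕ)) * θ := mul_nonneg (by linarith) hθ.le
  unfold shiftedRow
  positivity

theorem le_shiftedRow_sub {θ : ℝ} (hθ : 0 < θ) {N : ℕ} {μ : Fin N → ℕ} (hμ : Antitone μ) {i j : Fin N}
    (hij : i < j) : θ ≤ shiftedRow θ N μ i - shiftedRow θ N μ j := by
  have h1 : (μ j : ℝ) ≤ μ i := by exact_mod_cast hμ hij.le
  have h2 : (((i : ℕ) + 1 : ℕ) : ℝ) ≤ (j : ℕ) := by exact_mod_cast hij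
  push_cast at h2
  unfold shiftedRow
  nlinarith

/-- The product over pairs of rows of a function of the difference of the shifted rows. -/
def pairProd (θ : ℝ) (N : ℕ) (φ : ℝ → ℝ) (μ : Fin N → ℕ) : ℝ :=
  ∏ i, ∏ j ∈ Finset.Ioi i, φ (shiftedRow θ N μ i - shiftedRow θ N μ j)

theorem pairProd_snocZero (θ : ℝ) {n : ℕ} (φ : ℝ → ℝ) (μ : Fin n →₀ ℕ) :
    pairProd θ (n + 1) φ (snocZero μ) = pairProd θ n φ μ * ∏ i, φ (shiftedRow θ n μ i + θ) := by
  rw [pairProd, prod_pairs_castSucc]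
  simp only [shiftedRow_snocZero, shiftedRow_snocZero_last, sub_zero, add_sub_add_right_eq_sub]
  rfl

theorem pairProd_add_ones (θ : ℝ) {N : ℕ} (φ : ℝ → ℝ) (μ : Fin N →₀ ℕ) :
    pairProd θ N φ (μ + onesExp N : Fin N →₀ ℕ) = pairProd θ N φ μ := by
  simp only [pairProd, shiftedRow_add_ones, add_sub_add_right_eq_sub]

theorem pairProd_pos {θ : ℝ} (hθ : 0 < θ) {N : ℕ} {φ : ℝ → ℝ} (hφ : ∀ d, θ ≤ d → 0 < φ d)
    {μ : Fin N → ℕ} (hμ : Antitone μ) : 0 < pairProd θ N φ μ :=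
  Finset.prod_pos fun _ _ => Finset.prod_pos fun _ hj =>
    hφ _ (le_shiftedRow_sub hθ hμ (Finset.mem_Ioi.1 hj))

/-- The product of Gamma functions in the expansion of `∏ (1 - x_i) ^ (-a)` in Jack polynomials. -/
def hookProd (θ : ℝ) (N : ℕ) (μ : Fin N → ℕ) : ℝ :=
  (∏ i, Real.Gamma (shiftedRow θ N μ i + 1)) *
    pairProd θ N (fun d => Real.Gamma (d + 1 - θ) / Real.Gamma (d + 1)) μ

theorem hookProd_pos {θ : ℝ} (hθ : 0 < θ) {N : ℕ} {μ : Fin N → ℕ} (hμ : Antitone μ) :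
    0 < hookProd θ N μ :=
  mul_pos (Finset.prod_pos fun i _ => Real.Gamma_pos_of_pos (by linarith [shiftedRow_nonneg hθ μ i]))
    (pairProd_pos hθ (fun d hd => div_pos (Real.Gamma_pos_of_pos (by linarith))
      (Real.Gamma_pos_of_pos (by linarith))) hμ)

theorem hookProd_snocZero {θ : ℝ} (hθ : 0 < θ) {n : ℕ} (μ : Fin n →₀ ℕ) :
    hookProd θ (n + 1) (snocZero μ) = hookProd θ n μ := by
  rw [hookProd, pairProd_snocZero, Fin.prod_univ_castSucc, shiftedRow_snocZero_last, zero_add,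
    Real.Gamma_one, mul_one, mul_left_comm, ← Finset.prod_mul_distrib, hookProd, mul_comm]
  congr 1
  refine Finset.prod_congr rfl fun i _ => ?_
  have h := shiftedRow_nonneg hθ μ i
  have h1 : Real.Gamma (shiftedRow θ n μ i + θ + 1) ≠ 0 := (Real.Gamma_pos_of_pos (by linarith)).ne'
  rw [shiftedRow_snocZero, mul_div_cancel₀ _ h1]
  congr 1
  ring

theorem hookProd_add_ones {θ : ℝ} (hθ : 0 < θ) {N : ℕ} (μ : Fin N →₀ ℕ) :
    hookProd θ N (μ + onesExp N : Fin N →₀ ℕ) = (∏ i, (shiftedRow θ N μ i + 1)) * hookProd θ N μ := by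
  rw [hookProd, hookProd, pairProd_add_ones, ← mul_assoc, ← Finset.prod_mul_distrib]
  congr 1
  refine Finset.prod_congr rfl fun i _ => ?_
  have h := shiftedRow_nonneg hθ μ i
  rw [shiftedRow_add_ones, Real.Gamma_add_one (by linarith)]

/-- The coefficient of the Jack polynomial in `∏ (1 - x_i) ^ (-a)`. -/
def binEval (θ a : ℝ) (N : ℕ) (μ : Fin N → ℕ) : ℝ :=
  (∏ i : Fin N, ∏ k ∈ Finset.range (μ i), (a - (i : ℕ) * θ + k)) / hookProd θ N μ

theorem binEval_snocZero {θ : ℝ} (hθ : 0 < θ) (a : ℝ) {n : ℕ} (μ : Fin n →₀ ℕ) :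
    binEval θ a (n + 1) (snocZero μ) = binEval θ a n μ := by
  rw [binEval, hookProd_snocZero hθ, Fin.prod_univ_castSucc, snocZero_last, Finset.prod_range_zero,
    mul_one, binEval]
  simp only [snocZero_castSucc, Fin.val_castSucc]

/-- The recursion dictated by `sekiguchiDet_binPoly`: the eigenvalue at u = 0 is the product of the
l_i + 1, which is exactly the factor gained by `hookProd`. -/
theorem binEval_add_ones {θ : ℝ} (hθ : 0 < θ) (a : ℝ) {N : ℕ} (μ : Fin N →₀ ℕ) :
    sekEigenvalue θ N (μ + onesExp N : Fin N →₀ ℕ) 0 * binEval θ a N (μ + onesExp N : Fin N →₀ ℕ) =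
      (∏ i : Fin N, (a - (i : ℕ) * θ)) * binEval θ (a + 1) N μ := by
  have h1 : sekEigenvalue θ N (μ + onesExp N : Fin N →₀ ℕ) 0 = ∏ i, (shiftedRow θ N μ i + 1) := by
    rw [sekEigenvalue_add_ones, zero_add]
    rfl
  have h2 : ∏ i, (shiftedRow θ N μ i + 1) ≠ 0 :=
    (Finset.prod_pos fun i _ => by linarith [shiftedRow_nonneg hθ μ i]).ne'
  rw [h1, binEval, hookProd_add_ones hθ, mul_div_assoc', mul_div_mul_left _ _ h2, binEval,
    mul_div_assoc', ← Finset.prod_mul_distrib]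
  congr 1
  refine Finset.prod_congr rfl fun i _ => ?_
  rw [Finsupp.add_apply, onesExp_apply, Finset.prod_range_succ', mul_comm]
  congr 1
  · simp
  · refine Finset.prod_congr rfl fun k _ => ?_
    push_cast
    ring

/-- At a = Nθ every factor is at least (N - i)θ, with i < N in the numbering from 0. This positivity
later shows that the Cauchy coefficients do not vanish. -/
theorem binEval_pos {θ : ℝ} (hθ : 0 < θ) {N : ℕ} {μ : Fin N → ℕ} (hμ : Antitone μ) :
    0 < binEval θ (N * θ) N μ := by
  refine div_pos (Finset.prod_pos fun i _ => Finset.prod_pos fun k _ => ?_) (hookProd_pos hθ hμ)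
  have : ((i : ℕ) : ℝ) < (N : ℝ) := by exact_mod_cast i.2
  have : 0 < ((N : ℝ) - (i : ℕ)) * θ := mul_pos (by linarith) hθ
  have hk : (0 : ℝ) ≤ k := by positivity
  linarith

/-- At a = Nθ the last new factor in row i is l_i + θ, so the recursion coincides with
`dualCoef_add_ones`. The quotient of the two functions, which will be J_λ(1^N), is thus unchanged by
a full column. -/
theorem binEval_add_ones_self {θ : ℝ} (hθ : 0 < θ) {N : ℕ} (μ : Fin N →₀ ℕ) :
    (∏ i, (shiftedRow θ N μ i + 1)) * binEval θ (N * θ) N (μ + onesExp N : Fin N →₀ ℕ) =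
      (∏ i, (shiftedRow θ N μ i + θ)) * binEval θ (N * θ) N μ := by
  have h2 : ∏ i, (shiftedRow θ N μ i + 1) ≠ 0 :=
    (Finset.prod_pos fun i _ => by linarith [shiftedRow_nonneg hθ μ i]).ne'
  rw [binEval, hookProd_add_ones hθ, mul_div_assoc', mul_div_mul_left _ _ h2, binEval,
    mul_div_assoc', ← Finset.prod_mul_distrib]
  congr 1
  refine Finset.prod_congr rfl fun i _ => ?_
  rw [Finsupp.add_apply, onesExp_apply, Finset.prod_range_succ, mul_comm]
  congr 1
  rw [shiftedRow]
  ring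

/-- The coefficient of `J_r(x) J_r(y)` in `∏ (1 - x_i y_j) ^ (-θ)`. -/
def dualCoef (θ : ℝ) (N : ℕ) (μ : Fin N → ℕ) : ℝ :=
  (∏ i, Real.Gamma (shiftedRow θ N μ i + θ) / (Real.Gamma θ * Real.Gamma (shiftedRow θ N μ i + 1))) *
    pairProd θ N (fun d => Real.Gamma d * Real.Gamma (d + 1) /
      (Real.Gamma (d + θ) * Real.Gamma (d + 1 - θ))) μ

theorem dualCoef_pos {θ : ℝ} (hθ : 0 < θ) {N : ℕ} {μ : Fin N → ℕ} (hμ : Antitone μ) :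
    0 < dualCoef θ N μ := by
  refine mul_pos (Finset.prod_pos fun i _ => ?_) (pairProd_pos hθ (fun d hd => ?_) hμ)
  · have h := shiftedRow_nonneg hθ μ i
    exact div_pos (Real.Gamma_pos_of_pos (by linarith)) (mul_pos (Real.Gamma_pos_of_pos hθ)
      (Real.Gamma_pos_of_pos (by linarith)))
  · exact div_pos (mul_pos (Real.Gamma_pos_of_pos (by linarith)) (Real.Gamma_pos_of_pos (by linarith)))
      (mul_pos (Real.Gamma_pos_of_pos (by linarith)) (Real.Gamma_pos_of_pos (by linarith)))

theorem dualCoef_snocZero {θ : ℝ} (hθ : 0 < θ) {n : ℕ} (μ : Fin n →₀ ℕ) :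
    dualCoef θ (n + 1) (snocZero μ) = dualCoef θ n μ := by
  have h0 : Real.Gamma θ ≠ 0 := (Real.Gamma_pos_of_pos hθ).ne'
  rw [dualCoef, pairProd_snocZero, Fin.prod_univ_castSucc, shiftedRow_snocZero_last, zero_add, zero_add,
    Real.Gamma_one, mul_one, div_self h0, mul_one, mul_left_comm, ← Finset.prod_mul_distrib, dualCoef,
    mul_comm]
  congr 1
  refine Finset.prod_congr rfl fun i _ => ?_
  have h := shiftedRow_nonneg hθ μ i
  have h1 : Real.Gamma (shiftedRow θ n μ i + θ + 1) ≠ 0 := (Real.Gamma_pos_of_pos (by linarith)).ne'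
  have h2 : Real.Gamma (shiftedRow θ n μ i + θ + θ) ≠ 0 := (Real.Gamma_pos_of_pos (by linarith)).ne'
  have h3 : Real.Gamma (shiftedRow θ n μ i + 1) ≠ 0 := (Real.Gamma_pos_of_pos (by linarith)).ne'
  have h4 : shiftedRow θ n μ i + θ + 1 - θ = shiftedRow θ n μ i + 1 := by ring
  rw [shiftedRow_snocZero, h4]
  field_simp

theorem dualCoef_add_ones {θ : ℝ} (hθ : 0 < θ) {N : ℕ} (μ : Fin N →₀ ℕ) :
    (∏ i, (shiftedRow θ N μ i + 1)) * dualCoef θ N (μ + onesExp N : Fin N →₀ ℕ) =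
      (∏ i, (shiftedRow θ N μ i + θ)) * dualCoef θ N μ := by
  rw [dualCoef, dualCoef, pairProd_add_ones, ← mul_assoc, ← mul_assoc, ← Finset.prod_mul_distrib,
    ← Finset.prod_mul_distrib]
  congr 1
  refine Finset.prod_congr rfl fun i _ => ?_
  have h := shiftedRow_nonneg hθ μ i
  have h0 : Real.Gamma θ ≠ 0 := (Real.Gamma_pos_of_pos hθ).ne'
  have h3 : Real.Gamma (shiftedRow θ N μ i + 1) ≠ 0 := (Real.Gamma_pos_of_pos (by linarith)).ne'
  have h4 : shiftedRow θ N μ i + 1 ≠ 0 := by linarith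
  rw [shiftedRow_add_ones, Real.Gamma_add_one h4, add_right_comm, Real.Gamma_add_one (by linarith)]
  field_simp

/-! ### Induction on diagrams by rows and columns, and the product over boxes. -/

theorem removeColumn_card_lt {lam : YoungDiagram} (h : 0 < lam.colLen 0) :
    (removeColumn lam).card < lam.card := by
  rw [card_eq_sum_rowLen (lam := lam) le_rfl, card_eq_sum_rowLen (colLen_removeColumn_le lam)]
  refine Finset.sum_lt_sum (fun i _ => ?_) ⟨⟨0, h⟩, Finset.mem_univ _, ?_⟩
  · rw [rowLen_removeColumn]; omega
  · have h1 : lam.rowLen 0 ≠ 0 := by rw [Ne, rowLen_eq_zero]; omega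
    rw [rowLen_removeColumn]
    simp only
    omega

/-- Induction on diagrams with at most `N` rows, by adding an empty row or a full column. -/
theorem diagram_induction {P : ℕ → YoungDiagram → Prop} (zero : ∀ lam, lam.colLen 0 = 0 → P 0 lam)
    (snoc : ∀ N lam, lam.colLen 0 ≤ N → P N lam → P (N + 1) lam)
    (column : ∀ N lam, lam.colLen 0 = N + 1 → P (N + 1) (removeColumn lam) → P (N + 1) lam)
    (N : ℕ) (lam : YoungDiagram) (h : lam.colLen 0 ≤ N) : P N lam := by
  induction N generalizing lam with
  | zero => exact zero lam (Nat.le_zero.1 h)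
  | succ N ih =>
    induction hc : lam.card using Nat.strong_induction_on generalizing lam with
    | _ c ihc =>
      by_cases h1 : lam.colLen 0 ≤ N
      · exact snoc N lam h1 (ih lam h1)
      · refine column N lam (by omega) (ihc _ ?_ _ ((colLen_removeColumn_le lam).trans h) rfl)
        rw [← hc]
        exact removeColumn_card_lt (by omega)

theorem colLen_eq_zero_iff {lam : YoungDiagram} : lam.colLen 0 = 0 ↔ lam = ⊥ := by
  constructor
  · intro h
    exact YoungDiagram_ext_rowLen fun i => by
      rw [rowLen_eq_zero.2 (by omega), rowLen_eq_zero.2]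
      rw [Nat.le_iff_lt_or_eq]
      by_contra hc
      have : ((⟨0, by omega⟩ : Fin 1) : ℕ) < (⊥ : YoungDiagram).colLen 0 := by simp only; omega
      rw [← YoungDiagram.mem_iff_lt_colLen] at this
      exact YoungDiagram.notMem_bot _ this
  · rintro rfl
    by_contra hc
    have : 0 < (⊥ : YoungDiagram).colLen 0 := by omega
    rw [← YoungDiagram.mem_iff_lt_colLen] at this
    exact YoungDiagram.notMem_bot _ this

/-- The factor of a box in the definition of `Q_λ`. -/
def boxFactor (θ : ℝ) (lam : YoungDiagram) (b : ℕ × ℕ) : ℝ :=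
  ((arm lam b : ℝ) + θ * leg lam b + θ) / ((arm lam b : ℝ) + θ * leg lam b + 1)

/-- The boxes of the first column. -/
def firstColumnEmb : ℕ ↪ ℕ × ℕ := ⟨fun i => (i, 0), fun _ _ h => (Prod.mk.inj h).1⟩

@[simp] theorem firstColumnEmb_apply (i : ℕ) : firstColumnEmb i = (i, 0) := rfl

/-- The shift of the boxes by one column. -/
def shiftEmb : ℕ × ℕ ↪ ℕ × ℕ := ⟨fun b => (b.1, b.2 + 1), fun _ _ h =>
  Prod.ext (Prod.mk.inj h).1 (Nat.succ_injective (Prod.mk.inj h).2)⟩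

@[simp] theorem shiftEmb_apply (b : ℕ × ℕ) : shiftEmb b = (b.1, b.2 + 1) := rfl

theorem cells_eq_removeColumn (lam : YoungDiagram) : lam.cells =
    (Finset.range (lam.colLen 0)).map firstColumnEmb ∪ (removeColumn lam).cells.map shiftEmb := by
  ext ⟨i, j⟩
  simp only [Finset.mem_union, Finset.mem_map, Finset.mem_range, firstColumnEmb_apply, shiftEmb_apply,
    Prod.mk.injEq, Prod.exists, YoungDiagram.mem_cells, mem_removeColumn]
  rcases j with _ | j
  · simp [YoungDiagram.mem_iff_lt_colLen]
  · simp

theorem prod_boxFactor_removeColumn (θ : ℝ) (lam : YoungDiagram) :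
    ∏ b ∈ lam.cells, boxFactor θ lam b = (∏ i ∈ Finset.range (lam.colLen 0), boxFactor θ lam (i, 0)) *
      ∏ b ∈ (removeColumn lam).cells, boxFactor θ (removeColumn lam) b := by
  rw [cells_eq_removeColumn, Finset.prod_union, Finset.prod_map, Finset.prod_map]
  · congr 1
    refine Finset.prod_congr rfl fun b _ => ?_
    have h1 : arm lam (b.1, b.2 + 1) = arm (removeColumn lam) b := by
      simp only [arm, rowLen_removeColumn]; omega
    have h2 : leg lam (b.1, b.2 + 1) = leg (removeColumn lam) b := by
      simp only [leg, colLen_removeColumn]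
    rw [shiftEmb_apply, boxFactor, boxFactor, h1, h2]
  · rw [Finset.disjoint_left]
    rintro ⟨i, j⟩ h1 h2
    simp only [Finset.mem_map, firstColumnEmb_apply, shiftEmb_apply, Prod.mk.injEq] at h1 h2
    obtain ⟨_, _, _, rfl⟩ := h1
    obtain ⟨_, _, _, h3⟩ := h2
    omega

/-- Only the first column changes when a full column is removed. Its box in row i has arm + θ · leg
equal to the shifted row l_i of the smaller diagram, so its factor is the ratio appearing in
`dualCoef_add_ones`. -/
theorem prod_boxFactor_eq {θ : ℝ} (hθ : 0 < θ) (N : ℕ) (lam : YoungDiagram) (h : lam.colLen 0 ≤ N) :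
    ∏ b ∈ lam.cells, boxFactor θ lam b = dualCoef θ N (rowExp N lam) := by
  revert N lam
  apply diagram_induction
  · intro lam h
    rw [colLen_eq_zero_iff.1 h]
    simp [dualCoef, pairProd]
  · intro N lam h ih
    rw [ih, ← snocZero_rowExp h, dualCoef_snocZero hθ]
  · intro N lam h ih
    rw [prod_boxFactor_removeColumn, ih, h]
    have h1 := dualCoef_add_ones hθ (rowExp (N + 1) (removeColumn lam))
    have hr := rowExp_removeColumn (N := N + 1) h.ge
    rw [hr] at h1
    have h2 : ∏ i, (shiftedRow θ (N + 1) (rowExp (N + 1) (removeColumn lam)) i + 1) ≠ 0 :=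
      (Finset.prod_pos fun i _ => by linarith [shiftedRow_nonneg hθ (rowExp (N + 1) (removeColumn lam)) i]).ne'
    apply mul_left_cancel₀ h2
    rw [h1, ← mul_assoc, Finset.prod_range, ← Finset.prod_mul_distrib]
    congr 1
    refine Finset.prod_congr rfl fun i _ => ?_
    have h3 := shiftedRow_nonneg hθ (rowExp (N + 1) (removeColumn lam)) i
    have h4 : (arm lam (i, 0) : ℝ) + θ * leg lam (i, 0) =
        shiftedRow θ (N + 1) (rowExp (N + 1) (removeColumn lam)) i := by
      have := i.2
      simp only [arm, leg, shiftedRow, rowExp_apply, rowLen_removeColumn, zero_add, h]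
      rw [Nat.cast_sub (by omega : (i : ℕ) + 1 ≤ N + 1)]
      push_cast
      ring
    rw [boxFactor, h4]
    have h5 : shiftedRow θ (N + 1) (rowExp (N + 1) (removeColumn lam)) i + 1 ≠ 0 := by linarith
    field_simp

end
end JackMeasures

namespace JackMeasures
open MvPolynomial
noncomputable section

/-! ### Linear operators on symmetric polynomials in the basis of Jack polynomials -/

theorem weight_one_apply {n : ℕ} (μ : Fin n →₀ ℕ) : Finsupp.weight 1 μ = ∑ i, μ i := by
  rw [← Finsupp.degree_eq_sum]
  exact (DFunLike.congr_fun Finsupp.degree_eq_weight_one μ).symm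

theorem jackExists_zero (θ : ℝ) : JackExists θ 0 := by
  intro lam h
  refine ⟨1, ⟨IsSymmetric.one, ?_, fun u => ?_⟩, ?_⟩
  · rw [Subsingleton.elim (Finsupp.equivFunOnFinite.symm fun i : Fin 0 => lam.rowLen i) 0, coeff_zero_one]
  · rw [sekiguchiDet_apply]
    simp [vandermonde]
  · rw [card_eq_sum_rowLen h]
    exact isHomogeneous_one _ _

theorem JackExists.pred {θ : ℝ} {n : ℕ} (h : JackExists θ (n + 1)) : JackExists θ n := by
  intro lam hl
  obtain ⟨f, hf, hh⟩ := h lam (hl.trans n.le_succ)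
  refine ⟨restrictLast n f, hf.restrictLast hl, fun μ hμ => ?_⟩
  rw [coeff_restrictLast] at hμ
  have := hh hμ
  rw [weight_one_apply] at this ⊢
  rw [Fin.sum_univ_castSucc, snocZero_last, add_zero] at this
  simpa using this

/-- A symmetric polynomial restricted to one variable less. -/
def restrictSym (n : ℕ) :
    symmetricSubalgebra (Fin (n + 1)) ℝ →ₗ[ℝ] symmetricSubalgebra (Fin n) ℝ where
  toFun := fun f => ⟨restrictLast n f.1, restrictLast_isSymmetric f.2⟩
  map_add' := fun _ _ => Subtype.ext (map_add (restrictLast n) _ _)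
  map_smul' := fun r f => Subtype.ext (map_smul (restrictLast n) r f.1)

/-- Multiplication of a symmetric polynomial by `x_1 ⋯ x_N`. -/
def mulOnes (N : ℕ) : symmetricSubalgebra (Fin N) ℝ →ₗ[ℝ] symmetricSubalgebra (Fin N) ℝ :=
  LinearMap.mulLeft ℝ ⟨monomial (onesExp N) 1, isSymmetric_prod_X N⟩

/-- A diagram regarded as one with at most `n + 1` rows. -/
def Diagrams.castSucc {n : ℕ} (lam : Diagrams n) : Diagrams (n + 1) := ⟨lam.1, lam.2.trans n.le_succ⟩

section

variable {θ : ℝ} (hθ : 0 < θ) {N : ℕ} (h : JackExists θ N)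

include hθ in
theorem JackExists.basis_of_isJackPolynomial {lam : Diagrams N} {f : symmetricSubalgebra (Fin N) ℝ}
    (hf : IsJackPolynomial θ N lam.1 f.1) : f = h.basis hθ lam :=
  Subtype.ext (by rw [h.basis_val hθ]; exact hf.eq_jackPoly hθ)

include hθ in
theorem JackExists.isJackPolynomial_basis (lam : Diagrams N) :
    IsJackPolynomial θ N lam.1 (h.basis hθ lam).1 := by
  rw [h.basis_val hθ]; exact h.isJackPolynomial hθ lam

/-- On the basis, putting the last variable equal to zero either keeps the diagram or, if it has n +
1 rows, gives zero. -/
theorem JackExists.repr_restrictSym {n : ℕ} (h' : JackExists θ (n + 1)) (h : JackExists θ n)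
    (f : symmetricSubalgebra (Fin (n + 1)) ℝ) (lam : Diagrams n) :
    (h.basis hθ).repr (restrictSym n f) lam = (h'.basis hθ).repr f lam.castSucc := by
  have key : (h.basis hθ).coord lam ∘ₗ restrictSym n = (h'.basis hθ).coord lam.castSucc := by
    refine (h'.basis hθ).ext fun mu => ?_
    have hmu := h'.isJackPolynomial_basis hθ mu
    rw [LinearMap.comp_apply, Module.Basis.coord_apply, Module.Basis.coord_apply, Module.Basis.repr_self]
    by_cases hl : mu.1.colLen 0 ≤ n
    · have h1 : restrictSym n (h'.basis hθ mu) = h.basis hθ ⟨mu.1, hl⟩ :=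
        h.basis_of_isJackPolynomial hθ (lam := ⟨mu.1, hl⟩) (hmu.restrictLast hl)
      rw [h1, Module.Basis.repr_self]
      classical
      rw [Finsupp.single_apply, Finsupp.single_apply]
      refine if_congr ?_ rfl rfl
      rw [Subtype.ext_iff, Subtype.ext_iff]
      rfl
    · have h1 : restrictSym n (h'.basis hθ mu) = 0 :=
        Subtype.ext (hmu.restrictLast_eq_zero hθ (by omega))
      rw [h1, map_zero, Finsupp.zero_apply, Finsupp.single_eq_of_ne]
      rintro rfl
      exact hl lam.2
  exact DFunLike.congr_fun key f

/-- The diagram with the first column removed. -/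
def Diagrams.removeColumn (lam : Diagrams N) : Diagrams N :=
  ⟨JackMeasures.removeColumn lam.1, (colLen_removeColumn_le _).trans lam.2⟩

/-- On the basis, multiplication by x_1⋯x_N adds a full column, and a diagram with N rows arises in
this way from exactly one diagram. -/
theorem JackExists.repr_mulOnes (f : symmetricSubalgebra (Fin N) ℝ) (lam : Diagrams N)
    (hl : lam.1.colLen 0 = N) :
    (h.basis hθ).repr (mulOnes N f) lam = (h.basis hθ).repr f lam.removeColumn := by
  have key : (h.basis hθ).coord lam ∘ₗ mulOnes N = (h.basis hθ).coord lam.removeColumn := by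
    refine (h.basis hθ).ext fun mu => ?_
    rw [LinearMap.comp_apply, Module.Basis.coord_apply, Module.Basis.coord_apply, Module.Basis.repr_self]
    obtain ⟨nu, hnu, hnu'⟩ := exists_diagram (rowExp N mu.1 + onesExp N) (by
      intro i j hij
      simpa using rowExp_antitone N mu.1 hij)
    have hc : N ≤ nu.colLen 0 := by
      by_contra hc
      have h1 : nu.rowLen (nu.colLen 0) = 0 := rowLen_eq_zero.2 le_rfl
      have h2 := DFunLike.congr_fun hnu' ⟨nu.colLen 0, by omega⟩
      simp only [rowExp_apply, Finsupp.add_apply, onesExp_apply, h1] at h2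
      omega
    have hr : JackMeasures.removeColumn nu = mu.1 := by
      refine rowExp_injective ((colLen_removeColumn_le _).trans hnu) mu.2 ?_
      have := rowExp_removeColumn hc
      rw [hnu'] at this
      exact add_right_cancel this
    have h1 : mulOnes N (h.basis hθ mu) = h.basis hθ ⟨nu, hnu⟩ := by
      refine h.basis_of_isJackPolynomial hθ (lam := ⟨nu, hnu⟩) ?_
      refine IsJackPolynomial.of_removeColumn hc ?_
      rw [hr]
      exact h.isJackPolynomial_basis hθ mu
    rw [h1, Module.Basis.repr_self]
    classical
    rw [Finsupp.single_apply, Finsupp.single_apply]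
    refine if_congr ?_ rfl rfl
    rw [Subtype.ext_iff, Subtype.ext_iff]
    constructor
    · rintro h2
      change nu = lam.1 at h2
      change mu.1 = JackMeasures.removeColumn lam.1
      rw [← h2, hr]
    · intro h2
      change mu.1 = JackMeasures.removeColumn lam.1 at h2
      refine rowExp_injective hnu lam.2 ?_
      rw [← rowExp_removeColumn hc, hr, h2, rowExp_removeColumn hl.ge]
  exact DFunLike.congr_fun key f

/-- Sekiguchi's operator in the basis of Jack polynomials. -/
def JackExists.sekOp (u : ℝ) : Module.End ℝ (symmetricSubalgebra (Fin N) ℝ) :=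
  (h.basis hθ).constr ℝ fun lam => sekEigenvalue θ N (rowExp N lam.1) u • h.basis hθ lam

/-- Checked on the basis, where it is the defining equation. It justifies treating the diagonal
operator `sekOp` as Sekiguchi's determinant divided by the Vandermonde. -/
theorem JackExists.vandermonde_mul_sekOp (u : ℝ) (f : symmetricSubalgebra (Fin N) ℝ) :
    vandermonde N * (h.sekOp hθ u f).1 = sekiguchiDet θ u N f.1 := by
  have key : LinearMap.mulLeft ℝ (vandermonde N) ∘ₗ (symmetricSubalgebra (Fin N) ℝ).val.toLinearMap ∘ₗ
      h.sekOp hθ u = sekiguchiDet θ u N ∘ₗ (symmetricSubalgebra (Fin N) ℝ).val.toLinearMap := by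
    refine (h.basis hθ).ext fun lam => ?_
    have h1 := (h.isJackPolynomial_basis hθ lam).sekiguchi u
    refine Eq.trans ?_ h1.symm
    simp only [LinearMap.comp_apply, LinearMap.mulLeft_apply, JackExists.sekOp,
      Module.Basis.constr_basis, map_smul]
    rw [← smul_eq_C_mul, mul_smul_comm]
    rfl
  exact DFunLike.congr_fun key f

theorem JackExists.repr_sekOp (u : ℝ) (f : symmetricSubalgebra (Fin N) ℝ) (lam : Diagrams N) :
    (h.basis hθ).repr (h.sekOp hθ u f) lam =
      sekEigenvalue θ N (rowExp N lam.1) u * (h.basis hθ).repr f lam := by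
  have key : (h.basis hθ).coord lam ∘ₗ h.sekOp hθ u =
      sekEigenvalue θ N (rowExp N lam.1) u • (h.basis hθ).coord lam := by
    refine (h.basis hθ).ext fun mu => ?_
    rw [LinearMap.comp_apply, LinearMap.smul_apply, JackExists.sekOp, Module.Basis.constr_basis, map_smul,
      Module.Basis.coord_apply, Module.Basis.repr_self, smul_eq_mul, smul_eq_mul]
    by_cases hm : mu = lam
    · rw [hm]
    · rw [Finsupp.single_eq_of_ne (Ne.symm hm), mul_zero, mul_zero]
  exact DFunLike.congr_fun key f

/-! ### The expansion of `∏ (1 - x_i) ^ (-a)` -/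

/-- `binPoly` as an element of the algebra of symmetric polynomials. -/
def binSym (a : ℝ) (n m : ℕ) : symmetricSubalgebra (Fin n) ℝ := ⟨binPoly a n m, binPoly_isSymmetric a n m⟩

include hθ in
-- Both sides obey the same two recursions: an empty row corresponds to restriction to fewer
-- variables, and a full column to `sekiguchiDet_binPoly`. The column step passes from a to a + 1,
-- so a stays universally quantified in the induction.
theorem JackExists.repr_binSym_of_card (N : ℕ) (lam : YoungDiagram) (hl : lam.colLen 0 ≤ N) :
    ∀ (h : JackExists θ N) (a : ℝ) (hl : lam.colLen 0 ≤ N),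
      (h.basis hθ).repr (binSym a N lam.card) ⟨lam, hl⟩ = binEval θ a N (rowExp N lam) := by
  revert N lam
  apply diagram_induction
  · intro lam h0 h a hl
    have hb : binSym a 0 lam.card = h.basis hθ ⟨lam, hl⟩ := by
      apply Subtype.ext
      ext μ
      have hμ : μ = rowExp 0 lam := Subsingleton.elim _ _
      rw [hμ, h.basis_val, h.coeff_self hθ ⟨lam, hl⟩]
      change coeff _ (binPoly a 0 _) = 1
      rw [coeff_binPoly, degree_rowExp hl, if_pos rfl]
      simp
    rw [hb, Module.Basis.repr_self, Finsupp.single_eq_same]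
    simp [binEval, hookProd, pairProd]
  · intro N lam hN ih h a hl
    rw [← snocZero_rowExp hN, binEval_snocZero hθ, ← ih h.pred a hN, ← (show restrictSym N
      (binSym a (N + 1) lam.card) = binSym a N lam.card from Subtype.ext (restrictLast_binPoly a N _)),
      h.repr_restrictSym hθ h.pred]
    rfl
  · intro N lam hN ih h a hl
    have hr := rowExp_removeColumn (N := N + 1) hN.ge
    have hc : lam.card = (removeColumn lam).card + (N + 1) := by
      rw [← degree_rowExp hl, ← hr, map_add, degree_rowExp ((colLen_removeColumn_le _).trans hl),
        Finsupp.degree_eq_sum (onesExp (N + 1))]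
      simp
    have h1 : h.sekOp hθ 0 (binSym a (N + 1) lam.card) = (∏ j : Fin (N + 1), (a - (j : ℕ) * θ)) •
        mulOnes (N + 1) (binSym (a + 1) (N + 1) (removeColumn lam).card) := by
      apply Subtype.ext
      apply mul_left_cancel₀ (vandermonde_ne_zero (N + 1))
      rw [h.vandermonde_mul_sekOp, hc]
      exact sekiguchiDet_binPoly θ a (N + 1) _
    have h2 := congrArg (fun f => (h.basis hθ).repr f ⟨lam, hl⟩) h1
    simp only [map_smul, Finsupp.smul_apply] at h2
    rw [h.repr_sekOp hθ, h.repr_mulOnes hθ _ _ hN] at h2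
    have h3 := ih h (a + 1) ((colLen_removeColumn_le _).trans hl)
    have h4 : Diagrams.removeColumn (⟨lam, hl⟩ : Diagrams (N + 1)) =
      ⟨removeColumn lam, (colLen_removeColumn_le _).trans hl⟩ := rfl
    rw [h4, h3, smul_eq_mul, ← binEval_add_ones hθ, hr] at h2
    refine mul_left_cancel₀ ?_ h2
    have h5 : sekEigenvalue θ (N + 1) (rowExp (N + 1) lam) 0 =
        ∏ i, (shiftedRow θ (N + 1) (rowExp (N + 1) (removeColumn lam)) i + 1) := by
      rw [← hr, sekEigenvalue_add_ones, zero_add]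
      rfl
    rw [h5]
    exact (Finset.prod_pos fun i _ => by
      linarith [shiftedRow_nonneg hθ (rowExp (N + 1) (removeColumn lam)) i]).ne'

theorem JackExists.repr_binSym (a : ℝ) {n : ℕ} (lam : Diagrams N) (hn : lam.1.card = n) :
    (h.basis hθ).repr (binSym a N n) lam = binEval θ a N (rowExp N lam.1) := by
  subst hn
  exact JackExists.repr_binSym_of_card hθ N lam.1 lam.2 h a lam.2

/-! ### Sums over diagrams of a given size -/

theorem finite_diagrams_card (N n : ℕ) : {lam : Diagrams N | lam.1.card = n}.Finite := by
  classical
  refine Set.Finite.of_finite_image (f := fun lam : Diagrams N => rowExp N lam.1)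
    (((Finset.finsuppAntidiag Finset.univ n).finite_toSet).subset ?_) ?_
  · rintro _ ⟨lam, hl, rfl⟩
    rw [Finset.mem_coe, Finset.mem_finsuppAntidiag]
    refine ⟨?_, Finset.subset_univ _⟩
    exact (card_eq_sum_rowLen lam.2).symm.trans hl
  · intro lam _ mu _ hlm
    exact Subtype.ext (rowExp_injective lam.2 mu.2 hlm)

/-- The diagrams with `n` boxes and at most `N` rows. -/
def diagramsOfCard (N n : ℕ) : Finset (Diagrams N) := (finite_diagrams_card N n).toFinset

@[simp] theorem mem_diagramsOfCard {N n : ℕ} {lam : Diagrams N} :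
    lam ∈ diagramsOfCard N n ↔ lam.1.card = n := by simp [diagramsOfCard]

theorem JackExists.eq_sum {f : symmetricSubalgebra (Fin N) ℝ} {n : ℕ} (hf : f.1.IsHomogeneous n) :
    f = ∑ lam ∈ diagramsOfCard N n, (h.basis hθ).repr f lam • h.basis hθ lam := by
  conv_lhs => rw [← (h.basis hθ).linearCombination_repr f, Finsupp.linearCombination_apply]
  refine Finsupp.sum_of_support_subset _ (fun lam hl => ?_) _ (by simp)
  rw [mem_diagramsOfCard]
  by_contra hc
  exact (Finsupp.mem_support_iff.1 hl) (h.repr_eq_zero_of_homogeneous hθ hf hc)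

theorem JackExists.repr_sum {n : ℕ} (c : Diagrams N → ℝ) {lam : Diagrams N} (hl : lam.1.card = n) :
    (h.basis hθ).repr (∑ mu ∈ diagramsOfCard N n, c mu • h.basis hθ mu) lam = c lam := by
  rw [map_sum, Finsupp.finsetSum_apply, Finset.sum_eq_single lam]
  · simp
  · intro mu _ hm
    simp [Finsupp.single_eq_of_ne (Ne.symm hm)]
  · intro hn
    exact absurd (mem_diagramsOfCard.2 hl) hn

end
end
end JackMeasures

namespace JackMeasures
open MvPolynomial
noncomputable section

/-! ### Existence of the Jack polynomials -/

theorem map_altSum {N : ℕ} {R R' : Type*} [AddCommGroup R] [Module ℝ R] [AddCommGroup R'] [Module ℝ R']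
    (L : R →ₗ[ℝ] R') (φ : Fin N → ℕ → ℝ) (c : (Fin N →₀ ℕ) → R) (ρ : Fin N →₀ ℕ) :
    L (altSum φ c ρ) = altSum φ (fun μ => L (c μ)) ρ := by
  rw [altSum, altSum, map_sum]
  refine Finset.sum_congr rfl fun σ _ => ?_
  rw [map_zsmul, apply_ite L, map_smul, map_zero]

/-- `kernelCoeff` as an element of the algebra of symmetric polynomials. -/
def kernelSym (θ : ℝ) (n : ℕ) {N : ℕ} (μ : Fin N →₀ ℕ) : symmetricSubalgebra (Fin n) ℝ :=
  ⟨kernelCoeff θ n μ, kernelCoeff_isSymmetric θ n μ⟩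

section

variable {θ : ℝ} (hθ : 0 < θ) {N : ℕ} (h : JackExists θ N)

/-- The kernel identity in N + 1 variables of each kind, restricted to y_{N+1} = 0. By
`restrictLast_sekiguchiDet` the operator in y becomes u y_1⋯y_N times the one in N variables at u +
θ. The factor y_1⋯y_N times the Vandermonde in y then cancels. -/
theorem JackExists.altSum_kernelSym (u : ℝ) (ρ : Fin (N + 1) →₀ ℕ) :
    altSum (sekFactor θ u (N + 1)) (fun μ => kernelSym θ N μ) ρ =
      altSum (fun _ _ => 1) (fun μ => u • h.sekOp hθ (u + θ) (kernelSym θ N μ)) ρ := by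
  apply Subtype.ext
  have h1 := congrArg (restrictLast N) (vandermonde_mul_altSum_kernelCoeff θ u (N + 1) ρ)
  have e1 := map_altSum (restrictLast N).toLinearMap (sekFactor θ u (N + 1)) (kernelCoeff θ (N + 1)) ρ
  have e2 := map_altSum (restrictLast N).toLinearMap (fun _ _ => 1)
    (fun μ => sekiguchiDet θ u (N + 1) (kernelCoeff θ (N + 1) μ)) ρ
  simp only [AlgHom.toLinearMap_apply, restrictLast_kernelCoeff, restrictLast_sekiguchiDet] at e1 e2
  rw [map_mul, e1, e2, restrictLast_vandermonde] at h1
  have e3 := map_altSum (symmetricSubalgebra (Fin N) ℝ).val.toLinearMap (sekFactor θ u (N + 1))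
    (fun μ => kernelSym θ N μ) ρ
  have e4 := map_altSum (LinearMap.mulLeft ℝ (monomial (onesExp N) 1 * vandermonde N) ∘ₗ
    (symmetricSubalgebra (Fin N) ℝ).val.toLinearMap) (fun _ _ => 1)
    (fun μ => u • h.sekOp hθ (u + θ) (kernelSym θ N μ)) ρ
  apply mul_left_cancel₀ (mul_ne_zero (monomial_eq_zero.not.2 one_ne_zero) (vandermonde_ne_zero N) :
    monomial (onesExp N) (1 : ℝ) * vandermonde N ≠ 0)
  refine Eq.trans ?_ (h1.trans (Eq.trans ?_ e4.symm))
  · exact congrArg _ e3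
  · congr 1
    funext μ
    have e5 := h.vandermonde_mul_sekOp hθ (u + θ) (kernelSym θ N μ)
    simp only [LinearMap.comp_apply, LinearMap.mulLeft_apply, map_smul]
    rw [mul_assoc, mul_assoc, ← smul_eq_C_mul]
    exact congrArg (fun p => u • (monomial (onesExp N) (1 : ℝ) * p)) e5.symm

/-- The coefficient of the Jack polynomial `J_λ(y)` in `∏ (1 - x_i y_j) ^ (-θ)`, where there is one
more variable `x` than there are variables `y`. -/
def JackExists.liftPoly (lam : Diagrams N) : MvPolynomial (Fin (N + 1)) ℝ :=
  ∑ μ ∈ Finset.finsuppAntidiag Finset.univ lam.1.card,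
    monomial μ ((h.basis hθ).repr (kernelSym θ N μ) lam)

theorem JackExists.coeff_liftPoly (lam : Diagrams N) (μ : Fin (N + 1) →₀ ℕ) :
    coeff μ (h.liftPoly hθ lam) = (h.basis hθ).repr (kernelSym θ N μ) lam := by
  rw [JackExists.liftPoly, coeff_sum, Finset.sum_congr rfl fun ν _ => coeff_monomial μ ν _,
    Finset.sum_ite_eq']
  split_ifs with hm
  · rfl
  · rw [h.repr_eq_zero_of_homogeneous hθ (kernelCoeff_isHomogeneous θ N μ)]
    intro hc
    apply hm
    rw [Finset.mem_finsuppAntidiag, hc, Finsupp.degree_eq_sum]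
    exact ⟨rfl, Finset.subset_univ _⟩

theorem JackExists.liftPoly_isHomogeneous (lam : Diagrams N) :
    (h.liftPoly hθ lam).IsHomogeneous lam.1.card := by
  intro μ hμ
  rw [h.coeff_liftPoly] at hμ
  by_contra hc
  apply hμ
  refine h.repr_eq_zero_of_homogeneous hθ (kernelCoeff_isHomogeneous θ N μ) ?_
  rw [weight_one_apply, ← Finsupp.degree_eq_sum] at hc
  exact Ne.symm hc

/-- The coordinate along J_λ(y) makes the right side of `altSum_kernelSym` diagonal. Its factor, u
times the eigenvalue at u + θ, is the eigenvalue of λ with an empty row appended. -/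
theorem JackExists.liftPoly_isSekEigen (lam : Diagrams N) :
    IsSekEigen θ (N + 1) (sekEigenvalue θ (N + 1) (rowExp (N + 1) lam.1)) (h.liftPoly hθ lam) := by
  refine ⟨fun τ => ?_, fun u => ?_⟩
  · ext μ
    obtain ⟨ν, rfl⟩ : ∃ ν : Fin (N + 1) →₀ ℕ, μ = ν.mapDomain τ := by
      refine ⟨μ.mapDomain τ.symm, ?_⟩
      rw [← Finsupp.mapDomain_comp]
      simp
    rw [coeff_rename_mapDomain _ τ.injective, h.coeff_liftPoly, h.coeff_liftPoly]
    congr 2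
    exact Subtype.ext (kernelCoeff_mapDomain θ N τ ν).symm
  · ext ρ
    rw [coeff_sekiguchiDet, coeff_vandermonde_mul]
    simp only [coeff_C_mul, h.coeff_liftPoly]
    have e1 := map_altSum ((h.basis hθ).coord lam) (sekFactor θ u (N + 1)) (fun μ => kernelSym θ N μ) ρ
    have e2 := map_altSum ((h.basis hθ).coord lam) (fun _ _ => 1)
      (fun μ => u • h.sekOp hθ (u + θ) (kernelSym θ N μ)) ρ
    rw [h.altSum_kernelSym hθ] at e1
    refine e1.symm.trans (e2.trans ?_)
    congr 1
    funext μ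
    rw [Module.Basis.coord_apply, map_smul, Finsupp.smul_apply, h.repr_sekOp hθ,
      ← snocZero_rowExp lam.2, sekEigenvalue_snocZero, smul_eq_mul, mul_assoc]

/-- The coefficient of `J_λ(x) J_λ(y)` in `∏ (1 - x_i y_j) ^ (-θ)`. -/
def JackExists.cauchyCoef (lam : Diagrams N) : ℝ :=
  (h.basis hθ).repr (kernelSym θ N (rowExp N lam.1)) lam

theorem kernelSym_snocZero (θ : ℝ) (n : ℕ) {N : ℕ} (μ : Fin N →₀ ℕ) :
    kernelSym θ n (snocZero μ) = kernelSym θ n μ := Subtype.ext (kernelCoeff_snocZero θ n μ)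

/-- At x_{N+1} = 0, `liftPoly` becomes an eigenfunction in N variables with the eigenvalue of λ,
hence a multiple of J_λ(x). So the kernel is diagonal in the Jack basis: this is the Cauchy
identity. -/
theorem JackExists.repr_kernelSym (lam : Diagrams N) (μ : Fin N →₀ ℕ) :
    (h.basis hθ).repr (kernelSym θ N μ) lam = h.cauchyCoef hθ lam * coeff μ (jackPoly θ N lam.1) := by
  have h1 := h.liftPoly_isSekEigen hθ lam
  rw [← snocZero_rowExp lam.2] at h1
  have h2 := h1.restrictLast.eq_smul hθ (rowExp_antitone N lam.1)
    (isJackPolynomial_iff.1 (h.isJackPolynomial hθ lam)).1 (h.coeff_self hθ lam)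
  have h3 := congrArg (coeff μ) h2
  rw [coeff_smul, coeff_restrictLast, coeff_restrictLast, h.coeff_liftPoly, h.coeff_liftPoly,
    kernelSym_snocZero, kernelSym_snocZero] at h3
  exact h3

/-- Putting y = 1^N in Π = ∑ c_λ J_λ(x) J_λ(y) turns Π into ∏ (1 - x_i)^(-Nθ), whose Jack
coefficients are already known. -/
theorem JackExists.binEval_eq (lam : Diagrams N) :
    binEval θ (N * θ) N (rowExp N lam.1) =
      h.cauchyCoef hθ lam * aeval (fun _ => (1 : ℝ)) (jackPoly θ N lam.1) := by
  have key : binSym (N * θ) N lam.1.card = ∑ mu ∈ diagramsOfCard N lam.1.card,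
      (h.cauchyCoef hθ mu * aeval (fun _ => (1 : ℝ)) (jackPoly θ N mu.1)) • h.basis hθ mu := by
    apply Subtype.ext
    rw [AddSubmonoidClass.coe_finsetSum]
    ext μ
    change coeff μ (binPoly (N * θ) N _) = _
    rw [coeff_sum, coeff_binPoly]
    have h0 : ∀ mu ∈ diagramsOfCard N lam.1.card, coeff μ
        (((h.cauchyCoef hθ mu * aeval (fun _ => (1 : ℝ)) (jackPoly θ N mu.1)) • h.basis hθ mu).1) =
        (h.basis hθ).repr (kernelSym θ N μ) mu * aeval (fun _ => (1 : ℝ)) (jackPoly θ N mu.1) := by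
      intro mu _
      rw [h.repr_kernelSym hθ, SetLike.val_smul, coeff_smul, h.basis_val hθ, smul_eq_mul]
      ring
    rw [Finset.sum_congr rfl h0]
    split_ifs with hd
    · have h1 := h.eq_sum hθ (hd ▸ kernelCoeff_isHomogeneous θ N μ : (kernelSym θ N μ).1.IsHomogeneous lam.1.card)
      have h2 := congrArg (fun f : symmetricSubalgebra (Fin N) ℝ => aeval (fun _ => (1 : ℝ)) f.1) h1
      simp only [AddSubmonoidClass.coe_finsetSum, SetLike.val_smul, map_sum, map_smul, h.basis_val hθ,
        smul_eq_mul] at h2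
      rw [← h2]
      exact (aeval_one_kernelCoeff θ N μ).symm
    · refine (Finset.sum_eq_zero fun mu hm => ?_).symm
      rw [mem_diagramsOfCard] at hm
      rw [h.repr_eq_zero_of_homogeneous hθ (kernelCoeff_isHomogeneous θ N μ) (by rw [hm]; exact Ne.symm hd),
        zero_mul]
  rw [← h.repr_binSym hθ (N * θ) lam rfl, key, h.repr_sum hθ _ rfl]

theorem JackExists.cauchyCoef_ne_zero (lam : Diagrams N) : h.cauchyCoef hθ lam ≠ 0 := by
  intro h0
  have h1 := h.binEval_eq hθ lam
  rw [h0, zero_mul] at h1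
  exact (binEval_pos hθ (rowExp_antitone N lam.1)).ne' h1

include hθ h in
-- For at most N rows, `liftPoly` is divided by its leading coefficient `cauchyCoef`, a factor of a
-- positive number. For N + 1 rows, the polynomial of the diagram without its first column is
-- multiplied by x_1⋯x_{N+1}.
theorem JackExists.succ : JackExists θ (N + 1) := by
  have key : ∀ lam : YoungDiagram, lam.colLen 0 ≤ N → ∃ f, IsJackPolynomial θ (N + 1) lam f ∧
      f.IsHomogeneous lam.card := by
    intro lam hl
    have h0 := h.cauchyCoef_ne_zero hθ ⟨lam, hl⟩
    refine ⟨(h.cauchyCoef hθ ⟨lam, hl⟩)⁻¹ • h.liftPoly hθ ⟨lam, hl⟩, isJackPolynomial_iff.2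
      ⟨(h.liftPoly_isSekEigen hθ ⟨lam, hl⟩).smul _, ?_⟩, ?_⟩
    · rw [coeff_smul, h.coeff_liftPoly, ← snocZero_rowExp hl, kernelSym_snocZero, smul_eq_mul]
      exact inv_mul_cancel₀ h0
    · rw [smul_eq_C_mul]
      exact (h.liftPoly_isHomogeneous hθ ⟨lam, hl⟩).C_mul _
  intro lam hl
  induction hc : lam.card using Nat.strong_induction_on generalizing lam with
  | _ c ih =>
    by_cases h1 : lam.colLen 0 ≤ N
    · rw [← hc]; exact key lam h1
    · obtain ⟨f, hf, hh⟩ := ih _ (hc ▸ removeColumn_card_lt (by omega)) (removeColumn lam)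
        ((colLen_removeColumn_le lam).trans hl) rfl
      refine ⟨_, hf.of_removeColumn (by omega), ?_⟩
      have h2 : (monomial (onesExp (N + 1)) (1 : ℝ)).IsHomogeneous (N + 1) := by
        apply isHomogeneous_monomial
        rw [Finsupp.degree_eq_sum]
        simp
      have h3 := h2.mul hh
      have h4 : N + 1 + (removeColumn lam).card = c := by
        rw [← hc, ← degree_rowExp hl, ← rowExp_removeColumn (by omega : N + 1 ≤ lam.colLen 0), map_add,
          degree_rowExp ((colLen_removeColumn_le _).trans hl), Finsupp.degree_eq_sum (onesExp (N + 1))]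
        simp [add_comm]
      rwa [h4] at h3

end

theorem jackExists {θ : ℝ} (hθ : 0 < θ) (N : ℕ) : JackExists θ N := by
  induction N with
  | zero => exact jackExists_zero θ
  | succ N ih => exact ih.succ hθ

end
end JackMeasures

/-! ### Explicit weights of the Jack measure. -/

namespace JackMeasures
open MvPolynomial
noncomputable section

/-! ### The Jack symmetric functions -/

theorem jackPoly_spec {θ : ℝ} (hθ : 0 < θ) {N : ℕ} {lam : YoungDiagram} (h : lam.colLen 0 ≤ N) :
    IsJackPolynomial θ N lam (jackPoly θ N lam) := (jackExists hθ N).isJackPolynomial hθ ⟨lam, h⟩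

theorem jackPoly_isHomogeneous {θ : ℝ} (hθ : 0 < θ) {N : ℕ} {lam : YoungDiagram} (h : lam.colLen 0 ≤ N) :
    (jackPoly θ N lam).IsHomogeneous lam.card := (jackExists hθ N).isHomogeneous hθ ⟨lam, h⟩

theorem exists_jackJ {θ : ℝ} (hθ : 0 < θ) (lam : YoungDiagram) :
    ∃ F : SymFun, ∀ N, lam.colLen 0 ≤ N → IsJackPolynomial θ N lam (F.1 N) := by
  refine ⟨⟨fun N => if lam.colLen 0 ≤ N then jackPoly θ N lam else 0, fun N => ?_, fun N => ?_,
    lam.card, fun N => ?_⟩, fun N hN => ?_⟩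
  · dsimp only
    split_ifs with h
    · exact (jackPoly_spec hθ h).isSymmetric
    · exact IsSymmetric.zero
  · dsimp only
    by_cases h : lam.colLen 0 ≤ N
    · rw [if_pos h, if_pos (h.trans N.le_succ)]
      exact ((jackPoly_spec hθ (h.trans N.le_succ)).restrictLast h).eq_jackPoly hθ
    · rw [if_neg h]
      split_ifs with h'
      · exact (jackPoly_spec hθ h').restrictLast_eq_zero hθ (by omega)
      · exact map_zero _
  · dsimp only
    split_ifs with h
    · exact (jackPoly_isHomogeneous hθ h).totalDegree_le
    · simp
  · dsimp only
    rw [if_pos hN]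
    exact jackPoly_spec hθ hN

theorem jackJ_val {θ : ℝ} (hθ : 0 < θ) {N : ℕ} {lam : YoungDiagram} (h : lam.colLen 0 ≤ N) :
    (jackJ θ lam).1 N = jackPoly θ N lam :=
  (Classical.epsilon_spec (exists_jackJ hθ lam) N h).eq_jackPoly hθ

theorem jackJ_val_eq_zero {θ : ℝ} (hθ : 0 < θ) {N : ℕ} {lam : YoungDiagram} (h : N < lam.colLen 0) :
    (jackJ θ lam).1 N = 0 := by
  have hr := (jackJ θ lam).2.2.1
  induction hk : lam.colLen 0 - N generalizing N with
  | zero => omega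
  | succ k ih =>
    rw [← hr N]
    by_cases h1 : lam.colLen 0 = N + 1
    · rw [jackJ_val hθ h1.le]
      exact (jackPoly_spec hθ h1.le).restrictLast_eq_zero hθ h
    · rw [ih (N := N + 1) (by omega) (by omega), map_zero]

theorem jackJ_isHomogeneous {θ : ℝ} (hθ : 0 < θ) (lam : YoungDiagram) (N : ℕ) :
    ((jackJ θ lam).1 N).IsHomogeneous lam.card := by
  rcases le_or_gt (lam.colLen 0) N with h | h
  · rw [jackJ_val hθ h]; exact jackPoly_isHomogeneous hθ h
  · rw [jackJ_val_eq_zero hθ h]; exact isHomogeneous_zero _ _ _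

/-! ### Specializations -/

theorem specialization_powerSum (θ : ℝ) (α β : ℕ → ℝ) (γ : ℝ) (j : ℕ) :
    specialization θ α β γ (powerSum j) = tripletPowerSum θ α β γ (j + 1) :=
  (existsUnique_specialization fun j => tripletPowerSum θ α β γ (j + 1)).choose_spec.1 j

theorem alphaSpecialization_powerSum (θ : ℝ) (N j : ℕ) :
    alphaSpecialization θ 1 N (powerSum j) = N := by
  rw [alphaSpecialization, specialization_powerSum, tripletPowerSum]
  have h : (fun i : ℕ => (if i < N then (1 : ℝ) else 0) ^ (j + 1)) =
      fun i => if i ∈ Finset.range N then 1 else 0 := by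
    funext i
    simp only [Finset.mem_range]
    split_ifs <;> simp
  rw [h, tsum_eq_sum (s := Finset.range N) (fun i hi => if_neg hi),
    Finset.sum_congr rfl fun i hi => if_pos hi]
  simp

theorem plancherelSpecialization_powerSum (θ s : ℝ) (j : ℕ) :
    plancherelSpecialization θ s (powerSum j) = if j = 0 then s else 0 := by
  rw [plancherelSpecialization, specialization_powerSum, tripletPowerSum]
  simp

theorem ext_of_powerSum {ρ₁ ρ₂ : SymFun →ₐ[ℝ] ℝ} (h : ∀ j, ρ₁ (powerSum j) = ρ₂ (powerSum j)) :
    ρ₁ = ρ₂ :=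
  (existsUnique_specialization fun j => ρ₂ (powerSum j)).unique h fun _ => rfl

theorem alphaSpecialization_apply (θ : ℝ) (N : ℕ) (F : SymFun) :
    alphaSpecialization θ 1 N F = aeval (fun _ => (1 : ℝ)) (F.1 N) := by
  let ev : SymFun →ₐ[ℝ] ℝ := (aeval fun _ => (1 : ℝ)).comp
    ((Pi.evalAlgHom ℝ (fun n : ℕ => MvPolynomial (Fin n) ℝ) N).comp SymFun.val)
  have : alphaSpecialization θ 1 N = ev := by
    refine ext_of_powerSum fun j => ?_
    rw [alphaSpecialization_powerSum]
    change _ = aeval (fun _ => (1 : ℝ)) (psum (Fin N) ℝ (j + 1))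
    simp [psum]
  rw [this]
  rfl

theorem algHom_ofPowerSums (ρ : SymFun →ₐ[ℝ] ℝ) (G : MvPolynomial ℕ ℝ) :
    ρ (ofPowerSums G) = aeval (fun j => ρ (powerSum j)) G := by
  have : ρ.comp ofPowerSums = aeval fun j => ρ (powerSum j) := by
    ext1 j
    simp [ofPowerSums]
  exact DFunLike.congr_fun this G

/-- For N variables all equal to s/N one has p_k = s^k N^(1-k), which tends to s for k = 1 and to 0
for k ≥ 2. A symmetric function is a polynomial in finitely many power sums, hence its values
converge; homogeneity extracts the factor (s/N)^n. -/
theorem tendsto_plancherelSpecialization (θ s : ℝ) {F : SymFun} {n : ℕ}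
    (hF : ∀ N, (F.1 N).IsHomogeneous n) :
    Tendsto (fun N : ℕ => (s / N) ^ n * aeval (fun _ => (1 : ℝ)) (F.1 N)) atTop
      (𝓝 (plancherelSpecialization θ s F)) := by
  obtain ⟨G, rfl⟩ := ofPowerSums_surjective F
  -- Freeness of the power sums transfers homogeneity of F to weighted homogeneity of G, where p_k
  -- has weight k.
  have hG : weightedHomogeneousComponent (fun i : ℕ => i + 1) n G = G := by
    apply ofPowerSums_injective
    apply Subtype.ext
    funext N
    have h1 := hF N
    rw [ofPowerSums_val] at h1 ⊢
    rw [ofPowerSums_val, ← homogeneousComponent_aeval_psum, homogeneousComponent_of_mem h1, if_pos rfl]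
  have hG' : G.IsWeightedHomogeneous (fun i : ℕ => i + 1) n := by
    rw [← hG]; exact weightedHomogeneousComponent_isWeightedHomogeneous n G
  have hscale : ∀ (x : ℝ) (v : ℕ → ℝ), aeval (fun j => x ^ (j + 1) * v j) G = x ^ n * aeval v G := by
    intro x v
    rw [aeval_def, aeval_def, eval₂_eq, eval₂_eq, Finset.mul_sum]
    refine Finset.sum_congr rfl fun d hd => ?_
    have h1 := hG' (mem_support_iff.1 hd)
    rw [Finsupp.weight_apply, Finsupp.sum] at h1
    rw [mul_left_comm, ← h1, ← Finset.prod_pow_eq_pow_sum, ← Finset.prod_mul_distrib]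
    congr 1
    refine Finset.prod_congr rfl fun i _ => ?_
    rw [mul_pow, smul_eq_mul, ← pow_mul, mul_comm (i + 1)]
  have h2 : ∀ N : ℕ, (s / N) ^ n * aeval (fun _ => (1 : ℝ)) ((ofPowerSums G).1 N) =
      aeval (fun j => (s / N) ^ (j + 1) * (N : ℝ)) G := by
    intro N
    rw [hscale, ← alphaSpecialization_apply θ, algHom_ofPowerSums]
    simp only [alphaSpecialization_powerSum]
  simp only [h2]
  rw [algHom_ofPowerSums]
  simp only [plancherelSpecialization_powerSum]
  have hc : Continuous fun v : ℕ → ℝ => aeval v G := by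
    simpa only [aeval_eq_eval] using MvPolynomial.continuous_eval G
  refine (hc.tendsto _).comp ?_
  rw [tendsto_pi_nhds]
  intro j
  have h3 : ∀ᶠ N : ℕ in atTop, s ^ (j + 1) * (1 / (N : ℝ)) ^ j = (s / N) ^ (j + 1) * (N : ℝ) := by
    filter_upwards [eventually_ge_atTop 1] with N hN
    have : (N : ℝ) ≠ 0 := by positivity
    rw [div_pow s, pow_succ (N : ℝ) j, one_div, inv_pow]
    field_simp
  refine Tendsto.congr' h3 ?_
  have h4 := ((tendsto_one_div_atTop_nhds_zero_nat (𝕜 := ℝ)).pow j).const_mul (s ^ (j + 1))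
  convert h4 using 2
  split_ifs with h
  · simp [h]
  · simp [h]

/-! ### The values of the Jack functions at the specializations -/

section

variable {θ : ℝ} (hθ : 0 < θ)

include hθ

omit hθ in
theorem stable_of_snocZero {α : Type*} {φ : ∀ N, (Fin N → ℕ) → α}
    (hφ : ∀ N (μ : Fin N →₀ ℕ), φ (N + 1) (snocZero μ) = φ N μ) {lam : YoungDiagram} {M N : ℕ}
    (h : lam.colLen 0 ≤ M) (hMN : M ≤ N) : φ N (rowExp N lam) = φ M (rowExp M lam) := by
  induction N, hMN using Nat.le_induction with
  | base => rfl
  | succ N hN ih => rw [← snocZero_rowExp (h.trans hN), hφ, ih]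

/-- The product c_λ J_λ(1^N) is known, and a full column does not change J_λ(1^N), since x_1⋯x_N = 1
there. So c_λ obeys the column recursion of `binEval` at a = Nθ, which is that of `dualCoef`. -/
theorem cauchyCoef_eq (N : ℕ) (lam : YoungDiagram) (hl : lam.colLen 0 ≤ N) :
    ∀ (h : JackExists θ N) (hl : lam.colLen 0 ≤ N),
      h.cauchyCoef hθ ⟨lam, hl⟩ = dualCoef θ N (rowExp N lam) := by
  revert N lam
  apply diagram_induction
  · intro lam h0 h hl
    have h1 := h.binEval_eq hθ ⟨lam, hl⟩
    have h2 : jackPoly θ 0 lam = 1 := by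
      ext μ
      have hμ : μ = rowExp 0 lam := Subsingleton.elim _ _
      rw [hμ, h.coeff_self hθ ⟨lam, hl⟩, Subsingleton.elim (rowExp 0 lam) 0, coeff_zero_one]
    simp only [h2, map_one, mul_one] at h1
    rw [← h1]
    simp [binEval, hookProd, pairProd, dualCoef]
  · intro N lam hN ih h hl
    rw [← snocZero_rowExp hN, dualCoef_snocZero hθ, ← ih h.pred hN, JackExists.cauchyCoef,
      JackExists.cauchyCoef, ← snocZero_rowExp hN, kernelSym_snocZero]
    have : kernelSym θ N (rowExp N lam) = restrictSym N (kernelSym θ (N + 1) (rowExp N lam)) :=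
      Subtype.ext (restrictLast_kernelCoeff θ N _).symm
    rw [this, h.repr_restrictSym hθ]
    rfl
  · intro N lam hN ih h hl
    have hr := rowExp_removeColumn (N := N + 1) hN.ge
    have hl' := (colLen_removeColumn_le lam).trans hl
    have h1 := h.binEval_eq hθ ⟨lam, hl⟩
    have h2 := h.binEval_eq hθ ⟨removeColumn lam, hl'⟩
    have h3 : jackPoly θ (N + 1) lam = monomial (onesExp (N + 1)) 1 * jackPoly θ (N + 1) (removeColumn lam) :=
      ((jackPoly_spec hθ hl').of_removeColumn hN.ge).eq_jackPoly hθ |>.symm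
    have h4 : aeval (fun _ => (1 : ℝ)) (jackPoly θ (N + 1) lam) =
        aeval (fun _ => (1 : ℝ)) (jackPoly θ (N + 1) (removeColumn lam)) := by
      rw [h3, map_mul, ← prod_X_eq, map_prod]
      simp
    simp only [h4, ih h hl'] at h1 h2
    rw [← hr] at h1 ⊢
    set μ := rowExp (N + 1) (removeColumn lam)
    have hμ : Antitone μ := rowExp_antitone _ _
    have h5 := binEval_add_ones_self hθ μ
    have h6 := dualCoef_add_ones hθ μ
    have h7 : ∏ i, (shiftedRow θ (N + 1) μ i + 1) ≠ 0 :=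
      (Finset.prod_pos fun i _ => by linarith [shiftedRow_nonneg hθ μ i]).ne'
    have h8 := (binEval_pos hθ hμ).ne'
    rw [h2] at h8
    have h9 := right_ne_zero_of_mul h8
    apply mul_left_cancel₀ h7
    rw [h6]
    apply mul_right_cancel₀ h9
    rw [h1, h2] at h5
    linear_combination h5

theorem aeval_one_jackPoly {N : ℕ} {lam : YoungDiagram} (hl : lam.colLen 0 ≤ N) :
    aeval (fun _ => (1 : ℝ)) (jackPoly θ N lam) =
      binEval θ (N * θ) N (rowExp N lam) / dualCoef θ N (rowExp N lam) := by
  rw [eq_div_iff (dualCoef_pos hθ (rowExp_antitone N lam)).ne', mul_comm,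
    ← cauchyCoef_eq hθ N lam hl (jackExists hθ N) hl]
  exact ((jackExists hθ N).binEval_eq hθ ⟨lam, hl⟩).symm

theorem alphaSpecialization_jackJ {N : ℕ} {lam : YoungDiagram} (hl : lam.colLen 0 ≤ N) :
    alphaSpecialization θ 1 N (jackJ θ lam) =
      binEval θ (N * θ) N (rowExp N lam) / dualCoef θ N (rowExp N lam) := by
  rw [alphaSpecialization_apply, jackJ_val hθ hl, aeval_one_jackPoly hθ hl]

theorem alphaSpecialization_jackJ_eq_zero {N : ℕ} {lam : YoungDiagram} (hl : N < lam.colLen 0) :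
    alphaSpecialization θ 1 N (jackJ θ lam) = 0 := by
  rw [alphaSpecialization_apply, jackJ_val_eq_zero hθ hl, map_zero]

omit hθ in
-- In a, `binEval` is a polynomial whose degree is the number of boxes and whose leading coefficient
-- is 1/`hookProd`; only this leading term survives.
theorem tendsto_binEval_div {N : ℕ} (μ : Fin N → ℕ) {a : ℕ → ℝ} (c : ℝ)
    (ha : Tendsto (fun n : ℕ => a n / n) atTop (𝓝 c)) :
    Tendsto (fun n : ℕ => binEval θ (a n) N μ / (n : ℝ) ^ (∑ i, μ i)) atTop
      (𝓝 (c ^ (∑ i, μ i) / hookProd θ N μ)) := by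
  have h0 : ∀ n : ℕ, binEval θ (a n) N μ / (n : ℝ) ^ (∑ i, μ i) =
      (∏ i : Fin N, ∏ k ∈ Finset.range (μ i), (a n - (i : ℕ) * θ + k) / n) / hookProd θ N μ := by
    intro n
    rw [binEval, div_right_comm, ← Finset.prod_pow_eq_pow_sum, ← Finset.prod_div_distrib]
    congr 1
    refine Finset.prod_congr rfl fun i _ => ?_
    rw [Finset.prod_div_distrib, Finset.prod_const, Finset.card_range]
  simp only [h0]
  rw [← Finset.prod_pow_eq_pow_sum]
  refine Tendsto.div_const ?_ _
  refine tendsto_finsetProd _ fun i _ => ?_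
  have h1 : c ^ μ i = ∏ k ∈ Finset.range (μ i), c := by rw [Finset.prod_const, Finset.card_range]
  rw [h1]
  refine tendsto_finsetProd _ fun k _ => ?_
  have h2 : Tendsto (fun n : ℕ => (-((i : ℕ) : ℝ) * θ + k) / (n : ℝ)) atTop (𝓝 0) :=
    tendsto_const_div_atTop_nhds_zero_nat _
  have h3 := ha.add h2
  rw [add_zero] at h3
  refine h3.congr fun n => ?_
  rw [← add_div]
  congr 1
  ring

/-- The value is the limit of (s/n)^|λ| J_λ(1^n). Stability under empty rows lets the formulas for n
variables be written with the N fixed rows, so that n enters only through a = nθ. -/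
theorem plancherelSpecialization_jackJ (s : ℝ) {N : ℕ} {lam : YoungDiagram} (hl : lam.colLen 0 ≤ N) :
    plancherelSpecialization θ s (jackJ θ lam) =
      (s * θ) ^ lam.card / hookProd θ N (rowExp N lam) / dualCoef θ N (rowExp N lam) := by
  refine tendsto_nhds_unique (tendsto_plancherelSpecialization θ s (jackJ_isHomogeneous hθ lam)) ?_
  have h1 : Tendsto (fun n : ℕ => (n : ℝ) * θ / n) atTop (𝓝 θ) := by
    refine tendsto_const_nhds.congr' ?_
    filter_upwards [eventually_ge_atTop 1] with n hn
    have : (n : ℝ) ≠ 0 := by positivity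
    field_simp
  have h2 := ((tendsto_binEval_div (θ := θ) (rowExp N lam) θ h1).const_mul (s ^ lam.card)).div_const
    (dualCoef θ N (rowExp N lam))
  have hs : ∑ i, rowExp N lam i = lam.card := (card_eq_sum_rowLen hl).symm
  rw [hs, mul_div_assoc', ← mul_pow] at h2
  refine h2.congr' ?_
  filter_upwards [eventually_ge_atTop N] with n hn
  rw [jackJ_val hθ (hl.trans hn), aeval_one_jackPoly hθ (hl.trans hn),
    stable_of_snocZero (φ := dualCoef θ) (fun N μ => dualCoef_snocZero hθ μ) hl hn,
    stable_of_snocZero (φ := binEval θ (n * θ)) (fun N μ => binEval_snocZero hθ _ μ) hl hn, div_pow]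
  ring

theorem plancherelSpecialization_jackQ (s : ℝ) {N : ℕ} {lam : YoungDiagram} (hl : lam.colLen 0 ≤ N) :
    plancherelSpecialization θ s (jackQ θ lam) = (s * θ) ^ lam.card / hookProd θ N (rowExp N lam) := by
  have h1 := prod_boxFactor_eq hθ N lam hl
  simp only [boxFactor] at h1
  rw [jackQ, map_smul, h1, plancherelSpecialization_jackJ hθ s hl, smul_eq_mul,
    mul_div_cancel₀ _ (dualCoef_pos hθ (rowExp_antitone N lam)).ne']

omit hθ in
theorem jackH_eq (s : ℝ) (N : ℕ) :
    jackH θ (alphaSpecialization θ 1 N) (plancherelSpecialization θ s) = Real.exp (N * (s * θ)) := by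
  rw [jackH, tsum_eq_single 0]
  · rw [alphaSpecialization_powerSum, plancherelSpecialization_powerSum]
    simp only [if_true]
    congr 1
    push_cast
    ring
  · intro j hj
    rw [plancherelSpecialization_powerSum, if_neg hj, mul_zero]

/-- The weight `J_λ(1^N) Q_λ(𝔯_s)` without the power of `s`. -/
def latticeWeight (θ : ℝ) (N : ℕ) (μ : Fin N → ℕ) : ℝ :=
  binEval θ (N * θ) N μ / dualCoef θ N μ / hookProd θ N μ

omit hθ in
theorem latticeWeight_pos (hθ : 0 < θ) {N : ℕ} {μ : Fin N → ℕ} (hμ : Antitone μ) : 0 < latticeWeight θ N μ :=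
  div_pos (div_pos (binEval_pos hθ hμ) (dualCoef_pos hθ hμ)) (hookProd_pos hθ hμ)

theorem jackWeight_eq (s : ℝ) {N : ℕ} {lam : YoungDiagram} (hl : lam.colLen 0 ≤ N) :
    jackWeight θ (alphaSpecialization θ 1 N) (plancherelSpecialization θ s) lam =
      (s * θ) ^ lam.card * Real.exp (-(N * (s * θ))) * latticeWeight θ N (rowExp N lam) := by
  rw [jackWeight, alphaSpecialization_jackJ hθ hl, plancherelSpecialization_jackQ hθ s hl, jackH_eq,
    Real.exp_neg, latticeWeight]
  ring

theorem jackWeight_eq_zero (s : ℝ) {N : ℕ} {lam : YoungDiagram} (hl : N < lam.colLen 0) :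
    jackWeight θ (alphaSpecialization θ 1 N) (plancherelSpecialization θ s) lam = 0 := by
  rw [jackWeight, alphaSpecialization_jackJ_eq_zero hθ hl, zero_mul, zero_div]

/-! ### Normalization -/

/-- The degree n part of ∏ (1 - x_i)^(-a) at x = 1^N is expanded in Jack polynomials, divided by
a^n, and a → ∞ along the integers. In effect this evaluates the Jack expansion of p_1^n / n! at 1^N.
-/
theorem sum_latticeWeight (N n : ℕ) :
    ∑ lam ∈ diagramsOfCard N n, latticeWeight θ N (rowExp N lam.1) = (N : ℝ) ^ n / n.factorial := by
  have h := jackExists hθ N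
  have key : ∀ a : ℝ, ∑ lam ∈ diagramsOfCard N n, binEval θ a N (rowExp N lam.1) *
      aeval (fun _ => (1 : ℝ)) (jackPoly θ N lam.1) = binCoef (N * a) n := by
    intro a
    have h1 := h.eq_sum hθ (f := binSym a N n) (binPoly_isHomogeneous a N n)
    have h2 := congrArg (fun f : symmetricSubalgebra (Fin N) ℝ => aeval (fun _ => (1 : ℝ)) f.1) h1
    simp only [AddSubmonoidClass.coe_finsetSum, SetLike.val_smul, map_sum, map_smul, h.basis_val hθ,
      smul_eq_mul] at h2
    rw [← aeval_one_binPoly]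
    refine Eq.trans ?_ h2.symm
    refine Finset.sum_congr rfl fun lam hl => ?_
    rw [h.repr_binSym hθ a lam (mem_diagramsOfCard.1 hl)]
  have h1 : Tendsto (fun m : ℕ => (m : ℝ) / m) atTop (𝓝 1) := by
    refine tendsto_const_nhds.congr' ?_
    filter_upwards [eventually_ge_atTop 1] with n hn
    have : (n : ℝ) ≠ 0 := by positivity
    field_simp
  have hl : Tendsto (fun m : ℕ => binCoef (N * m) n / (m : ℝ) ^ n) atTop
      (𝓝 (∑ lam ∈ diagramsOfCard N n, latticeWeight θ N (rowExp N lam.1))) := by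
    simp only [← key, Finset.sum_div]
    refine tendsto_finsetSum _ fun lam hl => ?_
    have h2 := (tendsto_binEval_div (θ := θ) (rowExp N lam.1) 1 h1).mul_const
      (aeval (fun _ => (1 : ℝ)) (jackPoly θ N lam.1))
    have hs : ∑ i, rowExp N lam.1 i = n := (card_eq_sum_rowLen lam.2).symm.trans (mem_diagramsOfCard.1 hl)
    rw [hs, one_pow] at h2
    convert h2 using 1
    · funext m; ring
    · rw [latticeWeight, aeval_one_jackPoly hθ lam.2]
      congr 1
      ring
  refine tendsto_nhds_unique hl ?_
  have h0 : ∀ m : ℕ, binCoef (N * m) n / (m : ℝ) ^ n =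
      (∏ i ∈ Finset.range n, ((N : ℝ) * m + i) / m) / n.factorial := by
    intro m
    rw [binCoef, div_right_comm, Finset.prod_div_distrib, Finset.prod_const, Finset.card_range]
  simp only [h0]
  refine Tendsto.div_const ?_ _
  have h2 : (N : ℝ) ^ n = ∏ i ∈ Finset.range n, (N : ℝ) := by rw [Finset.prod_const, Finset.card_range]
  rw [h2]
  refine tendsto_finsetProd _ fun i _ => ?_
  have h3 := (h1.const_mul (N : ℝ)).add (tendsto_const_div_atTop_nhds_zero_nat (i : ℝ))
  rw [mul_one, add_zero] at h3
  refine h3.congr fun m => ?_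
  rw [add_div, mul_div_assoc]

end
end
end JackMeasures

/-! ### The Jack measure as a probability on the integer lattice. -/

namespace JackMeasures
open MvPolynomial
noncomputable section

/-! ### Jack measures as measures on a lattice -/

section

variable {θ : ℝ} (hθ : 0 < θ)

include hθ

theorem jackWeight_nonneg {s : ℝ} (hs : 0 ≤ s) (N : ℕ) (lam : YoungDiagram) :
    0 ≤ jackWeight θ (alphaSpecialization θ 1 N) (plancherelSpecialization θ s) lam := by
  rcases le_or_gt (lam.colLen 0) N with h | h
  · rw [jackWeight_eq hθ s h]
    have := latticeWeight_pos hθ (rowExp_antitone N lam)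
    positivity
  · rw [jackWeight_eq_zero hθ s h]

/-- With τ = sθ, the diagrams with n boxes have total weight e^(-Nτ) (Nτ)^n / n!: the number of
boxes is Poisson distributed. -/
theorem tsum_jackWeight {s : ℝ} (hs : 0 ≤ s) (N : ℕ) :
    ∑' lam, ENNReal.ofReal
      (jackWeight θ (alphaSpecialization θ 1 N) (plancherelSpecialization θ s) lam) = 1 := by
  set w := jackWeight θ (alphaSpecialization θ 1 N) (plancherelSpecialization θ s) with hw
  set τ := s * θ with hτ
  have hτ0 : 0 ≤ τ := mul_nonneg hs hθ.le
  have h1 : ∑' lam : Diagrams N, ENNReal.ofReal (w lam.1) = ∑' lam, ENNReal.ofReal (w lam) := by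
    refine Function.Injective.tsum_eq (f := fun lam => ENNReal.ofReal (w lam)) Subtype.val_injective
      fun lam hl => ?_
    rcases le_or_gt (lam.colLen 0) N with h | h
    · exact ⟨⟨lam, h⟩, rfl⟩
    · exact absurd (by simp only [hw, jackWeight_eq_zero hθ s h, ENNReal.ofReal_zero]) hl
  have h2 : ∀ n : ℕ, ∑' x : {lam : Diagrams N // lam.1.card = n}, ENNReal.ofReal (w x.1.1) =
      ENNReal.ofReal (Real.exp (-(N * τ)) * ((N * τ) ^ n / n.factorial)) := by
    intro n
    have h3 := tsum_subtype {lam : Diagrams N | lam.1.card = n} fun lam => ENNReal.ofReal (w lam.1)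
    refine h3.trans ?_
    have h4 : ∀ lam ∉ diagramsOfCard N n, {lam : Diagrams N | lam.1.card = n}.indicator
        (fun lam => ENNReal.ofReal (w lam.1)) lam = 0 := fun lam hl =>
      Set.indicator_of_notMem (s := {lam : Diagrams N | lam.1.card = n})
        (fun h => hl (mem_diagramsOfCard.2 h)) _
    have h5 : ∀ lam ∈ diagramsOfCard N n, {lam : Diagrams N | lam.1.card = n}.indicator
        (fun lam => ENNReal.ofReal (w lam.1)) lam = ENNReal.ofReal (w lam.1) := fun lam hl =>
      Set.indicator_of_mem (s := {lam : Diagrams N | lam.1.card = n}) (mem_diagramsOfCard.1 hl) _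
    rw [tsum_eq_sum h4, Finset.sum_congr rfl h5,
      ← ENNReal.ofReal_sum_of_nonneg fun lam _ => jackWeight_nonneg hθ hs N lam.1,
      Finset.sum_congr rfl fun lam hl => by
        rw [hw, jackWeight_eq hθ s lam.2, mem_diagramsOfCard.1 hl], ← Finset.mul_sum,
      sum_latticeWeight hθ]
    congr 1
    rw [mul_pow]
    ring
  rw [← h1, ← (Equiv.sigmaFiberEquiv fun lam : Diagrams N => lam.1.card).tsum_eq, ENNReal.tsum_sigma']
  simp only [Equiv.sigmaFiberEquiv_apply]
  rw [tsum_congr h2, ← ENNReal.ofReal_tsum_of_nonneg (fun n => by positivity)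
    ((Real.summable_pow_div_factorial _).mul_left _), tsum_mul_left,
    ← congrFun (NormedSpace.exp_eq_tsum_div (𝔸 := ℝ)) (N * τ), ← Real.exp_eq_exp_ℝ, ← Real.exp_add, neg_add_cancel, Real.exp_zero, ENNReal.ofReal_one]

theorem isProbabilityMeasure_jackMeasure {s : ℝ} (hs : 0 ≤ s) (N : ℕ) :
    IsProbabilityMeasure
      (jackMeasure θ (alphaSpecialization θ 1 N) (plancherelSpecialization θ s)) := by
  refine ⟨?_⟩
  rw [jackMeasure, Measure.sum_apply _ MeasurableSet.univ, ← tsum_jackWeight hθ hs N]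
  exact tsum_congr fun lam => by simp

/-- The row lengths of the diagram with a given increasing vector of rows. -/
def rowsOf {N : ℕ} (m : Fin N → ℤ) (i : Fin N) : ℕ := (m (Fin.rev i)).toNat

/-- The weight of the vector `m` of rows in increasing order, where `τ = s θ`. -/
def latticeDensity (θ : ℝ) (N : ℕ) (τ : ℝ) (m : Fin N → ℤ) : ℝ :=
  if Monotone m ∧ ∀ k, 0 ≤ m k then
    τ ^ (∑ i, rowsOf m i) * Real.exp (-(N * τ)) * latticeWeight θ N (rowsOf m) else 0

omit hθ in
theorem rowsOf_antitone {N : ℕ} {m : Fin N → ℤ} (hm : Monotone m) : Antitone (rowsOf m) :=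
  fun _ _ hij => Int.toNat_le_toNat (hm (Fin.rev_le_rev.2 hij))

omit hθ in
theorem latticeDensity_nonneg (hθ : 0 < θ) {N : ℕ} {τ : ℝ} (hτ : 0 ≤ τ) (m : Fin N → ℤ) :
    0 ≤ latticeDensity θ N τ m := by
  rw [latticeDensity]
  split_ifs with h
  · have := latticeWeight_pos hθ (rowsOf_antitone h.1)
    positivity
  · exact le_rfl

/-- The rows of a diagram in increasing order. -/
def increasingRows (N : ℕ) (lam : YoungDiagram) (k : Fin N) : ℤ := lam.rowLen (Fin.rev k)

omit hθ in
theorem rowsOf_increasingRows (N : ℕ) (lam : YoungDiagram) :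
    rowsOf (increasingRows N lam) = rowExp N lam := by
  funext i
  simp [rowsOf, increasingRows]

theorem latticeDensity_increasingRows (s : ℝ) {N : ℕ} {lam : YoungDiagram} (hl : lam.colLen 0 ≤ N) :
    latticeDensity θ N (s * θ) (increasingRows N lam) =
      jackWeight θ (alphaSpecialization θ 1 N) (plancherelSpecialization θ s) lam := by
  rw [latticeDensity, if_pos, rowsOf_increasingRows, jackWeight_eq hθ s hl, card_eq_sum_rowLen hl]
  · rfl
  · refine ⟨fun i j hij => ?_, fun k => by simp [increasingRows]⟩
    exact Int.ofNat_le.2 (lam.rowLen_anti _ _ (Fin.rev_le_rev.2 hij))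

omit hθ in
theorem exists_increasingRows {N : ℕ} {m : Fin N → ℤ} (h1 : Monotone m) (h2 : ∀ k, 0 ≤ m k) :
    ∃ lam : Diagrams N, increasingRows N lam.1 = m := by
  obtain ⟨lam, hl, hr⟩ := exists_diagram (Finsupp.equivFunOnFinite.symm (rowsOf m)) (rowsOf_antitone h1)
  refine ⟨⟨lam, hl⟩, funext fun k => ?_⟩
  have h3 := DFunLike.congr_fun hr (Fin.rev k)
  simp only [rowExp_apply, Finsupp.equivFunOnFinite_symm_apply_apply, rowsOf, Fin.rev_rev] at h3
  rw [increasingRows, h3, Int.toNat_of_nonneg (h2 k)]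

/-- Sums over diagrams as sums over the lattice. -/
theorem tsum_jackWeight_smul {α : Type*} [AddCommMonoid α] [TopologicalSpace α] (s : ℝ) (N : ℕ)
    (G : ℝ → (Fin N → ℤ) → α) (hG : ∀ m, G 0 m = 0) :
    ∑' lam, G (jackWeight θ (alphaSpecialization θ 1 N) (plancherelSpecialization θ s) lam)
      (increasingRows N lam) = ∑' m, G (latticeDensity θ N (s * θ) m) m := by
  have h1 := Function.Injective.tsum_eq (g := (Subtype.val : Diagrams N → YoungDiagram))
    (f := fun lam => G (jackWeight θ (alphaSpecialization θ 1 N) (plancherelSpecialization θ s) lam)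
      (increasingRows N lam)) Subtype.val_injective (fun lam hl => by
    rcases le_or_gt (lam.colLen 0) N with h | h
    · exact ⟨⟨lam, h⟩, rfl⟩
    · exact absurd (by simp only [jackWeight_eq_zero hθ s h, hG]) hl)
  have h2 := Function.Injective.tsum_eq (g := fun lam : Diagrams N => increasingRows N lam.1)
    (f := fun m => G (latticeDensity θ N (s * θ) m) m) (fun lam mu hlm => by
      refine Subtype.ext (rowExp_injective lam.2 mu.2 (DFunLike.coe_injective ?_))
      rw [← rowsOf_increasingRows, ← rowsOf_increasingRows]
      exact congrArg rowsOf hlm) (fun m hm => by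
    by_cases h : Monotone m ∧ ∀ k, 0 ≤ m k
    · exact exists_increasingRows h.1 h.2
    · exact absurd (by simp only [latticeDensity, if_neg h, hG]) hm)
  rw [← h1, ← h2]
  exact tsum_congr fun lam => by rw [latticeDensity_increasingRows hθ s lam.2]

theorem summable_latticeDensity {s : ℝ} (hs : 0 ≤ s) (N : ℕ) :
    Summable (latticeDensity θ N (s * θ)) := by
  have h := tsum_jackWeight_smul hθ s N (fun w _ => ENNReal.ofReal w) (fun _ => ENNReal.ofReal_zero)
  rw [tsum_jackWeight hθ hs] at h
  have h1 := ENNReal.summable_toReal (f := fun m => ENNReal.ofReal (latticeDensity θ N (s * θ) m))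
    (by rw [← h]; exact ENNReal.one_ne_top)
  refine h1.congr fun m => ENNReal.toReal_ofReal (latticeDensity_nonneg hθ (mul_nonneg hs hθ.le) m)

theorem integral_jackMeasure {s : ℝ} (hs : 0 ≤ s) {N : ℕ} {f : (Fin N → ℝ) → ℝ} (hf : Continuous f)
    {M : ℝ} (hM : ∀ y, ‖f y‖ ≤ M) (t ε : ℝ) :
    ∫ y, f y ∂(Measure.map (rescaledRows N t ε)
      (jackMeasure θ (alphaSpecialization θ 1 N) (plancherelSpecialization θ s))) =
    ∑' m : Fin N → ℤ, latticeDensity θ N (s * θ) m * f fun k => Real.sqrt ε * ((m k : ℝ) - t / ε) := by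
  have : MeasurableSingletonClass YoungDiagram := ⟨fun _ => trivial⟩
  have hmeas : ∀ {β : Type} [MeasurableSpace β] (g : YoungDiagram → β), Measurable g :=
    fun g _ _ => trivial
  have hp := isProbabilityMeasure_jackMeasure hθ hs N
  rw [integral_map (hmeas _).aemeasurable hf.aestronglyMeasurable]
  have hint : Integrable (fun lam => f (rescaledRows N t ε lam))
      (jackMeasure θ (alphaSpecialization θ 1 N) (plancherelSpecialization θ s)) :=
    Integrable.of_bound (hmeas _).aestronglyMeasurable M (Eventually.of_forall fun lam => hM _)
  rw [jackMeasure] at hint ⊢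
  rw [integral_sum_measure hint]
  have h1 : ∀ lam, ∫ a, f (rescaledRows N t ε a) ∂(ENNReal.ofReal
      (jackWeight θ (alphaSpecialization θ 1 N) (plancherelSpecialization θ s) lam) •
        Measure.dirac lam) = jackWeight θ (alphaSpecialization θ 1 N) (plancherelSpecialization θ s) lam *
        f fun k => Real.sqrt ε * ((increasingRows N lam k : ℝ) - t / ε) := by
    intro lam
    rw [integral_smul_measure, integral_dirac, ENNReal.toReal_ofReal (jackWeight_nonneg hθ hs N lam),
      smul_eq_mul]
    rfl
  rw [tsum_congr h1]
  exact tsum_jackWeight_smul hθ s N (fun w m => w * f fun k => Real.sqrt ε * ((m k : ℝ) - t / ε))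
    (fun _ => zero_mul _)

end

/-! ### Lattice sums as integrals -/

/-- The point of the lattice below `y`. -/
def cellIndex {N : ℕ} (h τ : ℝ) (y : Fin N → ℝ) (k : Fin N) : ℤ := ⌊τ + y k / h⌋

theorem measurable_cellIndex {N : ℕ} (h τ : ℝ) :
    Measurable (cellIndex h τ : (Fin N → ℝ) → Fin N → ℤ) := by
  refine measurable_pi_lambda _ fun k => Int.measurable_floor.comp ?_
  have h1 : Measurable fun y : Fin N → ℝ => y k := measurable_pi_apply k
  exact measurable_const.add (h1.div_const h)

/-- Every fibre is a half-open cube of side h. -/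
theorem map_cellIndex {N : ℕ} {h : ℝ} (hh : 0 < h) (τ : ℝ) :
    Measure.map (cellIndex h τ) (volume : Measure (Fin N → ℝ)) =
      ENNReal.ofReal (h ^ N) • Measure.count := by
  refine Measure.ext_of_singleton fun m => ?_
  rw [Measure.map_apply (measurable_cellIndex h τ) (MeasurableSet.singleton m), Measure.smul_apply,
    Measure.count_singleton, smul_eq_mul, mul_one]
  have h1 : cellIndex h τ ⁻¹' {m} = Set.pi Set.univ fun k : Fin N =>
      Set.Ico (h * ((m k : ℝ) - τ)) (h * ((m k : ℝ) - τ) + h) := by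
    ext y
    simp only [Set.mem_preimage, Set.mem_singleton_iff, Set.mem_pi, Set.mem_univ, true_imp_iff,
      Set.mem_Ico, funext_iff, cellIndex]
    refine forall_congr' fun k => ?_
    rw [Int.floor_eq_iff]
    have h2 : y k = h * (y k / h) := by field_simp
    constructor
    · rintro ⟨h3, h4⟩
      rw [h2]
      constructor <;> nlinarith
    · rintro ⟨h3, h4⟩
      rw [h2] at h3 h4
      have h5 : (m k : ℝ) - τ ≤ y k / h := le_of_mul_le_mul_left h3 hh
      have h6 : y k / h < (m k : ℝ) - τ + 1 := lt_of_mul_lt_mul_left (by linarith) hh.le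
      constructor <;> linarith
  rw [h1, Real.volume_pi_Ico]
  simp [ENNReal.ofReal_pow hh.le]

/-- A lattice sum becomes an integral over a fixed space, to which dominated convergence applies as
the mesh tends to zero. -/
theorem integral_cellIndex {N : ℕ} {h : ℝ} (hh : 0 < h) (τ : ℝ) {G : (Fin N → ℤ) → ℝ} (hG : Summable G) :
    ∫ y : Fin N → ℝ, G (cellIndex h τ y) = h ^ N * ∑' m, G m := by
  have hm : AEStronglyMeasurable G (Measure.map (cellIndex h τ) (volume : Measure (Fin N → ℝ))) :=
    (measurable_of_countable G).aestronglyMeasurable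
  rw [← integral_map (measurable_cellIndex h τ).aemeasurable hm, map_cellIndex hh, integral_smul_measure,
    ENNReal.toReal_ofReal (by positivity), smul_eq_mul]
  congr 1
  have hi : Integrable G (Measure.count : Measure (Fin N → ℤ)) := integrable_count_iff.2 hG.norm
  rw [Measure.count] at hi ⊢
  rw [integral_sum_measure hi]
  exact tsum_congr fun m => integral_dirac _ _

end
end JackMeasures

/-! ### Asymptotics and uniform bounds for the weights. -/

namespace JackMeasures
open MvPolynomial
noncomputable section

/-! ### Asymptotics of Gamma functions -/

theorem exists_bounds_of_tendsto {f : ℕ → ℝ} (hf : ∀ n, 0 < f n) {l : ℝ} (hl : 0 < l)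
    (h : Tendsto f atTop (𝓝 l)) : ∃ a b : ℝ, 0 < a ∧ 0 < b ∧ ∀ n, a ≤ f n ∧ f n ≤ b := by
  obtain ⟨b, hb⟩ := h.bddAbove_range
  obtain ⟨a, ha⟩ := (h.inv₀ hl.ne').bddAbove_range
  have hb' : ∀ n, f n ≤ b := fun n => hb ⟨n, rfl⟩
  have ha' : ∀ n, (f n)⁻¹ ≤ a := fun n => ha ⟨n, rfl⟩
  have ha0 : 0 < a := (inv_pos.2 (hf 0)).trans_le (ha' 0)
  exact ⟨a⁻¹, b, inv_pos.2 ha0, (hf 0).trans_le (hb' 0), fun n =>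
    ⟨(inv_le_comm₀ (hf n) ha0).1 (ha' n), hb' n⟩⟩

/-- The ratio of `Γ(k + 1 + s)` and `k! (k + 1) ^ s`. -/
def gammaRatio (s : ℝ) (k : ℕ) : ℝ := Real.Gamma (k + 1 + s) / (k.factorial * ((k : ℝ) + 1) ^ s)

theorem gammaRatio_pos {s : ℝ} (hs : 0 ≤ s) (k : ℕ) : 0 < gammaRatio s k := by
  have h1 : (0 : ℝ) < k + 1 := by positivity
  have h2 : (0 : ℝ) < k.factorial := by exact_mod_cast k.factorial_pos
  exact div_pos (Real.Gamma_pos_of_pos (by positivity)) (mul_pos h2 (Real.rpow_pos_of_pos h1 s))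

theorem gamma_eq_gammaRatio (s : ℝ) (k : ℕ) :
    Real.Gamma (k + 1 + s) = gammaRatio s k * (k.factorial * ((k : ℝ) + 1) ^ s) := by
  have h1 : (0 : ℝ) < k + 1 := by positivity
  have h2 : (0 : ℝ) < k.factorial := by exact_mod_cast k.factorial_pos
  rw [gammaRatio, div_mul_cancel₀]
  exact (mul_pos h2 (Real.rpow_pos_of_pos h1 s)).ne'

theorem prod_range_add_eq_gamma {s : ℝ} (hs : 0 < s) (n : ℕ) :
    Real.Gamma s * ∏ j ∈ Finset.range n, (s + j) = Real.Gamma (s + n) := by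
  induction n with
  | zero => simp
  | succ n ih =>
    rw [Finset.prod_range_succ, ← mul_assoc, ih, mul_comm, ← Real.Gamma_add_one (by positivity)]
    push_cast
    ring_nf

/-- Gauss's limit formula for Γ. Using (k + 1)^s in place of k^s keeps the ratio positive at k = 0,
so that convergence gives two-sided bounds for every k. -/
theorem tendsto_gammaRatio {s : ℝ} (hs : 0 ≤ s) : Tendsto (gammaRatio s) atTop (𝓝 1) := by
  rcases hs.eq_or_lt with rfl | hs
  · refine tendsto_const_nhds.congr fun k => ?_
    have h2 : (k.factorial : ℝ) ≠ 0 := by exact_mod_cast k.factorial_ne_zero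
    rw [gammaRatio, add_zero, Real.Gamma_nat_eq_factorial, Real.rpow_zero, mul_one, div_self h2]
  · have h0 := (Real.Gamma_pos_of_pos hs).ne'
    have h1 : Tendsto (fun n : ℕ => ((n : ℝ) / (n + 1)) ^ s) atTop (𝓝 1) := by
      have := (tendsto_natCast_div_add_atTop (1 : ℝ)).rpow_const (p := s) (Or.inr hs.le)
      rwa [Real.one_rpow] at this
    have h2 := ((Real.GammaSeq_tendsto_Gamma s).inv₀ h0).const_mul (Real.Gamma s)
    rw [mul_inv_cancel₀ h0] at h2
    have h3 := h2.mul h1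
    rw [one_mul] at h3
    refine h3.congr' ?_
    filter_upwards [eventually_ge_atTop 1] with n hn
    have hn0 : (0 : ℝ) < n := by positivity
    have hp := prod_range_add_eq_gamma hs (n + 1)
    have hn1 : (0 : ℝ) < n + 1 := by positivity
    have hP : ∏ j ∈ Finset.range (n + 1), (s + (j : ℕ)) ≠ 0 :=
      (Finset.prod_pos fun j _ => by positivity).ne'
    have hf : (n.factorial : ℝ) ≠ 0 := by exact_mod_cast n.factorial_ne_zero
    have hr := (Real.rpow_pos_of_pos hn0 s).ne'
    have hr1 := (Real.rpow_pos_of_pos hn1 s).ne'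
    have e : (n : ℝ) + 1 + s = s + (n + 1 : ℕ) := by push_cast; ring
    rw [gammaRatio, e, ← hp, Real.GammaSeq, Real.div_rpow hn0.le hn1.le]
    field_simp

theorem exists_gammaRatio_bounds {s : ℝ} (hs : 0 ≤ s) :
    ∃ a b : ℝ, 0 < a ∧ 0 < b ∧ ∀ n, a ≤ gammaRatio s n ∧ gammaRatio s n ≤ b :=
  exists_bounds_of_tendsto (gammaRatio_pos hs) one_pos (tendsto_gammaRatio hs)

/-- The ratio of `m!` and `√(m + 1) (m / e) ^ m`. -/
def stirlingRatio (m : ℕ) : ℝ := m.factorial / (Real.sqrt (m + 1) * (m / Real.exp 1) ^ m)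

theorem pow_div_exp_pos (m : ℕ) : 0 < ((m : ℝ) / Real.exp 1) ^ m := by
  rcases m with _ | m
  · simp
  · positivity

theorem stirlingRatio_pos (m : ℕ) : 0 < stirlingRatio m := by
  have h1 := pow_div_exp_pos m
  have h2 : (0 : ℝ) < m.factorial := by exact_mod_cast m.factorial_pos
  unfold stirlingRatio
  positivity

theorem tendsto_stirlingRatio : Tendsto stirlingRatio atTop (𝓝 (Real.sqrt (2 * Real.pi))) := by
  have h1 : Tendsto (fun n : ℕ => Real.sqrt (2 * ((n : ℝ) / (n + 1)))) atTop (𝓝 (Real.sqrt (2 * 1))) :=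
    ((tendsto_natCast_div_add_atTop (1 : ℝ)).const_mul 2).sqrt
  have h2 := Stirling.tendsto_stirlingSeq_sqrt_pi.mul h1
  rw [mul_one, mul_comm, ← Real.sqrt_mul (by norm_num)] at h2
  refine h2.congr' ?_
  filter_upwards [eventually_ge_atTop 1] with n hn
  have hn0 : (0 : ℝ) < n := by positivity
  have h3 := (pow_div_exp_pos n).ne'
  have h4 : Real.sqrt (2 * ((n : ℝ) / (n + 1))) = Real.sqrt (2 * n) / Real.sqrt (n + 1) := by
    rw [← Real.sqrt_div (by positivity)]
    congr 1
    ring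
  have h5 : Real.sqrt (2 * (n : ℝ)) ≠ 0 := (Real.sqrt_pos.2 (by positivity)).ne'
  have h6 : Real.sqrt ((n : ℝ) + 1) ≠ 0 := (Real.sqrt_pos.2 (by positivity)).ne'
  rw [stirlingRatio, Stirling.stirlingSeq, h4]
  field_simp

/-! ### The weight of one row -/

/-- The exponent `m log (m / τ) - m + τ`. -/
def rateFunction (τ m : ℝ) : ℝ := m * Real.log (m / τ) - m + τ

theorem pow_mul_exp_neg {τ : ℝ} (hτ : 0 < τ) (m : ℕ) :
    τ ^ m * Real.exp (-τ) = Real.exp (-rateFunction τ m) * (m / Real.exp 1) ^ m := by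
  rcases Nat.eq_zero_or_pos m with rfl | hm
  · simp [rateFunction]
  · have hm' : (0 : ℝ) < m := by exact_mod_cast hm
    have h1 : ∀ x : ℝ, 0 < x → x ^ m = Real.exp (m * Real.log x) := fun x hx => by
      rw [mul_comm, Real.exp_mul, Real.exp_log hx, Real.rpow_natCast]
    rw [h1 τ hτ, h1 _ (div_pos hm' (Real.exp_pos 1)), ← Real.exp_add, ← Real.exp_add, rateFunction,
      Real.log_div hm'.ne' (Real.exp_pos 1).ne', Real.log_exp, Real.log_div hm'.ne' hτ.ne']
    congr 1
    ring

/-- The inequality log x ≥ 1 - 1/x at x = √(m/τ) gives log (m/τ) ≥ 2 - 2√(τ/m). It covers both tails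
at once. -/
theorem sq_le_rateFunction {τ m : ℝ} (hτ : 0 < τ) (hm : 0 ≤ m) :
    (Real.sqrt m - Real.sqrt τ) ^ 2 ≤ rateFunction τ m := by
  rcases hm.eq_or_lt with rfl | hm
  · simp [rateFunction, Real.sq_sqrt hτ.le]
  · have h1 := Real.one_sub_inv_le_log_of_pos (Real.sqrt_pos.2 (div_pos hm hτ))
    rw [Real.log_sqrt (div_pos hm hτ).le, Real.sqrt_div hm.le, inv_div] at h1
    have h2 := Real.sq_sqrt hm.le
    have h3 := Real.sq_sqrt hτ.le
    have h4 := Real.sqrt_pos.2 hm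
    have h5 : m * (Real.sqrt τ / Real.sqrt m) = Real.sqrt m * Real.sqrt τ := by
      nth_rewrite 1 [← h2]
      field_simp
    have h6 := mul_le_mul_of_nonneg_left h1 hm.le
    rw [mul_sub, h5] at h6
    unfold rateFunction
    nlinarith

/-- The weight of a row of length `m`, in terms of `τ`. -/
def rowWeight (c τ : ℝ) (m : ℕ) : ℝ :=
  Real.sqrt τ * (τ ^ m * τ ^ c * Real.exp (-τ)) / Real.Gamma (m + c + 1)

/-- Separates the exponential rate from a prefactor that tends to 1/√(2π) near m = τ. -/
theorem rowWeight_eq (c : ℝ) {τ : ℝ} (hτ : 0 < τ) (m : ℕ) :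
    rowWeight c τ m = (τ / (m + 1)) ^ ((1 / 2 : ℝ) + c) / (stirlingRatio m * gammaRatio c m) *
      Real.exp (-rateFunction τ m) := by
  have hm : (0 : ℝ) < (m : ℝ) + 1 := by positivity
  have h1 : (m.factorial : ℝ) = stirlingRatio m * (Real.sqrt (m + 1) * (m / Real.exp 1) ^ m) := by
    rw [stirlingRatio, div_mul_cancel₀]
    have := pow_div_exp_pos m
    positivity
  have e : (m : ℝ) + c + 1 = m + 1 + c := by ring
  have h2 := (pow_div_exp_pos m).ne'
  have h3 := (stirlingRatio_pos m).ne'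
  have h4 := (Real.sqrt_pos.2 hm).ne'
  have h5 := (Real.rpow_pos_of_pos hm c).ne'
  have h6 : (τ / (m + 1)) ^ ((1 / 2 : ℝ) + c) = Real.sqrt τ * τ ^ c / (Real.sqrt (m + 1) * ((m : ℝ) + 1) ^ c) := by
    rw [Real.div_rpow hτ.le hm.le, Real.rpow_add hτ, Real.rpow_add hm, ← Real.sqrt_eq_rpow,
      ← Real.sqrt_eq_rpow]
  rw [rowWeight, e, gamma_eq_gammaRatio, mul_right_comm (τ ^ m), pow_mul_exp_neg hτ, h1, h6]
  by_cases h7 : gammaRatio c m = 0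
  · simp [h7]
  · field_simp

theorem rpow_le_mul_exp {K : ℝ} {δ : ℝ} (hδ : 0 < δ) :
    ∃ C : ℝ, 0 < C ∧ ∀ x : ℝ, 0 ≤ x → (1 + x) ^ K ≤ C * Real.exp (δ * x) := by
  obtain ⟨n, hn⟩ := exists_nat_ge K
  have hf : (0 : ℝ) < n.factorial := by exact_mod_cast n.factorial_pos
  refine ⟨n.factorial / δ ^ n * Real.exp δ, by positivity, fun x hx => ?_⟩
  have h1 : (1 + x) ^ K ≤ (1 + x) ^ n := by
    rw [← Real.rpow_natCast]
    exact Real.rpow_le_rpow_of_exponent_le (by linarith) hn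
  have h2 := Real.pow_div_factorial_le_exp (δ * (1 + x)) (by positivity) n
  refine h1.trans ?_
  rw [mul_assoc, ← Real.exp_add, (by ring : δ + δ * x = δ * (1 + x)), div_mul_eq_mul_div,
    le_div_iff₀ (by positivity)]
  rw [div_le_iff₀ hf, mul_pow] at h2
  linarith

theorem rowWeight_nonneg {c : ℝ} (hc : 0 ≤ c) {τ : ℝ} (hτ : 0 < τ) (m : ℕ) : 0 ≤ rowWeight c τ m := by
  have := Real.Gamma_pos_of_pos (show 0 < (m : ℝ) + c + 1 by positivity)
  have := Real.rpow_pos_of_pos hτ c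
  unfold rowWeight
  positivity

/-- Put v = |√m - √τ|. The exponential is at most e^(-v²), the power in the prefactor at most C e^v,
and |m - τ|/√τ ≤ 2v² + 1 for τ ≥ 1. The constants fit because v - v² ≤ 1 - (2v² + 1)/4. -/
theorem exists_rowWeight_le {c : ℝ} (hc : 0 ≤ c) :
    ∃ C : ℝ, 0 < C ∧ ∀ τ : ℝ, 1 ≤ τ → ∀ m : ℕ,
      rowWeight c τ m ≤ C * Real.exp (-(|((m : ℝ) - τ) / Real.sqrt τ| / 4)) := by
  obtain ⟨a₁, _, ha₁, -, h₁⟩ := exists_gammaRatio_bounds hc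
  obtain ⟨a₂, _, ha₂, -, h₂⟩ := exists_bounds_of_tendsto stirlingRatio_pos
    (Real.sqrt_pos.2 (by positivity)) tendsto_stirlingRatio
  obtain ⟨C, hC, h₃⟩ := rpow_le_mul_exp (K := 1 + 2 * c) one_pos
  refine ⟨C / (a₂ * a₁) * Real.exp 1, by positivity, fun τ hτ m => ?_⟩
  have hτ0 : 0 < τ := by linarith
  have hm : (0 : ℝ) < (m : ℝ) + 1 := by positivity
  have hm0 : (0 : ℝ) ≤ m := by positivity
  set v := |Real.sqrt m - Real.sqrt τ| with hv
  have hv0 : 0 ≤ v := abs_nonneg _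
  have hv2 : v ^ 2 = (Real.sqrt m - Real.sqrt τ) ^ 2 := sq_abs _
  have hτ1 : 1 ≤ Real.sqrt τ := Real.one_le_sqrt.2 hτ
  have hsm := Real.sqrt_nonneg (m : ℝ)
  have e1 : (τ / (m + 1)) ^ ((1 / 2 : ℝ) + c) ≤ C * Real.exp v := by
    -- √τ ≤ √m + v ≤ √(m+1) (1 + v), as √(m+1) ≥ 1.
    have h4 : Real.sqrt (τ / (m + 1)) ≤ 1 + v := by
      rw [Real.sqrt_div hτ0.le, div_le_iff₀ (Real.sqrt_pos.2 hm)]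
      have h5 : Real.sqrt m ≤ Real.sqrt (m + 1) := Real.sqrt_le_sqrt (by linarith)
      have h6 : 1 ≤ Real.sqrt ((m : ℝ) + 1) := Real.one_le_sqrt.2 (by linarith)
      have h7 := neg_abs_le (Real.sqrt m - Real.sqrt τ)
      nlinarith
    have h5 : (τ / (m + 1)) ^ ((1 / 2 : ℝ) + c) = Real.sqrt (τ / (m + 1)) ^ (1 + 2 * c) := by
      rw [Real.sqrt_eq_rpow, ← Real.rpow_mul (by positivity)]
      congr 1
      ring
    rw [h5]
    have := h₃ v hv0
    rw [one_mul] at this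
    exact (Real.rpow_le_rpow (Real.sqrt_nonneg _) h4 (by linarith)).trans this
  have e2 : Real.exp (-rateFunction τ m) ≤ Real.exp (-v ^ 2) := by
    rw [hv2]
    exact Real.exp_le_exp.2 (neg_le_neg (sq_le_rateFunction hτ0 hm0))
  have e3 : |((m : ℝ) - τ) / Real.sqrt τ| ≤ 2 * v ^ 2 + 1 := by
    have h4 : (m : ℝ) - τ = (Real.sqrt m - Real.sqrt τ) * (Real.sqrt m + Real.sqrt τ) := by
      have h5 := Real.sq_sqrt hm0
      have h6 := Real.sq_sqrt hτ0.le
      nlinarith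
    rw [abs_div, abs_of_pos (by linarith : 0 < Real.sqrt τ), div_le_iff₀ (by linarith), h4, abs_mul,
      abs_of_nonneg (by linarith : 0 ≤ Real.sqrt m + Real.sqrt τ)]
    have h7 : Real.sqrt m ≤ Real.sqrt τ + v := by
      have := le_abs_self (Real.sqrt m - Real.sqrt τ)
      linarith
    have h8 : v * (Real.sqrt m + Real.sqrt τ) ≤ v * (2 * Real.sqrt τ + v) :=
      mul_le_mul_of_nonneg_left (by linarith) hv0
    nlinarith [mul_nonneg (sq_nonneg (v - 1)) (by linarith : 0 ≤ Real.sqrt τ),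
      mul_nonneg (sq_nonneg v) (by linarith : 0 ≤ Real.sqrt τ - 1)]
  rw [rowWeight_eq c hτ0]
  have e4 : (τ / (m + 1)) ^ ((1 / 2 : ℝ) + c) / (stirlingRatio m * gammaRatio c m) ≤
      C * Real.exp v / (a₂ * a₁) :=
    div_le_div₀ (by positivity) e1 (by positivity)
      (mul_le_mul (h₂ m).1 (h₁ m).1 ha₁.le (stirlingRatio_pos m).le)
  refine (mul_le_mul e4 e2 (Real.exp_pos _).le (by positivity)).trans ?_
  have e5 : C * Real.exp v / (a₂ * a₁) * Real.exp (-v ^ 2) =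
      C / (a₂ * a₁) * Real.exp (v - v ^ 2) := by
    rw [sub_eq_add_neg, Real.exp_add]
    ring
  rw [e5, mul_assoc, ← Real.exp_add]
  refine mul_le_mul_of_nonneg_left (Real.exp_le_exp.2 ?_) (by positivity)
  nlinarith [sq_nonneg (v - 1)]

/-- One application of l'Hôpital's rule leaves half the slope of the logarithm at 1. -/
theorem tendsto_rateFunction_quotient :
    Tendsto (fun x : ℝ => (x * Real.log x - x + 1) / (x - 1) ^ 2) (𝓝[≠] 1) (𝓝 (1 / 2)) := by
  refine HasDerivAt.lhopital_zero_nhdsNE (f' := Real.log) (g' := fun x => 2 * (x - 1)) ?_ ?_ ?_ ?_ ?_ ?_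
  · have : ∀ᶠ x : ℝ in 𝓝[≠] 1, x ≠ 0 := eventually_nhdsWithin_of_eventually_nhds
      (eventually_ne_nhds one_ne_zero)
    filter_upwards [this] with x hx
    have h := (((hasDerivAt_id x).mul (Real.hasDerivAt_log hx)).sub (hasDerivAt_id x)).add_const 1
    refine h.congr_deriv ?_
    simp [hx]
  · refine Eventually.of_forall fun x => ?_
    have h := ((hasDerivAt_id x).sub_const 1).pow 2
    refine h.congr_deriv ?_
    simp
  · filter_upwards [self_mem_nhdsWithin] with x hx
    exact mul_ne_zero two_ne_zero (sub_ne_zero.2 hx)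
  · have : ContinuousAt (fun x : ℝ => x * Real.log x - x + 1) 1 := by
      fun_prop (disch := norm_num)
    have := this.tendsto
    norm_num at this
    exact this.mono_left nhdsWithin_le_nhds
  · have : ContinuousAt (fun x : ℝ => (x - 1) ^ 2) 1 := by fun_prop
    have := this.tendsto
    norm_num at this
    exact this.mono_left nhdsWithin_le_nhds
  · have h := (Real.hasDerivAt_log (one_ne_zero)).tendsto_slope
    rw [inv_one] at h
    have h2 := h.const_mul (1 / 2)
    rw [mul_one] at h2
    refine h2.congr' ?_
    filter_upwards [self_mem_nhdsWithin] with x hx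
    have : x - 1 ≠ 0 := sub_ne_zero.2 hx
    rw [slope_def_field, Real.log_one, sub_zero]
    field_simp

section Limits

variable {ι : Type*} {l : Filter ι} {τ : ι → ℝ}

theorem tendsto_div_sqrt {u : ℝ} (hτ : Tendsto τ l atTop) {m : ι → ℝ}
    (hm : Tendsto (fun x => (m x - τ x) / Real.sqrt (τ x)) l (𝓝 u)) :
    Tendsto (fun x => m x / τ x) l (𝓝 1) := by
  have h1 : Tendsto (fun x => Real.sqrt (τ x)) l atTop := Real.tendsto_sqrt_atTop.comp hτ
  have h2 := (hm.div_atTop h1).add_const 1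
  rw [zero_add] at h2
  refine h2.congr' ?_
  filter_upwards [hτ.eventually_gt_atTop 0] with x hx
  rw [div_div, Real.mul_self_sqrt hx.le]
  field_simp
  ring

/-- With x = m/τ, the rate is the square of (m - τ)/√τ times (x log x - x + 1)/(x - 1)², and x → 1.
-/
theorem tendsto_rateFunction {u : ℝ} (hτ : Tendsto τ l atTop) {m : ι → ℝ}
    (hm : Tendsto (fun x => (m x - τ x) / Real.sqrt (τ x)) l (𝓝 u)) :
    Tendsto (fun x => rateFunction (τ x) (m x)) l (𝓝 (u ^ 2 / 2)) := by
  -- The quotient is completed by its limit at 1, because m = τ may occur along the filter.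
  let q : ℝ → ℝ := Function.update (fun x : ℝ => (x * Real.log x - x + 1) / (x - 1) ^ 2) 1 (1 / 2)
  have hq : ContinuousAt q 1 := continuousAt_update_same.2 tendsto_rateFunction_quotient
  have h1 := hq.tendsto.comp (tendsto_div_sqrt hτ hm)
  have h2 := (hm.pow 2).mul h1
  have h3 : q 1 = 1 / 2 := Function.update_self _ _ _
  rw [h3, mul_one_div] at h2
  refine h2.congr' ?_
  filter_upwards [hτ.eventually_gt_atTop 0] with x hx
  simp only [Function.comp_apply]
  rw [div_pow, Real.sq_sqrt hx.le, rateFunction]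
  by_cases h4 : m x / τ x = 1
  · rw [h4, h3, Real.log_one]
    have : m x = τ x := by rwa [div_eq_one_iff_eq hx.ne'] at h4
    rw [this]
    ring
  · have h5 : q (m x / τ x) = _ := Function.update_of_ne h4 _ _
    have h6 : m x - τ x ≠ 0 := fun h => h4 (by rw [div_eq_one_iff_eq hx.ne']; linarith)
    rw [h5]
    have h7 : m x / τ x - 1 = (m x - τ x) / τ x := by field_simp
    rw [h7]
    field_simp

theorem tendsto_atTop_of_div {u : ℝ} (hτ : Tendsto τ l atTop) {m : ι → ℕ}
    (hm : Tendsto (fun x => ((m x : ℝ) - τ x) / Real.sqrt (τ x)) l (𝓝 u)) : Tendsto m l atTop := by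
  rw [← tendsto_natCast_atTop_iff (R := ℝ)]
  have h1 := (tendsto_div_sqrt hτ hm).pos_mul_atTop one_pos hτ
  refine h1.congr' ?_
  filter_upwards [hτ.eventually_gt_atTop 0] with x hx
  rw [div_mul_cancel₀ _ hx.ne']

theorem tendsto_rowWeight {c : ℝ} (hc : 0 ≤ c) {u : ℝ} (hτ : Tendsto τ l atTop) {m : ι → ℕ}
    (hm : Tendsto (fun x => ((m x : ℝ) - τ x) / Real.sqrt (τ x)) l (𝓝 u)) :
    Tendsto (fun x => rowWeight c (τ x) (m x)) l
      (𝓝 (1 / Real.sqrt (2 * Real.pi) * Real.exp (-(u ^ 2 / 2)))) := by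
  have h0 := tendsto_atTop_of_div hτ hm
  have h1 := (tendsto_gammaRatio hc).comp h0
  have h2 := tendsto_stirlingRatio.comp h0
  have h3 := (Real.continuous_exp.tendsto _).comp (tendsto_rateFunction hτ hm).neg
  have h4 : Tendsto (fun x => τ x / ((m x : ℝ) + 1)) l (𝓝 1) := by
    have h5 := (tendsto_div_sqrt hτ hm).add (tendsto_const_nhds (x := (1 : ℝ)).div_atTop hτ)
    rw [add_zero] at h5
    have h6 := h5.inv₀ one_ne_zero
    rw [inv_one] at h6
    refine h6.congr fun x => ?_
    rw [← add_div, inv_div]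
  have h5 := h4.rpow_const (p := (1 / 2 : ℝ) + c) (Or.inl one_ne_zero)
  rw [Real.one_rpow] at h5
  have hs : Real.sqrt (2 * Real.pi) * 1 ≠ 0 := by
    rw [mul_one]
    exact (Real.sqrt_pos.2 (by positivity)).ne'
  have h6 := (h5.div (h2.mul h1) hs).mul h3
  rw [mul_one] at h6
  refine h6.congr' ?_
  filter_upwards [hτ.eventually_gt_atTop 0] with x hx
  rw [rowWeight_eq c hx]
  rfl

/-! ### The interaction of two rows -/

/-- The factor `Γ(d + θ) Γ(d + 1) / (Γ(d) Γ(d + 1 - θ))`. -/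
def pairFactor (θ d : ℝ) : ℝ :=
  Real.Gamma (d + θ) * Real.Gamma (d + 1) / (Real.Gamma d * Real.Gamma (d + 1 - θ))

/-- Two shifted rows differ by an integer k plus c = (j - i)θ ≥ θ. Rewriting the Gamma functions at
k + 1 + s with s = c ± θ ≥ 0 brings in `gammaRatio`; the powers of k + 1 combine to exponent 2θ. -/
theorem pairFactor_eq {θ c : ℝ} (hθ : 0 < θ) (hc : θ ≤ c) (k : ℕ) :
    pairFactor θ (k + c) = ((k : ℝ) + 1) ^ (2 * θ) *
      (gammaRatio (c + θ) k / gammaRatio (c - θ) k * ((k + c) / (k + c + θ))) := by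
  have hk : (0 : ℝ) ≤ k := by positivity
  have hk1 : (0 : ℝ) < k + 1 := by positivity
  have hd : (0 : ℝ) < k + c := by linarith
  have g1 : Real.Gamma (k + 1 + (c + θ)) = (k + c + θ) * Real.Gamma (k + c + θ) := by
    rw [← Real.Gamma_add_one (by linarith)]
    congr 1
    ring
  have g2 : Real.Gamma ((k : ℝ) + c + 1) = (k + c) * Real.Gamma (k + c) := Real.Gamma_add_one hd.ne'
  have g3 : Real.Gamma ((k : ℝ) + c + 1 - θ) = Real.Gamma (k + 1 + (c - θ)) := by
    congr 1
    ring
  have g4 : Real.Gamma ((k : ℝ) + c) ≠ 0 := (Real.Gamma_pos_of_pos hd).ne'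
  have g5 : Real.Gamma ((k : ℝ) + c + θ) ≠ 0 := (Real.Gamma_pos_of_pos (by linarith)).ne'
  have g6 : Real.Gamma ((k : ℝ) + 1 + (c - θ)) ≠ 0 := (Real.Gamma_pos_of_pos (by linarith)).ne'
  have hf : (k.factorial : ℝ) ≠ 0 := by exact_mod_cast k.factorial_ne_zero
  have hp : ((k : ℝ) + 1) ^ (2 * θ) = ((k : ℝ) + 1) ^ (c + θ) / ((k : ℝ) + 1) ^ (c - θ) := by
    rw [← Real.rpow_sub hk1]
    congr 1
    ring
  have hp1 := (Real.rpow_pos_of_pos hk1 (c + θ)).ne'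
  have hp2 := (Real.rpow_pos_of_pos hk1 (c - θ)).ne'
  have hs : (k : ℝ) + c + θ ≠ 0 := by linarith
  rw [pairFactor, gammaRatio, gammaRatio, g1, g2, g3, hp]
  field_simp

theorem pairFactor_pos {θ d : ℝ} (hθ : 0 < θ) (hd : θ ≤ d) : 0 < pairFactor θ d :=
  div_pos (mul_pos (Real.Gamma_pos_of_pos (by linarith)) (Real.Gamma_pos_of_pos (by linarith)))
    (mul_pos (Real.Gamma_pos_of_pos (by linarith)) (Real.Gamma_pos_of_pos (by linarith)))

theorem exists_pairFactor_le {θ c : ℝ} (hθ : 0 < θ) (hc : θ ≤ c) :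
    ∃ C : ℝ, 0 < C ∧ ∀ k : ℕ, pairFactor θ (k + c) ≤ C * ((k : ℝ) + 1) ^ (2 * θ) := by
  obtain ⟨_, b₁, -, hb₁, h₁⟩ := exists_gammaRatio_bounds (s := c + θ) (by linarith)
  obtain ⟨a₂, _, ha₂, -, h₂⟩ := exists_gammaRatio_bounds (s := c - θ) (by linarith)
  refine ⟨b₁ / a₂ * 1, by positivity, fun k => ?_⟩
  have hk : (0 : ℝ) ≤ k := by positivity
  rw [pairFactor_eq hθ hc, mul_comm]
  refine mul_le_mul_of_nonneg_right (mul_le_mul ?_ ?_ ?_ (by positivity)) (by positivity)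
  · exact div_le_div₀ hb₁.le (h₁ k).2 ha₂ (h₂ k).1
  · exact div_le_one_of_le₀ (by linarith) (by linarith)
  · exact div_nonneg (by linarith) (by linarith)

theorem tendsto_pairFactor {θ c : ℝ} (hθ : 0 < θ) (hc : θ ≤ c) {w : ℝ} (hw : 0 < w)
    (hτ : Tendsto τ l atTop) {k : ι → ℕ}
    (hk : Tendsto (fun x => (k x : ℝ) / Real.sqrt (τ x)) l (𝓝 w)) :
    Tendsto (fun x => pairFactor θ (k x + c) / τ x ^ θ) l (𝓝 (w ^ (2 * θ))) := by
  have hs : Tendsto (fun x => Real.sqrt (τ x)) l atTop := Real.tendsto_sqrt_atTop.comp hτ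
  have h0 : Tendsto (fun x => (k x : ℝ)) l atTop := by
    have h1 := hk.pos_mul_atTop hw hs
    refine h1.congr' ?_
    filter_upwards [hs.eventually_gt_atTop 0] with x hx
    rw [div_mul_cancel₀ _ hx.ne']
  have h1 := tendsto_natCast_atTop_iff.1 h0
  have h2 := (tendsto_gammaRatio (s := c + θ) (by linarith)).comp h1
  have h3 := (tendsto_gammaRatio (s := c - θ) (by linarith)).comp h1
  have h4 : Tendsto (fun x => ((k x : ℝ) + c) / (k x + c + θ)) l (𝓝 1) := by
    have h5 : Tendsto (fun x => (k x : ℝ) + c + θ) l atTop :=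
      tendsto_atTop_add_const_right _ _ (tendsto_atTop_add_const_right _ _ h0)
    have h6 := (tendsto_const_nhds (x := θ)).div_atTop h5
    have h7 := (tendsto_const_nhds (x := (1 : ℝ))).sub h6
    rw [sub_zero] at h7
    refine h7.congr' ?_
    filter_upwards [h5.eventually_gt_atTop 0] with x hx
    rw [eq_div_iff hx.ne', sub_mul, div_mul_cancel₀ _ hx.ne']
    ring
  have h5 : Tendsto (fun x => ((k x : ℝ) + 1) / Real.sqrt (τ x)) l (𝓝 w) := by
    have h6 := hk.add ((tendsto_const_nhds (x := (1 : ℝ))).div_atTop hs)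
    rw [add_zero] at h6
    exact h6.congr fun x => (add_div _ _ _).symm
  have h6 := h5.rpow_const (p := 2 * θ) (Or.inl hw.ne')
  have h7 := h6.mul ((h2.div h3 one_ne_zero).mul h4)
  rw [div_one, mul_one, mul_one] at h7
  refine h7.congr' ?_
  filter_upwards [hτ.eventually_gt_atTop 0] with x hx
  have hk1 : (0 : ℝ) ≤ (k x : ℝ) + 1 := by positivity
  rw [pairFactor_eq hθ hc, Real.div_rpow hk1 (Real.sqrt_nonneg _), Real.sqrt_eq_rpow,
    ← Real.rpow_mul hx.le, (by ring : 1 / 2 * (2 * θ) = θ)]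
  simp only [Pi.div_apply, Function.comp_apply]
  ring

end Limits

end
end JackMeasures

namespace JackMeasures
open MvPolynomial
noncomputable section

/-! ### The rescaled density -/

theorem prod_pairs_const (a : ℝ) (N : ℕ) :
    ∏ i : Fin N, ∏ _j ∈ Finset.Ioi i, a = ∏ i : Fin N, a ^ (N - 1 - (i : ℕ)) :=
  Finset.prod_congr rfl fun i _ => by rw [Finset.prod_const, Fin.card_Ioi]

theorem prod_pairs_rev {N : ℕ} (F : Fin N → Fin N → ℝ) :
    ∏ i : Fin N, ∏ j ∈ Finset.Ioi i, F (Fin.rev i) (Fin.rev j) =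
      ∏ i : Fin N, ∏ j ∈ Finset.Ioi i, F j i := by
  have h : ∀ G : Fin N → Fin N → ℝ, ∏ i : Fin N, ∏ j ∈ Finset.Ioi i, G i j =
      ∏ i, ∏ j, if i < j then G i j else 1 := fun G => by
    refine Finset.prod_congr rfl fun i _ => ?_
    rw [← Finset.prod_filter]
    congr 1
    ext j
    simp
  rw [h fun i j => F (Fin.rev i) (Fin.rev j), h fun i j => F j i, Finset.prod_comm,
    ← Equiv.prod_comp Fin.revPerm]
  refine Finset.prod_congr rfl fun i _ => ?_
  rw [← Equiv.prod_comp Fin.revPerm]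
  refine Finset.prod_congr rfl fun j _ => ?_
  simp only [Fin.revPerm_apply, Fin.rev_rev, Fin.rev_lt_rev]

/-- The constant `∏ Γ(θ) / Γ(j θ)`. -/
def rowConst (θ : ℝ) (N : ℕ) : ℝ := ∏ i : Fin N, Real.Gamma θ / Real.Gamma (((N : ℝ) - (i : ℕ)) * θ)

theorem rowConst_pos {θ : ℝ} (hθ : 0 < θ) (N : ℕ) : 0 < rowConst θ N :=
  Finset.prod_pos fun i _ => div_pos (Real.Gamma_pos_of_pos hθ) (Real.Gamma_pos_of_pos (by
    have : ((i : ℕ) : ℝ) < N := by exact_mod_cast i.2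
    exact mul_pos (by linarith) hθ))

theorem rowConst_eq (θ : ℝ) (N : ℕ) :
    rowConst θ N = (∏ j ∈ Finset.Icc 1 N, Real.Gamma ((j : ℝ) * θ) / Real.Gamma θ)⁻¹ := by
  rw [← Finset.prod_inv_distrib, rowConst, ← Equiv.prod_comp Fin.revPerm]
  have h1 : ∏ j ∈ Finset.Icc 1 N, (Real.Gamma ((j : ℝ) * θ) / Real.Gamma θ)⁻¹ =
      ∏ j ∈ Finset.range N, (Real.Gamma (((j + 1 : ℕ) : ℝ) * θ) / Real.Gamma θ)⁻¹ := by
    rw [Finset.range_eq_Ico, Finset.prod_Ico_add' (fun j : ℕ => (Real.Gamma ((j : ℝ) * θ) / Real.Gamma θ)⁻¹)]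
    rfl
  rw [h1, Finset.prod_range]
  refine Finset.prod_congr rfl fun i _ => ?_
  rw [inv_div, Fin.revPerm_apply, Fin.val_rev, Nat.cast_sub (by omega)]
  congr 3
  push_cast
  ring

section

variable {θ : ℝ} (hθ : 0 < θ)

include hθ

/-- The factors Γ(l_i + θ) cancel between `binEval` at a = Nθ and `dualCoef`. `hookProd` enters
twice, once from J_λ(1^N) and once from Q_λ(𝔯_s), which completes the pair factors. -/
theorem latticeWeight_eq {N : ℕ} {μ : Fin N → ℕ} (hμ : Antitone μ) :
    latticeWeight θ N μ = rowConst θ N * (∏ i, (Real.Gamma (shiftedRow θ N μ i + 1))⁻¹) *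
      pairProd θ N (pairFactor θ) μ := by
  have h1 : ∏ i : Fin N, ∏ k ∈ Finset.range (μ i), ((N : ℝ) * θ - (i : ℕ) * θ + k) =
      ∏ i : Fin N, Real.Gamma (shiftedRow θ N μ i + θ) / Real.Gamma (((N : ℝ) - (i : ℕ)) * θ) := by
    refine Finset.prod_congr rfl fun i _ => ?_
    have h2 : ((i : ℕ) : ℝ) < N := by exact_mod_cast i.2
    have h3 : 0 < ((N : ℝ) - (i : ℕ)) * θ := mul_pos (by linarith) hθ
    rw [eq_div_iff (Real.Gamma_pos_of_pos h3).ne', mul_comm, ← sub_mul, prod_range_add_eq_gamma h3]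
    congr 1
    rw [shiftedRow]
    ring
  have h2 : pairProd θ N (pairFactor θ) μ = (pairProd θ N (fun d => Real.Gamma (d + 1 - θ) / Real.Gamma (d + 1)) μ *
      pairProd θ N (fun d => Real.Gamma d * Real.Gamma (d + 1) /
      (Real.Gamma (d + θ) * Real.Gamma (d + 1 - θ))) μ *
      pairProd θ N (fun d => Real.Gamma (d + 1 - θ) / Real.Gamma (d + 1)) μ)⁻¹ := by
    simp only [pairProd, ← Finset.prod_mul_distrib, ← Finset.prod_inv_distrib]
    refine Finset.prod_congr rfl fun i _ => Finset.prod_congr rfl fun j hj => ?_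
    have hd := le_shiftedRow_sub hθ hμ (Finset.mem_Ioi.1 hj)
    set d := shiftedRow θ N μ i - shiftedRow θ N μ j
    have g1 := (Real.Gamma_pos_of_pos (show 0 < d by linarith)).ne'
    have g2 := (Real.Gamma_pos_of_pos (show 0 < d + 1 by linarith)).ne'
    have g3 := (Real.Gamma_pos_of_pos (show 0 < d + θ by linarith)).ne'
    have g4 := (Real.Gamma_pos_of_pos (show 0 < d + 1 - θ by linarith)).ne'
    rw [pairFactor]
    field_simp
  have h3 : rowConst θ N * (∏ i, (Real.Gamma (shiftedRow θ N μ i + 1))⁻¹) =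
      (∏ i : Fin N, Real.Gamma (shiftedRow θ N μ i + θ) / Real.Gamma (((N : ℝ) - (i : ℕ)) * θ)) /
      ((∏ i, Real.Gamma (shiftedRow θ N μ i + 1)) * (∏ i, Real.Gamma (shiftedRow θ N μ i + θ) /
        (Real.Gamma θ * Real.Gamma (shiftedRow θ N μ i + 1))) *
        (∏ i, Real.Gamma (shiftedRow θ N μ i + 1))) := by
    rw [rowConst]
    simp only [← Finset.prod_mul_distrib, ← Finset.prod_div_distrib]
    refine Finset.prod_congr rfl fun i _ => ?_
    have hl := shiftedRow_nonneg hθ μ i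
    have g1 := (Real.Gamma_pos_of_pos (show 0 < shiftedRow θ N μ i + 1 by linarith)).ne'
    have g2 := (Real.Gamma_pos_of_pos (show 0 < shiftedRow θ N μ i + θ by linarith)).ne'
    have g3 := (Real.Gamma_pos_of_pos hθ).ne'
    field_simp
  rw [h2, h3, latticeWeight, binEval, h1, dualCoef, hookProd, div_div, div_div, div_mul_eq_mul_div,
    ← div_eq_mul_inv, div_div]
  congr 1
  ring

/-- The rescaled density as a product over rows and pairs of rows. -/
theorem latticeDensity_eq {N : ℕ} {τ : ℝ} (hτ : 0 < τ) {m : Fin N → ℤ} (hm : Monotone m)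
    (hm0 : ∀ k, 0 ≤ m k) :
    latticeDensity θ N τ m = (Real.sqrt τ ^ N)⁻¹ * rowConst θ N *
      (∏ i : Fin N, rowWeight (((N : ℝ) - 1 - (i : ℕ)) * θ) τ (rowsOf m i)) *
      ∏ i : Fin N, ∏ j ∈ Finset.Ioi i, pairFactor θ
        (shiftedRow θ N (rowsOf m) i - shiftedRow θ N (rowsOf m) j) / τ ^ θ := by
  -- Row i is the first member of N - 1 - i pairs, so the divisors τ^θ of the pairs compensate the
  -- powers τ^((N-1-i)θ) placed in the row weights.
  have h1 : ∏ i : Fin N, ∏ j ∈ Finset.Ioi i, pairFactor θ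
        (shiftedRow θ N (rowsOf m) i - shiftedRow θ N (rowsOf m) j) / τ ^ θ =
      pairProd θ N (pairFactor θ) (rowsOf m) / ∏ i : Fin N, τ ^ (((N : ℝ) - 1 - (i : ℕ)) * θ) := by
    simp only [Finset.prod_div_distrib]
    congr 1
    rw [prod_pairs_const]
    refine Finset.prod_congr rfl fun i _ => ?_
    rw [← natCast_rev, ← Real.rpow_natCast, ← Real.rpow_mul hτ.le, mul_comm]
  have h2 : ∏ i : Fin N, rowWeight (((N : ℝ) - 1 - (i : ℕ)) * θ) τ (rowsOf m i) =
      Real.sqrt τ ^ N * (τ ^ (∑ i, rowsOf m i) * (∏ i : Fin N, τ ^ (((N : ℝ) - 1 - (i : ℕ)) * θ)) *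
        Real.exp (-(N * τ))) * ∏ i, (Real.Gamma (shiftedRow θ N (rowsOf m) i + 1))⁻¹ := by
    have e1 : Real.sqrt τ ^ N = ∏ _i : Fin N, Real.sqrt τ := by simp
    have e2 : Real.exp (-(N * τ)) = ∏ _i : Fin N, Real.exp (-τ) := by
      rw [Finset.prod_const, Finset.card_univ, Fintype.card_fin, ← Real.exp_nat_mul]
      congr 1
      ring
    rw [e1, e2, ← Finset.prod_pow_eq_pow_sum]
    simp only [← Finset.prod_mul_distrib]
    refine Finset.prod_congr rfl fun i _ => ?_
    rw [rowWeight, shiftedRow]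
    rfl
  have h3 : ∏ i : Fin N, τ ^ (((N : ℝ) - 1 - (i : ℕ)) * θ) ≠ 0 :=
    (Finset.prod_pos fun i _ => Real.rpow_pos_of_pos hτ _).ne'
  have h4 : Real.sqrt τ ^ N ≠ 0 := pow_ne_zero _ (Real.sqrt_pos.2 hτ).ne'
  rw [latticeDensity, if_pos ⟨hm, hm0⟩, latticeWeight_eq hθ (rowsOf_antitone hm), h1, h2]
  generalize ∏ i : Fin N, τ ^ (((N : ℝ) - 1 - (i : ℕ)) * θ) = P at h3 ⊢
  field_simp

omit hθ in
theorem shiftedRow_sub_eq {N : ℕ} {μ : Fin N → ℕ} (hμ : Antitone μ) {i j : Fin N} (hij : i < j) :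
    shiftedRow θ N μ i - shiftedRow θ N μ j = ((μ i - μ j : ℕ) : ℝ) + (((j : ℕ) : ℝ) - (i : ℕ)) * θ := by
  rw [shiftedRow, shiftedRow, Nat.cast_sub (hμ hij.le)]
  ring

omit hθ in
theorem theta_le_of_lt (hθ : 0 < θ) {N : ℕ} {i j : Fin N} (hij : i < j) :
    θ ≤ (((j : ℕ) : ℝ) - (i : ℕ)) * θ := by
  have h : (((i : ℕ) + 1 : ℕ) : ℝ) ≤ (j : ℕ) := by exact_mod_cast hij
  push_cast at h
  nlinarith

/-! ### A uniform bound -/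

theorem exists_rowWeight_le_uniform (N : ℕ) : ∃ C : ℝ, 0 < C ∧ ∀ τ : ℝ, 1 ≤ τ → ∀ (i : Fin N) (m : ℕ),
    rowWeight (((N : ℝ) - 1 - (i : ℕ)) * θ) τ m ≤ C * Real.exp (-(|((m : ℝ) - τ) / Real.sqrt τ| / 4)) := by
  have hc : ∀ i : Fin N, 0 ≤ ((N : ℝ) - 1 - (i : ℕ)) * θ := fun i => by
    rw [← natCast_rev]; positivity
  choose C hC hC' using fun i : Fin N => exists_rowWeight_le (hc i)
  refine ⟨1 + ∑ i, C i, by have := Finset.sum_nonneg fun i (_ : i ∈ Finset.univ) => (hC i).le; linarith,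
    fun τ hτ i m => (hC' i τ hτ m).trans (mul_le_mul_of_nonneg_right ?_ (Real.exp_pos _).le)⟩
  have := Finset.single_le_sum (fun i _ => (hC i).le) (Finset.mem_univ i)
  linarith

theorem exists_pairFactor_le_uniform (N : ℕ) : ∃ C : ℝ, 0 < C ∧ ∀ (i j : Fin N), i < j → ∀ k : ℕ,
    pairFactor θ (k + (((j : ℕ) : ℝ) - (i : ℕ)) * θ) ≤ C * ((k : ℝ) + 1) ^ (2 * θ) := by
  choose C hC hC' using fun p : {p : Fin N × Fin N // p.1 < p.2} =>
    exists_pairFactor_le hθ (theta_le_of_lt hθ p.2)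
  refine ⟨1 + ∑ i, C i, by have := Finset.sum_nonneg fun i (_ : i ∈ Finset.univ) => (hC i).le; linarith,
    fun i j hij k => (hC' ⟨(i, j), hij⟩ k).trans (mul_le_mul_of_nonneg_right ?_ (by positivity))⟩
  have := Finset.single_le_sum (fun i _ => (hC i).le) (Finset.mem_univ (⟨(i, j), hij⟩ : {p : Fin N × Fin N // p.1 < p.2}))
  linarith

/-- Let S be the sum of the rescaled deviations. The rows give e^(-S/4). A rescaled difference of
rows is at most S, so a pair contributes at most a multiple of (1 + S)^(2θ), which is absorbed by
e^(S/(8N²)). At most N² pairs use up half of the decay. -/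
theorem exists_latticeDensity_le {N : ℕ} (hN : 1 ≤ N) : ∃ C : ℝ, 0 < C ∧ ∀ τ : ℝ, 1 ≤ τ →
    ∀ m : Fin N → ℤ, Real.sqrt τ ^ N * latticeDensity θ N τ m ≤
      C * Real.exp (-(∑ k, |((m k : ℝ) - τ) / Real.sqrt τ|) / 8) := by
  obtain ⟨C₁, hC₁, h₁⟩ := exists_rowWeight_le_uniform hθ N
  obtain ⟨C₂, hC₂, h₂⟩ := exists_pairFactor_le_uniform hθ N
  have hN0 : (0 : ℝ) < N := by exact_mod_cast hN
  obtain ⟨C₃, hC₃, h₃⟩ := rpow_le_mul_exp (K := 2 * θ) (δ := 1 / (8 * (N : ℝ) ^ 2)) (by positivity)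
  have hK := rowConst_pos hθ N
  -- D ≥ 1 allows the number of pairs to be rounded up to N².
  set D := max 1 (C₂ * C₃) with hD
  have hD1 : 1 ≤ D := le_max_left _ _
  refine ⟨rowConst θ N * C₁ ^ N * D ^ (N * N), by positivity, fun τ hτ m => ?_⟩
  have hτ0 : 0 < τ := by linarith
  have hsτ : 1 ≤ Real.sqrt τ := Real.one_le_sqrt.2 hτ
  by_cases hm : Monotone m ∧ ∀ k, 0 ≤ m k
  swap
  · rw [latticeDensity, if_neg hm, mul_zero]
    positivity
  obtain ⟨hm, hm0⟩ := hm
  set S := ∑ k, |((m k : ℝ) - τ) / Real.sqrt τ| with hS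
  have hS0 : 0 ≤ S := Finset.sum_nonneg fun _ _ => abs_nonneg _
  have hu : ∀ i, ((rowsOf m i : ℕ) : ℝ) = m (Fin.rev i) := fun i => by
    rw [rowsOf]
    exact_mod_cast Int.toNat_of_nonneg (hm0 _)
  have hS' : ∑ i, |((rowsOf m i : ℝ) - τ) / Real.sqrt τ| = S := by
    rw [hS, ← Equiv.sum_comp Fin.revPerm]
    exact Finset.sum_congr rfl fun i _ => by rw [hu, Fin.revPerm_apply, Fin.rev_rev]
  have e1 : ∏ i : Fin N, rowWeight (((N : ℝ) - 1 - (i : ℕ)) * θ) τ (rowsOf m i) ≤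
      C₁ ^ N * Real.exp (-S / 4) := by
    refine (Finset.prod_le_prod (fun i _ => rowWeight_nonneg (by rw [← natCast_rev]; positivity) hτ0 _)
      fun i _ => h₁ τ hτ i _).trans ?_
    rw [Finset.prod_mul_distrib, ← Real.exp_sum, Finset.prod_const, Finset.card_univ, Fintype.card_fin]
    rw [Finset.sum_neg_distrib, ← Finset.sum_div, hS', neg_div]
  have hτθ : (0 : ℝ) < τ ^ θ := Real.rpow_pos_of_pos hτ0 θ
  have e2 : ∀ i j : Fin N, i < j → pairFactor θ
      (shiftedRow θ N (rowsOf m) i - shiftedRow θ N (rowsOf m) j) / τ ^ θ ≤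
        D * Real.exp (S / (8 * (N : ℝ) ^ 2)) := by
    intro i j hij
    have hanti := rowsOf_antitone hm
    rw [shiftedRow_sub_eq hanti hij]
    have h4 := h₂ i j hij (rowsOf m i - rowsOf m j)
    have h5 : (((rowsOf m i - rowsOf m j : ℕ) : ℝ) + 1) / Real.sqrt τ ≤ 1 + S := by
      rw [Nat.cast_sub (hanti hij.le), add_div]
      have h6 : 1 / Real.sqrt τ ≤ 1 := div_le_one_of_le₀ hsτ (by linarith)
      have h7 : ((rowsOf m i : ℝ) - rowsOf m j) / Real.sqrt τ =
          ((rowsOf m i : ℝ) - τ) / Real.sqrt τ - ((rowsOf m j : ℝ) - τ) / Real.sqrt τ := by ring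
      have h8 : |((rowsOf m i : ℝ) - τ) / Real.sqrt τ| + |((rowsOf m j : ℝ) - τ) / Real.sqrt τ| ≤ S := by
        rw [← hS', ← Finset.sum_pair hij.ne (f := fun i => |((rowsOf m i : ℝ) - τ) / Real.sqrt τ|)]
        exact Finset.sum_le_sum_of_subset_of_nonneg (Finset.subset_univ _) fun _ _ _ => abs_nonneg _
      have h9 := le_abs_self (((rowsOf m i : ℝ) - τ) / Real.sqrt τ)
      have h10 := neg_abs_le (((rowsOf m j : ℝ) - τ) / Real.sqrt τ)
      linarith
    have h6 : τ ^ θ = Real.sqrt τ ^ (2 * θ) := by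
      rw [Real.sqrt_eq_rpow, ← Real.rpow_mul hτ0.le]
      congr 1
      ring
    have h7 := h₃ S hS0
    calc _ ≤ C₂ * (((rowsOf m i - rowsOf m j : ℕ) : ℝ) + 1) ^ (2 * θ) / τ ^ θ :=
          div_le_div_of_nonneg_right h4 hτθ.le
      _ = C₂ * ((((rowsOf m i - rowsOf m j : ℕ) : ℝ) + 1) / Real.sqrt τ) ^ (2 * θ) := by
          rw [Real.div_rpow (by positivity) (by linarith), h6, mul_div_assoc]
      _ ≤ C₂ * (1 + S) ^ (2 * θ) := by
          refine mul_le_mul_of_nonneg_left (Real.rpow_le_rpow ?_ h5 (by linarith)) hC₂.le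
          exact div_nonneg (by positivity) (by linarith)
      _ ≤ C₂ * (C₃ * Real.exp (1 / (8 * (N : ℝ) ^ 2) * S)) := mul_le_mul_of_nonneg_left h7 hC₂.le
      _ ≤ D * Real.exp (S / (8 * (N : ℝ) ^ 2)) := by
          rw [← mul_assoc, one_div_mul_eq_div]
          exact mul_le_mul_of_nonneg_right (le_max_right _ _) (Real.exp_pos _).le
  have hE : 1 ≤ D * Real.exp (S / (8 * (N : ℝ) ^ 2)) :=
    one_le_mul_of_one_le_of_one_le hD1 (Real.one_le_exp (by positivity))
  have e3 : ∏ i : Fin N, ∏ j ∈ Finset.Ioi i, pairFactor θ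
        (shiftedRow θ N (rowsOf m) i - shiftedRow θ N (rowsOf m) j) / τ ^ θ ≤
      D ^ (N * N) * Real.exp (S / 8) := by
    have hpos : ∀ i j : Fin N, i < j → 0 ≤ pairFactor θ
        (shiftedRow θ N (rowsOf m) i - shiftedRow θ N (rowsOf m) j) / τ ^ θ := fun i j hij =>
      div_nonneg (pairFactor_pos hθ (le_shiftedRow_sub hθ (rowsOf_antitone hm) hij)).le hτθ.le
    have h4 : ∀ i : Fin N, ∏ j ∈ Finset.Ioi i, pairFactor θ
        (shiftedRow θ N (rowsOf m) i - shiftedRow θ N (rowsOf m) j) / τ ^ θ ≤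
        (D * Real.exp (S / (8 * (N : ℝ) ^ 2))) ^ N := by
      intro i
      refine (Finset.prod_le_prod (fun j hj => hpos i j (Finset.mem_Ioi.1 hj))
        fun j hj => e2 i j (Finset.mem_Ioi.1 hj)).trans ?_
      rw [Finset.prod_const]
      refine pow_le_pow_right₀ hE ((Finset.card_le_univ _).trans_eq (Fintype.card_fin N))
    refine (Finset.prod_le_prod (fun i _ => Finset.prod_nonneg fun j hj => hpos i j (Finset.mem_Ioi.1 hj))
      fun i _ => h4 i).trans_eq ?_
    rw [Finset.prod_const, Finset.card_univ, Fintype.card_fin, ← pow_mul, mul_pow, ← Real.exp_nat_mul]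
    congr 2
    push_cast
    field_simp
  rw [latticeDensity_eq hθ hτ0 hm hm0]
  have h4 : Real.sqrt τ ^ N ≠ 0 := pow_ne_zero _ (by linarith)
  have h5 := mul_le_mul e1 e3 (Finset.prod_nonneg fun i _ => Finset.prod_nonneg fun j hj =>
    div_nonneg (pairFactor_pos hθ (le_shiftedRow_sub hθ (rowsOf_antitone hm) (Finset.mem_Ioi.1 hj))).le hτθ.le)
    (by positivity)
  have h6 := mul_le_mul_of_nonneg_left h5 hK.le
  calc _ = rowConst θ N * ((∏ i : Fin N, rowWeight (((N : ℝ) - 1 - (i : ℕ)) * θ) τ (rowsOf m i)) *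
      ∏ i : Fin N, ∏ j ∈ Finset.Ioi i, pairFactor θ
        (shiftedRow θ N (rowsOf m) i - shiftedRow θ N (rowsOf m) j) / τ ^ θ) := by
        rw [mul_assoc, mul_assoc, mul_inv_cancel_left₀ h4]
    _ ≤ _ := h6
    _ = rowConst θ N * C₁ ^ N * D ^ (N * N) * (Real.exp (-S / 4) * Real.exp (S / 8)) := by ring
    _ = _ := by
        rw [← Real.exp_add]
        congr 2
        ring

end
end
end JackMeasures

/-! ### Passage to the limit. -/

namespace JackMeasures
open MvPolynomial
noncomputable section

/-! ### Convergence to the Hermite ensemble -/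

theorem abs_cellIndex_sub_le {N : ℕ} {h : ℝ} (hh : 0 < h) (τ : ℝ) (y : Fin N → ℝ) (k : Fin N) :
    |h * ((cellIndex h τ y k : ℝ) - τ) - y k| ≤ h := by
  have h1 := Int.floor_le (τ + y k / h)
  have h2 := Int.lt_floor_add_one (τ + y k / h)
  have h3 : y k = h * (y k / h) := by field_simp
  rw [cellIndex, h3, ← mul_sub, abs_mul, abs_of_pos hh, ← h3]
  refine mul_le_of_le_one_right hh.le (abs_le.2 ⟨?_, ?_⟩) <;> linarith

theorem cellIndex_monotone {N : ℕ} {h : ℝ} (hh : 0 < h) (τ : ℝ) {y : Fin N → ℝ} (hy : Monotone y) :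
    Monotone (cellIndex h τ y) := fun _ _ hij =>
  Int.floor_mono (add_le_add le_rfl (div_le_div_of_nonneg_right (hy hij) hh.le))

theorem sqrt_div_eq {t ε : ℝ} (ht : 0 < t) : Real.sqrt (t / ε) = Real.sqrt t / Real.sqrt ε :=
  Real.sqrt_div ht.le ε

/-- The density at `y` of the rescaled Jack measure, smeared over the cells of the lattice. -/
def smearedDensity (θ t : ℝ) (N : ℕ) (ε : ℝ) (y : Fin N → ℝ) : ℝ :=
  (Real.sqrt ε ^ N)⁻¹ * latticeDensity θ N (t / ε) (cellIndex (Real.sqrt ε) (t / ε) y)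

/-- The point of the rescaled lattice below `y`. -/
def roundDown {N : ℕ} (t ε : ℝ) (y : Fin N → ℝ) (k : Fin N) : ℝ :=
  Real.sqrt ε * ((cellIndex (Real.sqrt ε) (t / ε) y k : ℝ) - t / ε)

theorem tendsto_roundDown {N : ℕ} (t : ℝ) (y : Fin N → ℝ) :
    Tendsto (fun ε => roundDown t ε y) (𝓝[>] 0) (𝓝 y) := by
  refine tendsto_pi_nhds.2 fun k => ?_
  have h1 : Tendsto (fun ε : ℝ => Real.sqrt ε) (𝓝[>] 0) (𝓝 0) := by
    have := (Real.continuous_sqrt.tendsto 0).mono_left (nhdsWithin_le_nhds (s := Set.Ioi 0))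
    rwa [Real.sqrt_zero] at this
  rw [tendsto_iff_dist_tendsto_zero]
  refine squeeze_zero' (Eventually.of_forall fun _ => dist_nonneg) ?_ h1
  filter_upwards [self_mem_nhdsWithin] with ε hε
  exact abs_cellIndex_sub_le (Real.sqrt_pos.2 hε) _ y k

theorem cellIndex_sub_div {N : ℕ} {t ε : ℝ} (ht : 0 < t) (hε : 0 < ε) (y : Fin N → ℝ) (k : Fin N) :
    ((cellIndex (Real.sqrt ε) (t / ε) y k : ℝ) - t / ε) / Real.sqrt (t / ε) =
      roundDown t ε y k / Real.sqrt t := by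
  have h1 := (Real.sqrt_pos.2 ht).ne'
  have h2 := (Real.sqrt_pos.2 hε).ne'
  rw [sqrt_div_eq ht, roundDown]
  field_simp

theorem inv_sqrt_pow_eq {t ε : ℝ} (ht : 0 < t) (hε : 0 < ε) (N : ℕ) :
    (Real.sqrt ε ^ N)⁻¹ = (Real.sqrt t ^ N)⁻¹ * Real.sqrt (t / ε) ^ N := by
  have h1 := (Real.sqrt_pos.2 ht).ne'
  have h2 := (Real.sqrt_pos.2 hε).ne'
  rw [sqrt_div_eq ht, div_pow]
  field_simp

theorem measurable_smearedDensity (θ t : ℝ) (N : ℕ) (ε : ℝ) : Measurable (smearedDensity θ t N ε) :=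
  ((measurable_of_countable (latticeDensity θ N (t / ε))).comp (measurable_cellIndex _ _)).const_mul _

theorem measurable_roundDown {N : ℕ} (t ε : ℝ) :
    Measurable (roundDown t ε : (Fin N → ℝ) → Fin N → ℝ) :=
  (measurable_of_countable fun (m : Fin N → ℤ) k => Real.sqrt ε * ((m k : ℝ) - t / ε)).comp
    (measurable_cellIndex _ _)

section

variable {θ : ℝ} (hθ : 0 < θ)

include hθ

/-- For s = t/(εθ) the parameter sθ is t/ε, and y ↦ t/ε + y/√ε inverts the rescaling, so the sum
over diagrams is an integral over cells of side √ε. -/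
theorem integral_jackMeasure_eq_integral {t ε : ℝ} (ht : 0 < t) (hε : 0 < ε) {N : ℕ}
    {f : (Fin N → ℝ) → ℝ} (hf : Continuous f) {M : ℝ} (hM : ∀ y, ‖f y‖ ≤ M) :
    ∫ y, f y ∂(Measure.map (rescaledRows N t ε)
      (jackMeasure θ (alphaSpecialization θ 1 N) (plancherelSpecialization θ (ε⁻¹ * (t / θ))))) =
    ∫ y, smearedDensity θ t N ε y * f (roundDown t ε y) := by
  have hs : 0 ≤ ε⁻¹ * (t / θ) := by positivity
  have h1 : ε⁻¹ * (t / θ) * θ = t / ε := by field_simp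
  have h2 := Real.sqrt_pos.2 hε
  have hsum := summable_latticeDensity hθ hs N
  rw [integral_jackMeasure hθ hs hf hM t ε, h1]
  rw [h1] at hsum
  have hG : Summable fun m : Fin N → ℤ => latticeDensity θ N (t / ε) m *
      f fun k => Real.sqrt ε * ((m k : ℝ) - t / ε) := by
    refine Summable.of_norm_bounded (hsum.mul_right M) fun m => ?_
    rw [norm_mul, Real.norm_of_nonneg (latticeDensity_nonneg hθ (by positivity) m)]
    exact mul_le_mul_of_nonneg_left (hM _) (latticeDensity_nonneg hθ (by positivity) m)
  have h3 := integral_cellIndex h2 (t / ε) hG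
  simp only [smearedDensity, mul_assoc]
  rw [integral_const_mul]
  change _ = _ * ∫ y, latticeDensity θ N (t / ε) (cellIndex (Real.sqrt ε) (t / ε) y) *
    f (fun k => Real.sqrt ε * ((cellIndex (Real.sqrt ε) (t / ε) y k : ℝ) - t / ε))
  rw [h3, inv_mul_cancel_left₀ (pow_ne_zero _ h2.ne')]

/-- For ε ≤ t the parameter t/ε is at least 1, as the lattice bound requires. Replacing the lattice
point by y costs at most √ε ≤ √t in each coordinate, hence a factor e^(N/8) in all. -/
theorem exists_smearedDensity_le {t : ℝ} (ht : 0 < t) {N : ℕ} (hN : 1 ≤ N) : ∃ C : ℝ, 0 < C ∧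
    ∀ ε : ℝ, 0 < ε → ε ≤ t → ∀ y : Fin N → ℝ,
      smearedDensity θ t N ε y ≤ C * ∏ k, Real.exp (-(1 / (8 * Real.sqrt t)) * |y k|) := by
  obtain ⟨C, hC, h⟩ := exists_latticeDensity_le hθ hN
  have h1 := Real.sqrt_pos.2 ht
  refine ⟨(Real.sqrt t ^ N)⁻¹ * (C * Real.exp (N / 8)), by positivity, fun ε hε hεt y => ?_⟩
  rw [smearedDensity, inv_sqrt_pow_eq ht hε, mul_assoc, mul_assoc]
  refine mul_le_mul_of_nonneg_left ((h _ ((one_le_div hε).2 hεt) _).trans ?_) (by positivity)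
  rw [mul_assoc, ← Real.exp_sum, ← Real.exp_add]
  refine mul_le_mul_of_nonneg_left (Real.exp_le_exp.2 ?_) hC.le
  have h2 : ∑ k : Fin N, (|y k| / Real.sqrt t - 1) ≤ ∑ k : Fin N,
      |((cellIndex (Real.sqrt ε) (t / ε) y k : ℝ) - t / ε) / Real.sqrt (t / ε)| := by
    refine Finset.sum_le_sum fun k _ => ?_
    rw [cellIndex_sub_div ht hε, abs_div, abs_of_pos h1, sub_le_iff_le_add, div_add_one h1.ne']
    refine div_le_div_of_nonneg_right ?_ h1.le
    have h3 : |roundDown t ε y k - y k| ≤ _ := abs_cellIndex_sub_le (Real.sqrt_pos.2 hε) (t / ε) y k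
    have h4 := Real.sqrt_le_sqrt hεt
    have h5 := abs_sub_abs_le_abs_sub (y k) (roundDown t ε y k)
    rw [abs_sub_comm] at h5
    linarith
  rw [Finset.sum_sub_distrib, Finset.sum_const, Finset.card_univ, Fintype.card_fin, nsmul_eq_mul,
    mul_one, ← Finset.sum_div] at h2
  rw [← Finset.mul_sum]
  have h6 : -(1 / (8 * Real.sqrt t)) * ∑ k, |y k| = -((∑ k, |y k|) / Real.sqrt t) / 8 := by
    field_simp
  rw [h6]
  linarith

omit hθ in
theorem tendsto_div_nhdsGT_zero {t : ℝ} (ht : 0 < t) :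
    Tendsto (fun ε : ℝ => t / ε) (𝓝[>] 0) atTop :=
  tendsto_inv_nhdsGT_zero.const_mul_atTop ht

omit hθ in
-- Splits Z into the constants produced by the limit: √t for each coordinate from the mesh, t^θ for
-- each of the N(N-1)/2 pairs, and √(2π) together with the ratios of Γ(jθ) and Γ(θ) from the rows.
-- Rows decrease while y increases, hence the reversals.
theorem hermiteDensity_eq {t : ℝ} (ht : 0 < t) {N : ℕ} {y : Fin N → ℝ} (hy : StrictMono y) :
    hermiteDensity θ t N y = (Real.sqrt t ^ N)⁻¹ * (rowConst θ N *
      (∏ i : Fin N, 1 / Real.sqrt (2 * Real.pi) *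
        Real.exp (-((y (Fin.rev i) / Real.sqrt t) ^ 2 / 2))) *
      ∏ i : Fin N, ∏ j ∈ Finset.Ioi i, ((y (Fin.rev i) - y (Fin.rev j)) / Real.sqrt t) ^ (2 * θ)) := by
  have h1 := Real.sqrt_pos.2 ht
  have e1 := prod_pairs_rev fun i j => ((y i - y j) / Real.sqrt t) ^ (2 * θ)
  have e2 : ∏ i : Fin N, ∏ j ∈ Finset.Ioi i, ((y j - y i) / Real.sqrt t) ^ (2 * θ) =
      (∏ i : Fin N, ∏ j ∈ Finset.Ioi i, (y j - y i) ^ (2 * θ)) /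
        t ^ (θ * ((N : ℝ) * ((N : ℝ) - 1) / 2)) := by
    have e3 : ∏ i : Fin N, ∏ j ∈ Finset.Ioi i, ((y j - y i) / Real.sqrt t) ^ (2 * θ) =
        ∏ i : Fin N, ∏ j ∈ Finset.Ioi i, (y j - y i) ^ (2 * θ) / t ^ θ := by
      refine Finset.prod_congr rfl fun i _ => Finset.prod_congr rfl fun j hj => ?_
      rw [Real.div_rpow (sub_nonneg.2 (hy.monotone (Finset.mem_Ioi.1 hj).le)) h1.le,
        Real.sqrt_eq_rpow, ← Real.rpow_mul ht.le]
      congr 2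
      ring
    rw [e3]
    simp only [Finset.prod_div_distrib]
    congr 1
    rw [prod_pairs_const, Finset.prod_pow_eq_pow_sum, ← Real.rpow_natCast, ← Real.rpow_mul ht.le]
    congr 2
    have e4 : ∑ i : Fin N, (N - 1 - (i : ℕ)) = N * (N - 1) / 2 := by
      rw [Fin.sum_univ_eq_sum_range fun i => N - 1 - i, Finset.sum_range_reflect (fun i => i),
        Finset.sum_range_id]
    rw [e4, Nat.cast_div (Nat.even_mul_pred_self N).two_dvd (by norm_num), Nat.cast_mul]
    rcases N with _ | n
    · simp
    · push_cast
      simp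
  have e5 : ∏ i : Fin N, 1 / Real.sqrt (2 * Real.pi) *
        Real.exp (-((y (Fin.rev i) / Real.sqrt t) ^ 2 / 2)) =
      (Real.sqrt (2 * Real.pi) ^ N)⁻¹ * ∏ i : Fin N, Real.exp (-(y i ^ 2 / (2 * t))) := by
    rw [Finset.prod_mul_distrib, Finset.prod_const, Finset.card_univ, Fintype.card_fin, one_div, inv_pow,
      ← Equiv.prod_comp Fin.revPerm fun i => Real.exp (-(y i ^ 2 / (2 * t)))]
    congr 1
    refine Finset.prod_congr rfl fun i _ => ?_
    rw [div_pow, Real.sq_sqrt ht.le, Fin.revPerm_apply, div_div, mul_comm t]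
  have e6 : ∀ x : ℝ, 0 ≤ x → x ^ ((N : ℝ) / 2) = Real.sqrt x ^ N := fun x hx => by
    rw [Real.sqrt_eq_rpow, ← Real.rpow_natCast, ← Real.rpow_mul hx]
    congr 1
    ring
  rw [e1, e2, e5, rowConst_eq, hermiteDensity, hermiteZ, Real.rpow_add ht, e6 t ht.le,
    e6 _ (by positivity)]
  have h2 : t ^ (θ * ((N : ℝ) * ((N : ℝ) - 1) / 2)) ≠ 0 := (Real.rpow_pos_of_pos ht _).ne'
  simp only [mul_inv, div_eq_mul_inv]
  ring

theorem tendsto_smearedDensity {t : ℝ} (ht : 0 < t) {N : ℕ} {y : Fin N → ℝ} (hy : StrictMono y) :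
    Tendsto (fun ε => smearedDensity θ t N ε y) (𝓝[>] 0) (𝓝 (hermiteDensity θ t N y)) := by
  have h1 := Real.sqrt_pos.2 ht
  have hτ := tendsto_div_nhdsGT_zero ht
  have hpos : ∀ᶠ ε : ℝ in 𝓝[>] 0, 0 < ε := self_mem_nhdsWithin
  have hv : ∀ k, Tendsto (fun ε => ((cellIndex (Real.sqrt ε) (t / ε) y k : ℝ) - t / ε) /
      Real.sqrt (t / ε)) (𝓝[>] 0) (𝓝 (y k / Real.sqrt t)) := fun k =>
    ((tendsto_pi_nhds.1 (tendsto_roundDown t y) k).div_const _).congr'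
      (hpos.mono fun ε hε => (cellIndex_sub_div ht hε y k).symm)
  -- The deviations converge on the scale √(t/ε), so the rows tend to infinity with t/ε, and the
  -- truncation at 0 in `rowsOf` is eventually harmless.
  have hm0 : ∀ᶠ ε : ℝ in 𝓝[>] 0, ∀ k, 0 ≤ cellIndex (Real.sqrt ε) (t / ε) y k := by
    refine eventually_all.2 fun k => ?_
    filter_upwards [((hv k).add_atTop (Real.tendsto_sqrt_atTop.comp hτ)).eventually_ge_atTop 0,
      hpos] with ε hε hε0
    have h2 : 0 < t / ε := div_pos ht hε0
    have h3 := Real.sqrt_pos.2 h2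
    have h4 := mul_nonneg h3.le hε
    have h5 : ((cellIndex (Real.sqrt ε) (t / ε) y k : ℝ)) = Real.sqrt (t / ε) *
        (((cellIndex (Real.sqrt ε) (t / ε) y k : ℝ) - t / ε) / Real.sqrt (t / ε) +
          Real.sqrt (t / ε)) := by
      rw [mul_add, mul_div_cancel₀ _ h3.ne', Real.mul_self_sqrt h2.le]
      ring
    rw [Function.comp_apply, ← h5] at h4
    exact_mod_cast h4
  have hu : ∀ i, ∀ᶠ ε : ℝ in 𝓝[>] 0, ((rowsOf (cellIndex (Real.sqrt ε) (t / ε) y) i : ℕ) : ℝ) =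
      cellIndex (Real.sqrt ε) (t / ε) y (Fin.rev i) := fun i => hm0.mono fun ε hε => by
    rw [rowsOf]
    exact_mod_cast Int.toNat_of_nonneg (hε _)
  have hr : ∀ i : Fin N, Tendsto (fun ε => rowWeight (((N : ℝ) - 1 - (i : ℕ)) * θ) (t / ε)
      (rowsOf (cellIndex (Real.sqrt ε) (t / ε) y) i)) (𝓝[>] 0)
      (𝓝 (1 / Real.sqrt (2 * Real.pi) * Real.exp (-((y (Fin.rev i) / Real.sqrt t) ^ 2 / 2)))) :=
    fun i => tendsto_rowWeight (by rw [← natCast_rev]; positivity) hτ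
      ((hv (Fin.rev i)).congr' ((hu i).mono fun ε hε => by simp only [hε]))
  have hp : ∀ i : Fin N, ∀ j ∈ Finset.Ioi i, Tendsto (fun ε => pairFactor θ
      (shiftedRow θ N (rowsOf (cellIndex (Real.sqrt ε) (t / ε) y)) i -
        shiftedRow θ N (rowsOf (cellIndex (Real.sqrt ε) (t / ε) y)) j) / (t / ε) ^ θ) (𝓝[>] 0)
      (𝓝 (((y (Fin.rev i) - y (Fin.rev j)) / Real.sqrt t) ^ (2 * θ))) := by
    intro i j hj
    have hij := Finset.mem_Ioi.1 hj
    have hanti : ∀ᶠ ε : ℝ in 𝓝[>] 0, Antitone (rowsOf (cellIndex (Real.sqrt ε) (t / ε) y)) :=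
      hpos.mono fun ε hε => rowsOf_antitone (cellIndex_monotone (Real.sqrt_pos.2 hε) _ hy.monotone)
    refine (tendsto_pairFactor hθ (theta_le_of_lt hθ hij)
      (div_pos (sub_pos.2 (hy (Fin.rev_lt_rev.2 hij))) h1) hτ
      (k := fun ε => rowsOf (cellIndex (Real.sqrt ε) (t / ε) y) i -
        rowsOf (cellIndex (Real.sqrt ε) (t / ε) y) j) ?_).congr' ?_
    · rw [sub_div]
      refine ((hv (Fin.rev i)).sub (hv (Fin.rev j))).congr' ?_
      filter_upwards [hanti, hu i, hu j] with ε h2 h3 h4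
      rw [Nat.cast_sub (h2 hij.le), h3, h4]
      ring
    · exact hanti.mono fun ε h2 => by simp only [shiftedRow_sub_eq h2 hij]
  rw [hermiteDensity_eq ht hy]
  refine (((((tendsto_finsetProd _ fun i _ => hr i).const_mul (rowConst θ N)).mul
    (tendsto_finsetProd _ fun i _ => tendsto_finsetProd _ fun j hj => hp i j hj))).const_mul
      (Real.sqrt t ^ N)⁻¹).congr' ?_
  filter_upwards [hpos, hm0] with ε hε h2
  have h3 : 0 < t / ε := div_pos ht hε
  rw [smearedDensity, inv_sqrt_pow_eq ht hε, latticeDensity_eq hθ h3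
    (cellIndex_monotone (Real.sqrt_pos.2 hε) _ hy.monotone) h2, mul_assoc (Real.sqrt t ^ N)⁻¹]
  congr 1
  rw [mul_assoc (Real.sqrt (t / ε) ^ N)⁻¹, mul_assoc (Real.sqrt (t / ε) ^ N)⁻¹,
    mul_inv_cancel_left₀ (pow_ne_zero _ (Real.sqrt_pos.2 h3).ne')]

omit hθ in
theorem smearedDensity_eventually_eq_zero {t : ℝ} {N : ℕ} {y : Fin N → ℝ}
    {i j : Fin N} (hij : i < j) (hy : y j < y i) :
    ∀ᶠ ε : ℝ in 𝓝[>] 0, smearedDensity θ t N ε y = 0 := by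
  have h1 := tendsto_pi_nhds.1 (tendsto_roundDown t y)
  filter_upwards [(h1 j).eventually_lt (h1 i) hy, self_mem_nhdsWithin] with ε hε hε0
  rw [smearedDensity, latticeDensity, if_neg, mul_zero]
  rintro ⟨h2, -⟩
  have h3 : ((cellIndex (Real.sqrt ε) (t / ε) y i : ℤ) : ℝ) ≤ cellIndex (Real.sqrt ε) (t / ε) y j := by
    exact_mod_cast h2 hij.le
  refine absurd hε (not_lt.2 (mul_le_mul_of_nonneg_left ?_ (Real.sqrt_nonneg ε)))
  linarith

omit hθ in
-- The walls y_i = y_j are kernels of nonzero functionals, hence null. Pointwise convergence is then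
-- needed only strictly inside the chamber and strictly outside it.
theorem ae_injective (N : ℕ) : ∀ᵐ y : Fin N → ℝ, Function.Injective y := by
  have h : ∀ p : Fin N × Fin N, ∀ᵐ y : Fin N → ℝ, p.1 ≠ p.2 → y p.1 ≠ y p.2 := by
    rintro ⟨i, j⟩
    by_cases hij : i = j
    · exact Eventually.of_forall fun y h => absurd hij h
    let D : (Fin N → ℝ) →ₗ[ℝ] ℝ := LinearMap.proj (R := ℝ) (φ := fun _ => ℝ) i -
      LinearMap.proj (R := ℝ) (φ := fun _ => ℝ) j
    have h1 := Measure.addHaar_submodule (volume : Measure (Fin N → ℝ)) (LinearMap.ker D) (fun h => by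
        have h2 : D (Pi.single i 1) = 0 := LinearMap.mem_ker.1 (Submodule.eq_top_iff'.1 h _)
        simp [D, Ne.symm hij] at h2)
    refine measure_mono_null (fun y hy => ?_) h1
    simpa [D, sub_eq_zero, hij] using hy
  filter_upwards [ae_all_iff.2 h] with y hy i j hij
  by_contra hne
  exact hy (i, j) hne hij

omit hθ in
theorem measurableSet_weylChamber (N : ℕ) : MeasurableSet (weylChamber N) := by
  have : weylChamber N = ⋂ i : Fin N, ⋂ j : Fin N, ⋂ _ : i < j, {y | y i < y j} := by
    ext y
    simp [weylChamber, StrictMono]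
  rw [this]
  exact MeasurableSet.iInter fun i => MeasurableSet.iInter fun j => MeasurableSet.iInter fun _ =>
    measurableSet_lt (measurable_pi_apply i) (measurable_pi_apply j)

omit hθ in
theorem closure_weylChamber_ae_eq (N : ℕ) :
    (closure (weylChamber N) : Set (Fin N → ℝ)) =ᵐ[volume] weylChamber N := by
  have h1 : closure (weylChamber N) ⊆ {y | Monotone y} :=
    closure_minimal (fun y hy => StrictMono.monotone hy) (by
      have : {y : Fin N → ℝ | Monotone y} = ⋂ i : Fin N, ⋂ j : Fin N, ⋂ _ : i ≤ j, {y | y i ≤ y j} := by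
        ext y
        simp [Monotone]
      rw [this]
      exact isClosed_iInter fun i => isClosed_iInter fun j => isClosed_iInter fun _ =>
        isClosed_le (continuous_apply i) (continuous_apply j))
  filter_upwards [ae_injective N] with y hy
  exact propext ⟨fun h => (h1 h).strictMono_of_injective hy, fun h => subset_closure h⟩

theorem hermiteDensity_nonneg {t : ℝ} (ht : 0 < t) {N : ℕ} {y : Fin N → ℝ} (hy : StrictMono y) :
    0 ≤ hermiteDensity θ t N y := by
  rw [hermiteDensity_eq ht hy]
  have h1 := rowConst_pos hθ N
  have h2 : 0 ≤ ∏ i : Fin N, ∏ j ∈ Finset.Ioi i,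
      ((y (Fin.rev i) - y (Fin.rev j)) / Real.sqrt t) ^ (2 * θ) :=
    Finset.prod_nonneg fun i _ => Finset.prod_nonneg fun j hj => Real.rpow_nonneg
      (div_nonneg (sub_nonneg.2 (hy.monotone (Fin.rev_le_rev.2 (Finset.mem_Ioi.1 hj).le)))
        (Real.sqrt_nonneg t)) _
  positivity

omit hθ in
theorem measurable_hermiteDensity (θ t : ℝ) (N : ℕ) : Measurable (hermiteDensity θ t N) := by
  unfold hermiteDensity
  refine (Measurable.const_mul ?_ _).mul ?_
  · refine Finset.measurable_prod _ fun i _ => Finset.measurable_prod _ fun j _ => ?_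
    exact ((measurable_pi_apply j).sub (measurable_pi_apply i)).pow_const _
  · refine Finset.measurable_prod _ fun i _ => Real.measurable_exp.comp ?_
    exact (((measurable_pi_apply i).pow_const 2).div_const _).neg

theorem integral_hermiteMeasure {t : ℝ} (ht : 0 < t) {N : ℕ} (f : (Fin N → ℝ) → ℝ) :
    ∫ y, f y ∂(hermiteMeasure θ t N) =
      ∫ y, (weylChamber N).indicator (fun y => hermiteDensity θ t N y * f y) y := by
  rw [hermiteMeasure, Measure.restrict_congr_set (closure_weylChamber_ae_eq N),
    integral_withDensity_eq_integral_toReal_smul (measurable_hermiteDensity θ t N).ennreal_ofReal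
      (Eventually.of_forall fun _ => ENNReal.ofReal_lt_top),
    integral_indicator (measurableSet_weylChamber N)]
  refine setIntegral_congr_fun (measurableSet_weylChamber N) fun y hy => ?_
  simp only [ENNReal.toReal_ofReal (hermiteDensity_nonneg hθ ht hy), smul_eq_mul]

omit hθ in
theorem integrable_exp_neg_mul_abs {b : ℝ} (hb : 0 < b) :
    Integrable fun x : ℝ => Real.exp (-b * |x|) := by
  rw [← integrableOn_univ, ← Set.Iic_union_Ioi (a := (0 : ℝ))]
  refine IntegrableOn.union ?_ ?_
  · refine (integrableOn_exp_mul_Iic hb 0).congr_fun (fun x hx => ?_) measurableSet_Iic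
    simp only [abs_of_nonpos (Set.mem_Iic.1 hx), neg_mul_neg]
  · refine (integrableOn_exp_mul_Ioi (neg_lt_zero.2 hb) 0).congr_fun (fun x hx => ?_) measurableSet_Ioi
    simp only [abs_of_pos (Set.mem_Ioi.1 hx)]

/-- The rescaled Jack measures converge to the Hermite ensemble. -/
theorem tendsto_integral_jackMeasure {t : ℝ} (ht : 0 < t) {N : ℕ} (hN : 1 ≤ N)
    {f : (Fin N → ℝ) → ℝ} (hf : Continuous f) {M : ℝ} (hM : ∀ y, ‖f y‖ ≤ M) :
    Tendsto (fun ε : ℝ => ∫ y, f y ∂(Measure.map (rescaledRows N t ε)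
      (jackMeasure θ (alphaSpecialization θ 1 N) (plancherelSpecialization θ (ε⁻¹ * (t / θ))))))
      (𝓝[>] 0) (𝓝 (∫ y, f y ∂(hermiteMeasure θ t N))) := by
  have hpos : ∀ᶠ ε : ℝ in 𝓝[>] 0, 0 < ε := self_mem_nhdsWithin
  obtain ⟨C, hC, hb⟩ := exists_smearedDensity_le hθ ht hN
  rw [integral_hermiteMeasure hθ ht]
  refine Tendsto.congr' (hpos.mono fun ε hε => (integral_jackMeasure_eq_integral hθ ht hε hf hM).symm) ?_
  refine tendsto_integral_filter_of_dominated_convergence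
    (fun y => C * (∏ k, Real.exp (-(1 / (8 * Real.sqrt t)) * |y k|)) * M) ?_ ?_ ?_ ?_
  · exact Eventually.of_forall fun ε => ((measurable_smearedDensity θ t N ε).mul
      (hf.measurable.comp (measurable_roundDown t ε))).aestronglyMeasurable
  · filter_upwards [hpos, Ioc_mem_nhdsGT ht] with ε hε hεt
    refine Eventually.of_forall fun y => ?_
    have h1 : 0 ≤ smearedDensity θ t N ε y :=
      mul_nonneg (by positivity) (latticeDensity_nonneg hθ (by positivity) _)
    rw [norm_mul, Real.norm_of_nonneg h1]
    exact mul_le_mul (hb ε hε hεt.2 y) (hM _) (norm_nonneg _) (by positivity)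
  · refine (Integrable.const_mul ?_ C).mul_const M
    exact Integrable.fintype_prod fun _ => integrable_exp_neg_mul_abs
      (one_div_pos.2 (mul_pos (by norm_num) (Real.sqrt_pos.2 ht)))
  · filter_upwards [ae_injective N] with y hy
    by_cases hs : StrictMono y
    · rw [Set.indicator_of_mem (show y ∈ weylChamber N from hs)]
      exact (tendsto_smearedDensity hθ ht hs).mul ((hf.tendsto y).comp (tendsto_roundDown t y))
    · rw [Set.indicator_of_notMem (show y ∉ weylChamber N from hs)]
      -- Off the walls, a point outside the open chamber has a strict inversion, which its lattice
      -- cell inherits for small ε.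
      have h1 : ∃ i j, i < j ∧ y j < y i := by
        by_contra! h
        exact hs (Monotone.strictMono_of_injective (fun i j hij =>
          hij.eq_or_lt.elim (fun e => e ▸ le_rfl) (h i j)) hy)
      obtain ⟨i, j, hij, hlt⟩ := h1
      refine tendsto_const_nhds.congr' ((smearedDensity_eventually_eq_zero (θ := θ) (t := t) hij hlt).mono fun ε hε => ?_)
      simp only [hε, zero_mul]

/-- The convergence theorem with the test function 1: the approximating measures have mass 1, hence
so does the limit. The Mehta-type integral behind Z comes out as a by-product. -/
theorem isProbabilityMeasure_hermiteMeasure {t : ℝ} (ht : 0 < t) {N : ℕ} (hN : 1 ≤ N) :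
    IsProbabilityMeasure (hermiteMeasure θ t N) := by
  have h1 := tendsto_integral_jackMeasure hθ ht hN (f := fun _ => 1) continuous_const
    (M := 1) (fun _ => by simp)
  have h2 : Tendsto (fun ε : ℝ => ∫ _y, (1 : ℝ) ∂(Measure.map (rescaledRows N t ε)
      (jackMeasure θ (alphaSpecialization θ 1 N) (plancherelSpecialization θ (ε⁻¹ * (t / θ))))))
      (𝓝[>] 0) (𝓝 1) := by
    refine tendsto_const_nhds.congr' ?_
    filter_upwards [self_mem_nhdsWithin] with ε hε
    have hε' : (0 : ℝ) < ε := hε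
    have := isProbabilityMeasure_jackMeasure hθ (s := ε⁻¹ * (t / θ)) (by positivity) N
    have hmeas : Measurable (rescaledRows N t ε) := fun _ _ => trivial
    have := Measure.isProbabilityMeasure_map (μ := jackMeasure θ (alphaSpecialization θ 1 N)
      (plancherelSpecialization θ (ε⁻¹ * (t / θ)))) hmeas.aemeasurable
    simp
  have h3 := tendsto_nhds_unique h1 h2
  rw [integral_const, smul_eq_mul, mul_one, Measure.real, ENNReal.toReal_eq_one_iff] at h3
  exact ⟨h3⟩

end

end
end JackMeasures
/-- Weak convergence of the rescaled Jack measures at a fixed time to the Hermite ensemble. -/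
theorem proposition2p8 (θ : ℝ) (hθ : 0 < θ) (t : ℝ) (ht : 0 < t) (N : ℕ) (hN : 1 ≤ N) :
    (∀ ε : ℝ, 0 < ε → IsProbabilityMeasure
      (JackMeasures.jackMeasure θ (JackMeasures.alphaSpecialization θ 1 N)
        (JackMeasures.plancherelSpecialization θ (ε⁻¹ * (t / θ))))) ∧
    IsProbabilityMeasure (JackMeasures.hermiteMeasure θ t N) ∧
    ∀ f : BoundedContinuousFunction (Fin N → ℝ) ℝ,
      Tendsto
        (fun ε : ℝ => ∫ y, f y ∂(Measure.map (JackMeasures.rescaledRows N t ε)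
          (JackMeasures.jackMeasure θ (JackMeasures.alphaSpecialization θ 1 N)
            (JackMeasures.plancherelSpecialization θ (ε⁻¹ * (t / θ))))))
        (𝓝[>] 0)
        (𝓝 (∫ y, f y ∂(JackMeasures.hermiteMeasure θ t N))) := by
  refine ⟨fun ε hε => ?_, JackMeasures.isProbabilityMeasure_hermiteMeasure hθ ht hN, fun f => ?_⟩
  · exact JackMeasures.isProbabilityMeasure_jackMeasure hθ (by positivity) N
  · exact JackMeasures.tendsto_integral_jackMeasure hθ ht hN f.continuous f.norm_coe_le_norm
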